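/- Let $d\in\{2,3\}$, $\Omega=(0,1)^d$, $T>0$. Let $(\mathsf u,\mathsf p)$ solve the time-dependent Stokes problem $\partial_t\mathsf u-\Delta\mathsf u+\nabla\mathsf p=f$ in $\Omega\times(0,T]$, $\nabla\cdot\mathsf u=0$ in $\Omega\times[0,T]$, $\mathsf u|_{\partial\Omega}=0$, $\mathsf u|_{t=0}=\mathsf u_0$, where $\mathsf p(t)$ has zero mean. *Operators.* For a set $S$ of coordinate directions let $\partial_S=\prod_{i\in S}\partial_i$. Let $A=\prod_{i=1}^d(1-\partial_{ii})$ with homogeneous Neumann conditions in each direction: in two dimensions $A=(1-\partial_{xx})(1-\partial_{yy})$ with $D(A)$ the set of zero-mean $q\in L^2(\Omega)$ such that $\partial_{yy}q,Aq\in L^2(\Omega)$, $\partial_yq|_{y=0,1}=0$, $\partial_x(1-\partial_{yy})q|_{x=0,1}=0$, and analogously in three dimensions. Let $Y$ be the space of zero-mean $q\in L^2(\Omega)$ with $\partial_Sq\in L^2(\Omega)$ for all $S$, with norm $\|q\|_A=\big(\sum_S\|\partial_Sq\|_{L^2}^2\big)^{1/2}$, the extension of $\langle Aq,q\rangle^{1/2}$.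 For $\tau>0$ let $B=B_\tau=\partial_{xxyy}$ if $d=2$ and $B=B_\tau=\partial_{xxyy}+\partial_{yyzz}+\partial_{zzxx}-\frac\tau2\partial_{xxyyzz}$ if $d=3$, with $D(B)=\{v\in H^1_0(\Omega)^d: Bv\in L^2(\Omega)^d\}$ carrying the graph norm, and $\|v\|_B=\langle v,Bv\rangle^{1/2}$. Put $\|v\|_{H^1}=\|\nabla v\|_{L^2}$. *Scheme (standard form, $\chi=0$).* Let $\tau\in(0,T]$, $t_s=s\tau$, $N=\lfloor T/\tau\rfloor$, $f^{k+\frac12}=f(t_{k+\frac12})$. Given $\phi^\star\in H^1(\Omega)$, set $u^0=\mathsf u_0$, $p^{-\frac12}=\mathsf p(0)$, $\phi^{-\frac12}=\phi^\star$, and for $0\le k<N$ let $p^{\star,k+\frac12}=p^{k-\frac12}+\phi^{k-\frac12}$, and let $u^{k+1}$ be determined as follows. If $d=2$: $$\tfrac{u^{k+\frac12}-u^k}{\tau/2}-\partial_{xx}u^{k+\frac12}-\partial_{yy}u^k+\nabla p^{\star,k+\frac12}=f^{k+\frac12},\quad u^{k+\frac12}|_{x=0,1}=0,$$ $$\tfrac{u^{k+1}-u^{k+\frac12}}{\tau/2}-\partial_{xx}u^{k+\frac12}-\partial_{yy}u^{k+1}+\nabla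 p^{\star,k+\frac12}=f^{k+\frac12},\quad u^{k+1}|_{y=0,1}=0.$$ If $d=3$: $$\tfrac{\xi^{k+1}-u^k}\tau-\Delta u^k+\nabla p^{\star,k+\frac12}=f^{k+\frac12},$$ $$\tfrac{\eta^{k+1}-\xi^{k+1}}\tau-\tfrac12\partial_{xx}(\eta^{k+1}-u^k)=0,\quad \eta^{k+1}|_{x=0,1}=0,$$ $$\tfrac{\zeta^{k+1}-\eta^{k+1}}\tau-\tfrac12\partial_{yy}(\zeta^{k+1}-u^k)=0,\quad \zeta^{k+1}|_{y=0,1}=0,$$ $$\tfrac{u^{k+1}-\zeta^{k+1}}\tau-\tfrac12\partial_{zz}(u^{k+1}-u^k)=0,\quad u^{k+1}|_{z=0,1}=0.$$ Then let $\phi^{k+\frac12}\in D(A)$ solve $A\phi^{k+\frac12}=-\frac1\tau\nabla\cdot u^{k+1}$ and set $p^{k+\frac12}=p^{k-\frac12}+\phi^{k+\frac12}$. *Errors.* Let $e^k=\mathsf u(t_k)-u^k$ for $0\le k\le N$, $\epsilon^{k-\frac12}=\mathsf p(t_{k-\frac12})-p^{k-\frac12}$ for $1\le k\le N$, and $\epsilon^{-\frac12}=\mathsf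 p(0)-p^{-\frac12}=0$. For a sequence $\psi$ let $\delta\psi^k=\psi^k-\psi^{k-1}$, and let $\|\delta e_\tau\|_{\ell^\infty(E)}=\max_{1\le k\le N}\|\delta e^k\|_E$, $\|\delta e_\tau\|_{\ell^2(E)}=\big(\tau\sum_{k=1}^N\|\delta e^k\|_E^2\big)^{1/2}$, $\|\delta\epsilon_\tau\|_{\ell^\infty(E)}=\max_{1\le k\le N}\|\delta\epsilon^{k-\frac12}\|_E$. **Statement.** Assume $\mathsf u\in W^{3,\infty}(0,T;H^2(\Omega)^d)$, $\mathsf u\in W^{2,\infty}(0,T;D(B_\tau))$ for every $\tau>0$, and $\mathsf p\in W^{3,\infty}(0,T;Y)$, and let $c_0\ge0$. Then there is a constant $c$, which depends only on $d$, $T$, $(\mathsf u,\mathsf p)$, $f$ and $c_0$, such that for every $\tau\in(0,T]$, every $\phi^\star$ with $\|\nabla(\mathsf p(\tfrac\tau2)-p^{\star,\frac12})\|_{L^2}\le c_0\tau$ (for instance $\phi^\star=0$ if $c_0$ is large enough), and the corresponding solution of the scheme, $$\|\delta e_\tau\|_{\ell^\infty(L^2)}+\|\delta e_\tau\|_{\ell^2(H^1)}+\tau\|\delta\epsilon_\tau\|_{\ell^\infty(A)}+\tau\|\delta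 e_\tau\|_{\ell^\infty(B)}\le c\,\tau^2 .$$ -/

import Mathlib

open MeasureTheory Filter Topology Set
open scoped ENNReal ContDiff

noncomputable section

namespace DirSplit

/-! ### The cube and its Lebesgue spaces -/

/-- The open unit cube `Ω = (0,1)^d`. -/
def cube (d : ℕ) : Set (Fin d → ℝ) := Set.pi Set.univ (fun _ => Set.Ioo (0 : ℝ) 1)

/-- `L²(Ω)`. -/
abbrev L2 (d : ℕ) : Type := Lp ℝ 2 ((volume : Measure (Fin d → ℝ)).restrict (cube d))

/-- `L²(Ω)^d`, with `‖v‖² = ∑ j, ‖v j‖²`. -/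
abbrev VL2 (d : ℕ) : Type := PiLp 2 (fun _ : Fin d => L2 d)

/-- `∫_Ω v ψ`. -/
def pairing {d : ℕ} (v : L2 d) (ψ : (Fin d → ℝ) → ℝ) : ℝ := ∫ x in cube d, v x * ψ x

/-- `v ∈ L²(Ω)` has zero mean. -/
def ZeroMean {d : ℕ} (v : L2 d) : Prop := ∫ x in cube d, v x = 0

/-! ### Classical and weak derivatives -/

/-- The classical partial derivative `∂ᵢ ψ`. -/
def pd {d : ℕ} (i : Fin d) (ψ : (Fin d → ℝ) → ℝ) : (Fin d → ℝ) → ℝ :=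
  fun x => fderiv ℝ ψ x (Pi.single i 1)

/-- The classical derivative `∂^α ψ` for a multi-index `α`. -/
def mpd {d : ℕ} (α : Fin d → ℕ) (ψ : (Fin d → ℝ) → ℝ) : (Fin d → ℝ) → ℝ :=
  (List.finRange d).foldr (fun i h => (pd i)^[α i] h) ψ

/-- The multi-index of `∂_S = ∏_{i ∈ S} ∂ᵢ`. -/
def ind {d : ℕ} (S : Finset (Fin d)) : Fin d → ℕ := fun i => if i ∈ S then 1 else 0

/-- `ψ ∈ C_c^∞(Ω)`. -/
def IsTest {d : ℕ} (ψ : (Fin d → ℝ) → ℝ) : Prop :=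
  ContDiff ℝ ∞ ψ ∧ HasCompactSupport ψ ∧ tsupport ψ ⊆ cube d

/-- `∂^α v = g` in the sense of distributions on `Ω`. -/
def IsWeakDeriv {d : ℕ} (α : Fin d → ℕ) (v g : L2 d) : Prop :=
  ∀ ψ, IsTest ψ → pairing v (mpd α ψ) = (-1) ^ (∑ i, α i) * pairing g ψ

/-- `∂ᵢ v = g` weakly in `Ω`, and `v` vanishes on the two faces `xᵢ = 0` and `xᵢ = 1`. The trace
condition is expressed by Green's formula: the test functions `ψ` are restrictions to `Ω` of
functions in `C_c^∞(ℝ^d)`, which need not vanish on `∂Ω`, and no boundary term appears. -/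
def IsZeroTraceDeriv {d : ℕ} (i : Fin d) (v g : L2 d) : Prop :=
  ∀ ψ : (Fin d → ℝ) → ℝ, ContDiff ℝ ∞ ψ → HasCompactSupport ψ →
    pairing v (pd i ψ) = - pairing g ψ

/-- `∂ᵢᵢ v = g` with the Dirichlet condition `v = 0` on `xᵢ = 0, 1`. -/
def IsDirichletSecond {d : ℕ} (i : Fin d) (v g : L2 d) : Prop :=
  ∃ w : L2 d, IsZeroTraceDeriv i v w ∧ IsWeakDeriv (Pi.single i 1) w g

/-- `∂ᵢᵢ v = g` with the Neumann condition `∂ᵢ v = 0` on `xᵢ = 0, 1`. -/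
def IsNeumannSecond {d : ℕ} (i : Fin d) (v g : L2 d) : Prop :=
  ∃ w : L2 d, IsWeakDeriv (Pi.single i 1) v w ∧ IsZeroTraceDeriv i w g

/-- `∇ q = G` weakly. -/
def IsWeakGrad {d : ℕ} (q : L2 d) (G : VL2 d) : Prop :=
  ∀ i, IsWeakDeriv (Pi.single i 1) q (G i)

/-- `∇ · v = D` weakly. -/
def IsWeakDiv {d : ℕ} (v : VL2 d) (D : L2 d) : Prop :=
  ∀ ψ, IsTest ψ → ∑ i, pairing (v i) (pd i ψ) = - pairing D ψ

/-- `Δ v = g` weakly, for a vector field `v`. -/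
def IsWeakLaplacian {d : ℕ} (v g : VL2 d) : Prop :=
  ∀ j, ∀ ψ, IsTest ψ → pairing (v j) (fun x => ∑ i, mpd (Pi.single i 2) ψ x) = pairing (g j) ψ

/-- `v ∈ H¹₀(Ω)`: the closure of `C_c^∞(Ω)` in the `W^{1,2}` norm. -/
def MemH10 {d : ℕ} (v : L2 d) : Prop :=
  ∃ (g : Fin d → L2 d) (ψ : ℕ → (Fin d → ℝ) → ℝ), (∀ n, IsTest (ψ n)) ∧
    Tendsto (fun n => eLpNorm (fun x => ψ n x - v x) 2 (volume.restrict (cube d))) atTop (𝓝 0) ∧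
    ∀ i, Tendsto (fun n => eLpNorm (fun x => pd i (ψ n) x - g i x) 2
      (volume.restrict (cube d))) atTop (𝓝 0)

/-! ### The direction splitting operators -/

/-- `φ ∈ D(A)` and `A φ = h`, where `A = (1 - ∂_{11}) ⋯ (1 - ∂_{dd})`. Here `w d = φ`, and
`w i = (1 - ∂ᵢᵢ) w (i+1)` with a homogeneous Neumann condition in the direction `i`, so that the
factor of the last direction acts first and `w 0 = A φ`. -/
def IsA {d : ℕ} (φ h : L2 d) : Prop :=
  ZeroMean φ ∧ ∃ w : Fin (d + 1) → L2 d, w (Fin.last d) = φ ∧ w 0 = h ∧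
    ∀ i : Fin d, ∃ a : L2 d, IsNeumannSecond i (w i.succ) a ∧ w i.castSucc = w i.succ - a

/-- The formal operator `B = ∑_{|S| ≥ 2} (-τ/2)^{|S|-2} ∏_{i ∈ S} ∂ᵢᵢ` on smooth functions, i.e.
`∂_{xxyy}` if `d = 2` and `∂_{xxyy} + ∂_{yyzz} + ∂_{zzxx} - (τ/2) ∂_{xxyyzz}` if `d = 3`. -/
def formalB {d : ℕ} (τ : ℝ) (ψ : (Fin d → ℝ) → ℝ) : (Fin d → ℝ) → ℝ := fun x =>
  ∑ S : Finset (Fin d) with 2 ≤ S.card, (-τ / 2) ^ (S.card - 2) * mpd (2 • ind S) ψ x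

/-- `v ∈ D(B)` and `B v = g`: `v ∈ H¹₀(Ω)^d` and `B v = g ∈ L²(Ω)^d` as distributions
(`B` has even order in each variable, so it is formally self-adjoint). -/
def IsB {d : ℕ} (τ : ℝ) (v g : VL2 d) : Prop :=
  (∀ j, MemH10 (v j)) ∧ ∀ j, ∀ ψ, IsTest ψ → pairing (v j) (formalB τ ψ) = pairing (g j) ψ

/-! ### Norms

These are `[0,∞]`-valued: they are `∞` outside of the space on which the norm lives. The weak
derivatives over which the infima run are unique if they exist. -/

/-- The `L²(Ω)^d` norm. -/
def normL2 {d : ℕ} (v : VL2 d) : ℝ≥0∞ := ENNReal.ofReal ‖v‖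

/-- `‖v‖_{H¹} = ‖∇ v‖_{L²}`. -/
def normH1 {d : ℕ} (v : VL2 d) : ℝ≥0∞ :=
  ⨅ (G : Fin d → VL2 d) (_ : ∀ i j, IsWeakDeriv (Pi.single i 1) (v j) (G i j)),
    ENNReal.ofReal (Real.sqrt (∑ i, ‖G i‖ ^ 2))

/-- The norm `‖q‖_A` of `Y`, the extension of `⟨A q, q⟩^{1/2}`: the space `Y` consists of the
zero-mean `q` with `∂_S q ∈ L²(Ω)` for all sets `S` of directions, and
`‖q‖_A² = ∑_S ‖∂_S q‖²`. -/
def normA {d : ℕ} (q : L2 d) : ℝ≥0∞ :=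
  ⨅ (G : Finset (Fin d) → L2 d) (_ : ZeroMean q ∧ ∀ S, IsWeakDeriv (ind S) q (G S)),
    ENNReal.ofReal (Real.sqrt (∑ S, ‖G S‖ ^ 2))

/-- `‖v‖_B = ⟨v, B v⟩^{1/2}` for `v ∈ D(B)`. -/
def normB {d : ℕ} (τ : ℝ) (v : VL2 d) : ℝ≥0∞ :=
  ⨅ (g : VL2 d) (_ : IsB τ v g), ENNReal.ofReal (Real.sqrt (inner ℝ v g))

/-- The time increment `δψ^k = ψ^k - ψ^{k-1}`, used for `k ≥ 1`. -/
def incr {E : Type*} [AddCommGroup E] (ψ : ℕ → E) (k : ℕ) : E := ψ k - ψ (k - 1)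

/-- The discrete `ℓ^∞` norm over the indices `1, …, N`. -/
def linfNorm {E : Type*} (N : ℕ) (nrm : E → ℝ≥0∞) (ψ : ℕ → E) : ℝ≥0∞ :=
  ⨆ k ∈ Finset.Icc 1 N, nrm (ψ k)

/-- The discrete `ℓ²` norm over the indices `1, …, N`, with time step `τ`. -/
def l2Norm {E : Type*} (τ : ℝ) (N : ℕ) (nrm : E → ℝ≥0∞) (ψ : ℕ → E) : ℝ≥0∞ :=
  (ENNReal.ofReal τ * ∑ k ∈ Finset.Icc 1 N, nrm (ψ k) ^ 2) ^ (1 / 2 : ℝ)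

/-! ### Regularity in time -/

/-- `g ∈ W^{m,∞}(0,T;F)`, `g` being the continuous representative on `[0,T]` (for `m ≥ 1`):
`V j` is the `j`-th derivative. -/
def MemWInfty {F : Type*} [NormedAddCommGroup F] [NormedSpace ℝ F] (m : ℕ) (T : ℝ) (g : ℝ → F) :
    Prop :=
  ∃ V : ℕ → ℝ → F, (∀ t ∈ Icc 0 T, V 0 t = g t) ∧
    (∀ j ≤ m, MemLp (V j) ⊤ (volume.restrict (Icc 0 T))) ∧
    ∀ j < m, ∀ t ∈ Icc 0 T, V j t = V j 0 + ∫ s in (0 : ℝ)..t, V (j + 1) s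

/-- `u ∈ W^{m,∞}(0,T;H²(Ω)^d)`: as `v ↦ (∂^α v)_{|α| ≤ 2}` identifies `H²(Ω)` with a closed
subspace of a power of `L²(Ω)`, this says that all `∂^α u`, `|α| ≤ 2`, are in
`W^{m,∞}(0,T;L²(Ω)^d)`. -/
def MemWInftyH2 {d : ℕ} (m : ℕ) (T : ℝ) (u : ℝ → VL2 d) : Prop :=
  ∀ α : Fin d → ℕ, ∑ i, α i ≤ 2 → ∃ g : ℝ → VL2 d, MemWInfty m T g ∧
    ∀ t ∈ Icc 0 T, ∀ j, IsWeakDeriv α (u t j) (g t j)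

/-- `u ∈ W^{m,∞}(0,T;D(B))`, where `D(B)` has the graph norm: both `u` and `B u` are in
`W^{m,∞}(0,T;L²(Ω)^d)`, and `u(t) ∈ D(B)`. -/
def MemWInftyDB {d : ℕ} (τ : ℝ) (m : ℕ) (T : ℝ) (u : ℝ → VL2 d) : Prop :=
  MemWInfty m T u ∧ ∃ g : ℝ → VL2 d, MemWInfty m T g ∧ ∀ t ∈ Icc 0 T, IsB τ (u t) (g t)

/-- `p ∈ W^{m,∞}(0,T;Y)`: `p(t)` has zero mean, and all `∂_S p` are in `W^{m,∞}(0,T;L²(Ω))`. -/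
def MemWInftyY {d : ℕ} (m : ℕ) (T : ℝ) (p : ℝ → L2 d) : Prop :=
  (∀ t ∈ Icc 0 T, ZeroMean (p t)) ∧
  ∀ S : Finset (Fin d), ∃ g : ℝ → L2 d, MemWInfty m T g ∧
    ∀ t ∈ Icc 0 T, IsWeakDeriv (ind S) (p t) (g t)

/-! ### The Stokes problem -/

/-- `(u, p)` solves the time-dependent Stokes system with source term `f` and initial velocity
`u₀` on `[0,T]`. -/
structure IsStokesSolution {d : ℕ} (T : ℝ) (f : ℝ → VL2 d) (u₀ : VL2 d) (u : ℝ → VL2 d)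
    (p : ℝ → L2 d) : Prop where
  momentum : ∀ t ∈ Ioc 0 T, ∃ ut L G : VL2 d, HasDerivWithinAt u ut (Icc 0 T) t ∧
    IsWeakLaplacian (u t) L ∧ IsWeakGrad (p t) G ∧ ut - L + G = f t
  incompressible : ∀ t ∈ Icc 0 T, IsWeakDiv (u t) 0
  boundary : ∀ t ∈ Ioc 0 T, ∀ j, MemH10 (u t j)
  initial : u 0 = u₀

/-! ### The scheme -/

/-- The velocity update `u^k ↦ u^{k+1}`, with `G = ∇ p^{⋆,k+1/2}` and `F = f^{k+1/2}`:
Peaceman–Rachford if `d = 2`, Douglas if `d = 3`.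

For `d = 2`, `w = u^{k+1/2}`, `a = ∂_{xx} u^{k+1/2}`, `b = ∂_{yy} u^k`, `c = ∂_{yy} u^{k+1}`.
For `d = 3`, `D i = ∂ᵢᵢ u^k` (so that `∑ i, D i = Δ u^k`), `a = ∂_{xx} η`, `b = ∂_{yy} ζ`,
`c = ∂_{zz} u^{k+1}`. The field `ξ` is given explicitly by its equation; no boundary condition
is imposed on it. -/
def VelocityStep : (d : ℕ) → (τ : ℝ) → (uk uk1 G F : VL2 d) → Prop
  | 2 => fun τ uk uk1 G F => ∃ w a b c : VL2 2,
      (∀ j, IsDirichletSecond 0 (w j) (a j)) ∧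
      (∀ j, IsWeakDeriv (Pi.single 1 2) (uk j) (b j)) ∧
      (∀ j, IsDirichletSecond 1 (uk1 j) (c j)) ∧
      (τ / 2)⁻¹ • (w - uk) - a - b + G = F ∧
      (τ / 2)⁻¹ • (uk1 - w) - a - c + G = F
  | 3 => fun τ uk uk1 G F => ∃ (ξ η ζ a b c : VL2 3) (D : Fin 3 → VL2 3),
      (∀ i j, IsWeakDeriv (Pi.single i 2) (uk j) (D i j)) ∧
      (∀ j, IsDirichletSecond 0 (η j) (a j)) ∧
      (∀ j, IsDirichletSecond 1 (ζ j) (b j)) ∧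
      (∀ j, IsDirichletSecond 2 (uk1 j) (c j)) ∧
      τ⁻¹ • (ξ - uk) - ∑ i, D i + G = F ∧
      τ⁻¹ • (η - ξ) - (1 / 2 : ℝ) • (a - D 0) = 0 ∧
      τ⁻¹ • (ζ - η) - (1 / 2 : ℝ) • (b - D 1) = 0 ∧
      τ⁻¹ • (uk1 - ζ) - (1 / 2 : ℝ) • (c - D 2) = 0
  | _ => fun _ _ _ _ _ => False

/-- The direction splitting scheme with parameter `χ`, run for `N` steps of length `τ`.
`U k = u^k`, `P k = p^{k-1/2}`, `Φ k = φ^{k-1/2}`; the pressure predictor is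
`p^{⋆,k+1/2} = P k + Φ k`. -/
structure IsSchemeSolution {d : ℕ} (χ τ : ℝ) (N : ℕ) (f : ℝ → VL2 d) (u₀ : VL2 d)
    (p₀ φstar : L2 d) (U : ℕ → VL2 d) (P Φ : ℕ → L2 d) : Prop where
  init_velocity : U 0 = u₀
  init_pressure : P 0 = p₀
  init_correction : Φ 0 = φstar
  velocity : ∀ k < N, ∃ G : VL2 d, IsWeakGrad (P k + Φ k) G ∧
    VelocityStep d τ (U k) (U (k + 1)) G (f (((k : ℝ) + 1 / 2) * τ))
  penalty : ∀ k < N, ∃ D : L2 d, IsWeakDiv (U (k + 1)) D ∧ IsA (Φ (k + 1)) (-(τ⁻¹ • D))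
  pressure : ∀ k < N, ∃ D : L2 d, IsWeakDiv ((1 / 2 : ℝ) • (U (k + 1) + U k)) D ∧
    P (k + 1) = P k + Φ (k + 1) - χ • D

/-- The velocity error `e^k = u(t_k) - u^k`. -/
def velError {d : ℕ} (τ : ℝ) (u : ℝ → VL2 d) (U : ℕ → VL2 d) (k : ℕ) : VL2 d :=
  u ((k : ℝ) * τ) - U k

/-- The pressure error `ε^{k-1/2} = p(t_{k-1/2}) - p^{k-1/2}` for `k ≥ 1`. As `p^{-1/2}` is the
initial pressure, the error with index `-1/2` is `p(0) - p^{-1/2}`. -/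
def presError {d : ℕ} (τ : ℝ) (p : ℝ → L2 d) (P : ℕ → L2 d) : ℕ → L2 d
  | 0 => p 0 - P 0
  | k + 1 => p (((k : ℝ) + 1 / 2) * τ) - P (k + 1)

end DirSplit

end

noncomputable section
namespace DirSplit

/-! ### An abstract stability estimate -/

/-! In the basis of products of sines, `B`, the Laplacian and all one-dimensional factors of the
scheme are diagonal. Eliminating the intermediate fields leaves M(u^{k+1} - u^k) - (τ/2)Δ(u^{k+1} +
u^k) + τ∇p^⋆ = τf with M = 1 + (τ²/4)B (`VelocityStep.coef_eq`). The exact solution satisfies the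
same equation up to τR with R of size τ² (`consistency`). The operator `A` is diagonal in cosines
instead. The two bases meet only through the gradient from Y to L²: its adjoint for the `A` inner
product is -A⁻¹div, so the penalty equation reads φ^{k+1/2} = τ⁻¹∇*u^{k+1} (`IsA.eq_adjoint`), and
all that is used about the coupling is ‖∇q‖ ≤ ‖q‖_A.

The error equations are differenced in time. Let E = δe, let r be the pressure error increment and ρ
the predicted one. Since the exact velocity is solenoidal, r_{k+1} = ρ_{k+1} + τ⁻¹∇*E_{k+1}, and the
pressure in the momentum equation is 2r_k - ρ_k up to a source. After the substitution e = M^{1/2}E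
put G = ∇*M^{-1/2}, so ‖G‖ ≤ 1, let N be the positive operator -ΔM⁻¹, and let S = 1 - (3/4)G*G ≥
1/4. Define v_k by S v_k = e_k + (τ/2)N e_k + (τ/2)G*ρ_k. The functional ⟨Sv,v⟩ + τ²‖ρ‖² does not
grow from (v_k, ρ_k) to the reflected pair (2e_k - v_k, r_k), and it loses at least 2τ⟨N e_k, e_k⟩
(`lyap_step`). The step equation says that (v_{k+1}, ρ_{k+1}) is the reflected pair plus sources, so
the square root of the functional grows by at most the size of the sources (`stability_estimate`,
`splitting_stability`).

The sources are differences of the remainders R and second differences of the exact pressure. They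
are O(τ³) from the third step on and O(τ²) in the first two, where φ^⋆ is only first order accurate
and the first pressure interval has length τ/2. As Nτ ≤ T, their sum is O(τ²) (`sum_incrRhs_le`).

The remaining work converts weak statements into coefficients: weak identities are extended by
cut-off to products of sines or cosines, which lack compact support (`IsWeakDeriv.prodFun`,
`pairing_even_operator`), and both systems are shown to be complete by Stone–Weierstrass
(`ae_eq_zero_of_cosProd`). -/

lemma sqrt_quadratic_triangle {a b c : ℝ} (ha : 0 ≤ a) (hb : 0 ≤ b)
    (h : ∀ t : ℝ, 0 ≤ a + 2 * t * c + t ^ 2 * b) :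
    Real.sqrt (a + 2 * c + b) ≤ Real.sqrt a + Real.sqrt b := by
  -- Discriminant argument. If b = 0 the polynomial is affine in t, and a nonzero slope would give
  -- it the value -1 at the chosen t; otherwise t is the minimizer.
  have hc : c ^ 2 ≤ a * b := by
    rcases hb.eq_or_lt with hb0 | hb0
    · subst hb0
      have hc0 : c = 0 := by
        by_contra hne
        have h1 := h (-(a + 1) / (2 * c))
        have h2 : 2 * (-(a + 1) / (2 * c)) * c = -(a + 1) := by field_simp
        rw [h2] at h1
        linarith
      simp [hc0]
    · have := h (-c / b)
      have e : a + 2 * (-c / b) * c + (-c / b) ^ 2 * b = (a * b - c ^ 2) / b := by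
        field_simp; ring
      rw [e] at this
      have := (div_nonneg_iff.1 this)
      rcases this with h1 | h1
      · linarith [h1.1]
      · linarith [h1.2]
  have hc' : c ≤ Real.sqrt a * Real.sqrt b := by
    rw [← Real.sqrt_mul ha]
    exact Real.le_sqrt_of_sq_le hc
  apply Real.sqrt_le_iff.2
  refine ⟨by positivity, ?_⟩
  nlinarith [Real.sq_sqrt ha, Real.sq_sqrt hb]

section Stability

variable {V H Y : Type*} [NormedAddCommGroup V] [InnerProductSpace ℝ V]
  [NormedAddCommGroup H] [InnerProductSpace ℝ H] [NormedAddCommGroup Y] [InnerProductSpace ℝ Y]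

/-- The form `⟨M v, w⟩` with `M = 1 - (3/4) G* G`. -/
def stabForm (G : V →L[ℝ] Y) (v w : V) : ℝ :=
  inner ℝ v w - 3 / 4 * inner ℝ (G v) (G w)

/-- The Lyapunov functional. -/
def lyap (G : V →L[ℝ] Y) (τ : ℝ) (v : V) (ρ : Y) : ℝ :=
  stabForm G v v + τ ^ 2 * ‖ρ‖ ^ 2

/-- The contraction property of `G` leaves 1 - 3/4 = 1/4 as coercivity constant. -/
lemma stabForm_self_ge {G : V →L[ℝ] Y} (hG : ∀ v, ‖G v‖ ≤ ‖v‖) (v : V) :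
    1 / 4 * ‖v‖ ^ 2 ≤ stabForm G v v := by
  have := hG v
  simp only [stabForm, real_inner_self_eq_norm_sq]
  nlinarith [norm_nonneg (G v), norm_nonneg v]

lemma lyap_nonneg {G : V →L[ℝ] Y} (hG : ∀ v, ‖G v‖ ≤ ‖v‖) (τ : ℝ) (v : V) (ρ : Y) :
    0 ≤ lyap G τ v ρ := by
  have := stabForm_self_ge hG v
  have h2 : 0 ≤ τ ^ 2 * ‖ρ‖ ^ 2 := by positivity
  unfold lyap
  nlinarith [sq_nonneg ‖v‖]

/-- Minkowski's inequality, since `lyap` is a nonnegative quadratic form in the pair. Working with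
its square root makes the sources accumulate additively, without a Gronwall factor. -/
lemma sqrt_lyap_add_le {G : V →L[ℝ] Y} (hG : ∀ v, ‖G v‖ ≤ ‖v‖) (τ : ℝ) (v w : V) (ρ σ : Y) :
    Real.sqrt (lyap G τ (v + w) (ρ + σ)) ≤
      Real.sqrt (lyap G τ v ρ) + Real.sqrt (lyap G τ w σ) := by
  have key : ∀ t : ℝ, lyap G τ (v + t • w) (ρ + t • σ) = lyap G τ v ρ
      + 2 * t * (stabForm G v w + τ ^ 2 * inner ℝ ρ σ) + t ^ 2 * lyap G τ w σ := by
    intro t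
    simp only [lyap, stabForm, ← real_inner_self_eq_norm_sq, map_add, map_smul, inner_add_left,
      inner_add_right, real_inner_smul_left, real_inner_smul_right, real_inner_comm v w,
      real_inner_comm (G v) (G w), real_inner_comm ρ σ]
    ring
  have h1 := key 1
  simp only [one_smul, mul_one, one_pow, one_mul] at h1
  rw [h1]
  exact sqrt_quadratic_triangle (lyap_nonneg hG _ _ _) (lyap_nonneg hG _ _ _)
    (fun t => by rw [← key t]; exact lyap_nonneg hG _ _ _)

/-- The operator is 1 - K with K = (3/4)G*G of norm less than 1, hence a unit by the Neumann series.
-/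
lemma exists_stabForm_solution [CompleteSpace V] [CompleteSpace Y] {G : V →L[ℝ] Y}
    (hG : ∀ v, ‖G v‖ ≤ ‖v‖) (F : V) :
    ∃ v : V, ∀ w, stabForm G v w = inner ℝ F w := by
  set K : V →L[ℝ] V := (3 / 4 : ℝ) • (ContinuousLinearMap.adjoint G ∘L G) with hK
  have hGn : ‖G‖ ≤ 1 := G.opNorm_le_bound zero_le_one (by simpa using hG)
  have hKn : ‖K‖ < 1 := by
    rw [hK, norm_smul, ContinuousLinearMap.norm_adjoint_comp_self]
    rw [Real.norm_of_nonneg (by norm_num)]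
    nlinarith [norm_nonneg G]
  refine ⟨(↑(Units.oneSub K hKn)⁻¹ : V →L[ℝ] V) F, fun w => ?_⟩
  set v := (↑(Units.oneSub K hKn)⁻¹ : V →L[ℝ] V) F with hv
  have h1 : v - K v = F := by
    have : ((↑(Units.oneSub K hKn) : V →L[ℝ] V) * ↑(Units.oneSub K hKn)⁻¹) F = F := by
      rw [Units.mul_inv]; rfl
    simpa [hv] using this
  rw [← h1, inner_sub_left, hK]
  simp [stabForm, real_inner_smul_left, ContinuousLinearMap.adjoint_inner_left]

/-- Testing with `x` and using coercivity gives ‖x‖ ≤ 4‖ζ‖, so the form at `x` is at most 4‖ζ‖². -/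
lemma sqrt_lyap_le_of_source {G : V →L[ℝ] Y} (hG : ∀ v, ‖G v‖ ≤ ‖v‖) {i : V →L[ℝ] H}
    (hi : ∀ v, ‖i v‖ ≤ ‖v‖) {τ : ℝ} (hτ : 0 < τ) {x : V} {ζ : H} {σ : Y}
    (hx : ∀ w, stabForm G x w = inner ℝ ζ (i w)) :
    Real.sqrt (lyap G τ x σ) ≤ 2 * ‖ζ‖ + τ * ‖σ‖ := by
  have h1 : stabForm G x x ≤ ‖ζ‖ * ‖x‖ := by
    rw [hx]
    exact (real_inner_le_norm _ _).trans (mul_le_mul_of_nonneg_left (hi x) (norm_nonneg _))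
  have h2 := stabForm_self_ge hG x
  have h3 : ‖x‖ ≤ 4 * ‖ζ‖ := by
    rcases (norm_nonneg x).eq_or_lt with h | h
    · rw [← h]; positivity
    · nlinarith
  have h4 : stabForm G x x ≤ 4 * ‖ζ‖ ^ 2 := by nlinarith [norm_nonneg ζ]
  apply Real.sqrt_le_iff.2
  refine ⟨by positivity, ?_⟩
  unfold lyap
  have : 0 ≤ ‖ζ‖ * (τ * ‖σ‖) := by positivity
  nlinarith

/-- One step of the scheme: dissipation of the Lyapunov functional. -/
lemma lyap_step {G : V →L[ℝ] Y} {N : V →L[ℝ] V} {τ : ℝ} (hτ : 0 < τ)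
    {v e : V} {r ρ : Y} (hr : r = ρ + τ⁻¹ • G e)
    (hv : ∀ w, stabForm G v w = inner ℝ e w + τ / 2 * inner ℝ (N e) w
      + τ / 2 * inner ℝ ρ (G w)) :
    lyap G τ (2 • e - v) r + 2 * τ * inner ℝ (N e) e ≤ lyap G τ v ρ := by
  have h1 := hv e
  have hG : G e = τ • (r - ρ) := by
    rw [hr]; simp [smul_smul, hτ.ne']
  have e1 : lyap G τ (2 • e - v) r = stabForm G v v + 4 * stabForm G e e - 4 * stabForm G v e
      + τ ^ 2 * ‖r‖ ^ 2 := by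
    simp only [lyap, stabForm, map_sub, map_add, two_smul, inner_add_left, inner_add_right,
      inner_sub_left, inner_sub_right, real_inner_comm v e, real_inner_comm (G v) (G e)]
    ring
  have e2 : stabForm G e e = inner ℝ e e - 3 / 4 * τ ^ 2 * ‖r - ρ‖ ^ 2 := by
    simp only [stabForm]
    rw [hG, real_inner_self_eq_norm_sq (τ • (r - ρ)), norm_smul, mul_pow, Real.norm_eq_abs, sq_abs]
    ring
  have e3 : inner ℝ ρ (G e) = τ * (inner ℝ ρ r - ‖ρ‖ ^ 2) := by
    rw [hG, real_inner_smul_right, inner_sub_right, real_inner_self_eq_norm_sq]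
  have e4 : ‖r - ρ‖ ^ 2 = ‖r‖ ^ 2 - 2 * inner ℝ ρ r + ‖ρ‖ ^ 2 := by
    rw [norm_sub_sq_real, real_inner_comm]
  rw [e1, e2, h1, e3]
  unfold lyap
  -- The substitutions give an exact balance in which the right side exceeds the left by 2τ²‖r -
  -- ρ‖². This term is dropped.
  have := sq_nonneg ‖r - ρ‖
  have h5 : 0 ≤ τ ^ 2 * ‖r - ρ‖ ^ 2 := by positivity
  rw [e4] at h5 ⊢
  nlinarith

/-- Stability of the perturbed scheme in the energy norm. -/
theorem stability_estimate [CompleteSpace V] [CompleteSpace H] [CompleteSpace Y]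
    (i : V →L[ℝ] H) (g : Y →L[ℝ] H) (N : V →L[ℝ] V)
    (hi : ∀ v, ‖i v‖ ≤ ‖v‖) (hg : ∀ q, ‖g q‖ ≤ ‖q‖) (hN0 : ∀ v, 0 ≤ inner ℝ (N v) v)
    {τ : ℝ} (hτ : 0 < τ) (n : ℕ) (e : ℕ → V) (r ρ σ : ℕ → Y) (φ : ℕ → H)
    (he0 : e 0 = 0) (hr0 : r 0 = 0) (hρ0 : ρ 0 = 0)
    (hstep : ∀ k < n, ∀ w, inner ℝ (e (k + 1) - e k) w + τ / 2 * inner ℝ (N (e (k + 1) + e k)) w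
      + τ * inner ℝ (g (2 • r k - ρ k)) (i w) = inner ℝ (φ k) (i w))
    (hρ : ∀ k < n, ρ (k + 1) = r k + σ k)
    (hr : ∀ k < n, r (k + 1) = ρ (k + 1) + τ⁻¹ • ContinuousLinearMap.adjoint g (i (e (k + 1))))
    {Γ : ℝ} (hΓ : ∑ k ∈ Finset.range n, (2 * ‖φ k‖ + 2 * (τ * ‖σ k‖)) ≤ Γ) :
    (∀ k ≤ n, ‖e k‖ ≤ 2 * Γ ∧ τ * ‖r k‖ ≤ Γ) ∧
      τ * ∑ k ∈ Finset.range (n + 1), inner ℝ (N (e k)) (e k) ≤ Γ ^ 2 := by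
  set G : V →L[ℝ] Y := ContinuousLinearMap.adjoint g ∘L i with hGdef
  have hGi : ∀ q w, inner ℝ (g q) (i w) = inner ℝ q (G w) := by
    intro q w
    simp [hGdef, ContinuousLinearMap.adjoint_inner_right]
  have hgn : ‖ContinuousLinearMap.adjoint g‖ ≤ 1 := by
    rw [LinearIsometryEquiv.norm_map]
    exact g.opNorm_le_bound zero_le_one (by simpa using hg)
  have hG : ∀ v, ‖G v‖ ≤ ‖v‖ := by
    intro v
    calc ‖G v‖ ≤ ‖ContinuousLinearMap.adjoint g‖ * ‖i v‖ :=
          (ContinuousLinearMap.adjoint g).le_opNorm (i v)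
      _ ≤ 1 * ‖v‖ := mul_le_mul hgn (hi v) (norm_nonneg _) zero_le_one
      _ = ‖v‖ := one_mul _
  -- The auxiliary unknown `v k` gathers the part of the step equation that belongs to index k, so
  -- that the step relates only `v (k + 1)` to the reflected point `2 • e k - v k`.
  have hex : ∀ k, ∃ v : V, ∀ w, stabForm G v w = inner ℝ (e k) w + τ / 2 * inner ℝ (N (e k)) w
      + τ / 2 * inner ℝ (ρ k) (G w) := by
    intro k
    obtain ⟨v, hv⟩ := exists_stabForm_solution hG
      (e k + (τ / 2) • N (e k) + (τ / 2) • ContinuousLinearMap.adjoint G (ρ k))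
    refine ⟨v, fun w => ?_⟩
    rw [hv, inner_add_left, inner_add_left, real_inner_smul_left, real_inner_smul_left,
      ContinuousLinearMap.adjoint_inner_left]
  choose v hv using hex
  have hrG : ∀ k ≤ n, r k = ρ k + τ⁻¹ • G (e k) := by
    intro k hk
    rcases k with _ | k
    · simp [hr0, hρ0, he0]
    · exact hr k hk
  set A : ℕ → ℝ := fun k => Real.sqrt (lyap G τ (v k) (ρ k))
  set A' : ℕ → ℝ := fun k => Real.sqrt (lyap G τ (2 • e k - v k) (r k))
  set a : ℕ → ℝ := fun k => 2 * ‖φ k‖ + 2 * (τ * ‖σ k‖)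
  have ha : ∀ k, 0 ≤ a k := fun k => by positivity
  have hA : ∀ k, 0 ≤ A k := fun k => Real.sqrt_nonneg _
  have hA' : ∀ k, 0 ≤ A' k := fun k => Real.sqrt_nonneg _
  have hAsq : ∀ k, A k ^ 2 = lyap G τ (v k) (ρ k) := fun k => Real.sq_sqrt (lyap_nonneg hG _ _ _)
  have hAsq' : ∀ k, A' k ^ 2 = lyap G τ (2 • e k - v k) (r k) :=
    fun k => Real.sq_sqrt (lyap_nonneg hG _ _ _)
  have hdiss : ∀ k ≤ n, A' k ^ 2 + 2 * τ * inner ℝ (N (e k)) (e k) ≤ A k ^ 2 := by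
    intro k hk
    rw [hAsq, hAsq']
    exact lyap_step hτ (hrG k hk) (hv k)
  have hle : ∀ k ≤ n, A' k ≤ A k := by
    intro k hk
    have := hdiss k hk
    have h2 : 0 ≤ 2 * τ * inner ℝ (N (e k)) (e k) := mul_nonneg (by positivity) (hN0 _)
    exact abs_le_of_sq_le_sq' (by linarith) (hA k) |>.2
  have hjump : ∀ k < n, A (k + 1) ≤ A' k + a k := by
    intro k hk
    -- The factor 3/4 is chosen for this cancellation: with G e_k = τ(r_k - ρ_k) the pressure terms
    -- add up to (τ/2)(r_k + ρ_k + 3(r_k - ρ_k)) = τ(2r_k - ρ_k), the extrapolated pressure of the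
    -- step. Only the sources remain.
    have hx : ∀ w, stabForm G (v (k + 1) - (2 • e k - v k)) w
        = inner ℝ (φ k + (τ / 2) • g (σ k)) (i w) := by
      intro w
      have s1 : stabForm G (v (k + 1) - (2 • e k - v k)) w
          = stabForm G (v (k + 1)) w + stabForm G (v k) w - 2 * stabForm G (e k) w := by
        simp only [stabForm, map_sub, map_add, two_smul, inner_add_left, inner_sub_left]
        ring
      have s2 : stabForm G (e k) w = inner ℝ (e k) w - 3 / 4 * (τ * (inner ℝ (r k) (G w)
          - inner ℝ (ρ k) (G w))) := by
        have : G (e k) = τ • (r k - ρ k) := by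
          rw [hrG k hk.le]; simp [smul_smul, hτ.ne']
        simp only [stabForm]
        rw [this, real_inner_smul_left, inner_sub_left]
      have s3 := hstep k hk w
      rw [hGi, inner_sub_left, inner_sub_left, map_add, inner_add_left, two_smul,
        inner_add_left] at s3
      rw [s1, s2, hv, hv, hρ k hk, inner_add_left, inner_add_left, real_inner_smul_left, hGi]
      linarith
    have h1 := sqrt_lyap_le_of_source hG hi hτ (σ := σ k) hx
    have h2 := sqrt_lyap_add_le hG τ (2 • e k - v k) (v (k + 1) - (2 • e k - v k)) (r k) (σ k)
    rw [add_sub_cancel, ← hρ k hk] at h2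
    have h3 : ‖φ k + (τ / 2) • g (σ k)‖ ≤ ‖φ k‖ + τ / 2 * ‖σ k‖ := by
      refine (norm_add_le _ _).trans (add_le_add le_rfl ?_)
      rw [norm_smul, Real.norm_of_nonneg (by positivity)]
      exact mul_le_mul_of_nonneg_left (hg _) (by positivity)
    simp only [A, A', a]
    linarith
  have hA0 : A 0 = 0 := by
    have h := hv 0 (v 0)
    have h2 := stabForm_self_ge hG (v 0)
    simp only [he0, hρ0, map_zero, inner_zero_left, mul_zero, add_zero] at h
    simp only [A, lyap, h, hρ0]
    simp
  have hmono : ∀ k ≤ n, ∑ j ∈ Finset.range k, a j ≤ Γ := fun k hk =>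
    (Finset.sum_le_sum_of_subset_of_nonneg (Finset.range_mono hk) (fun _ _ _ => ha _)).trans hΓ
  have hAsum : ∀ k ≤ n, A k ≤ ∑ j ∈ Finset.range k, a j := by
    intro k
    induction k with
    | zero => intro _; simp [hA0]
    | succ k ih =>
      intro hk
      rw [Finset.sum_range_succ]
      linarith [hjump k hk, hle k (by omega), ih (by omega)]
  have hAΓ : ∀ k ≤ n, A k ≤ Γ := fun k hk => (hAsum k hk).trans (hmono k hk)
  have hΓ0 : 0 ≤ Γ := (hA 0).trans (hAΓ 0 (Nat.zero_le _))
  have hnorm : ∀ (x : V) (q : Y), ‖x‖ ≤ 2 * Real.sqrt (lyap G τ x q) := by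
    intro x q
    have h1 := stabForm_self_ge hG x
    have h2 : 1 / 4 * ‖x‖ ^ 2 ≤ lyap G τ x q := by
      unfold lyap
      have : 0 ≤ τ ^ 2 * ‖q‖ ^ 2 := by positivity
      linarith
    have h3 : ‖x‖ / 2 ≤ Real.sqrt (lyap G τ x q) := Real.le_sqrt_of_sq_le (by linarith [h2])
    linarith
  refine ⟨fun k hk => ⟨?_, ?_⟩, ?_⟩
  -- The vector e_k is the midpoint of v_k and its reflection, and both have norm at most 2Γ.
  · have h1 := hnorm (v k) (ρ k)
    have h2 := hnorm (2 • e k - v k) (r k)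
    have h3 : ‖(2 : ℝ) • e k‖ ≤ ‖2 • e k - v k‖ + ‖v k‖ := by
      have := norm_add_le (2 • e k - v k) (v k)
      rw [sub_add_cancel] at this
      rwa [← ofNat_smul_eq_nsmul ℝ] at this ⊢
    rw [norm_smul, Real.norm_of_nonneg (by norm_num)] at h3
    have := hle k hk
    have := hAΓ k hk
    simp only [A, A'] at *
    linarith
  · have h1 : τ * ‖r k‖ ≤ A' k := by
      apply Real.le_sqrt_of_sq_le
      unfold lyap
      have := stabForm_self_ge hG (2 • e k - v k)
      nlinarith [sq_nonneg ‖2 • e k - v k‖]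
    linarith [hle k hk, hAΓ k hk]
  -- The dissipation telescopes. The jump costs at most 2Γ a_k in the squared functional, because
  -- both A' k and A (k + 1) are bounded by Γ.
  · have hind : ∀ k ≤ n, 2 * (τ * ∑ j ∈ Finset.range k, inner ℝ (N (e j)) (e j)) + A k ^ 2
        ≤ 2 * Γ * ∑ j ∈ Finset.range k, a j := by
      intro k
      induction k with
      | zero => intro _; simp [hA0]
      | succ k ih =>
        intro hk
        rw [Finset.sum_range_succ, Finset.sum_range_succ]
        have h1 := ih (by omega)
        have h2 := hdiss k (by omega)
        have h3 := hjump k hk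
        have h4 := hle k (by omega)
        have h5 := hAΓ k (by omega)
        have h6 := hAΓ (k + 1) hk
        have h7 := ha k
        have h8 := hA' k
        have h9 := hA (k + 1)
        have h10 : A (k + 1) ^ 2 ≤ A' k ^ 2 + 2 * Γ * a k := by
          by_cases hc : A (k + 1) ≤ A' k
          · have : 0 ≤ 2 * Γ * a k := by positivity
            nlinarith
          · push Not at hc
            nlinarith
        nlinarith
    have h1 := hind n le_rfl
    have h2 := hdiss n le_rfl
    have h3 := hmono n le_rfl
    rw [Finset.sum_range_succ]
    nlinarith [sq_nonneg (A' n)]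

end Stability
/-! ### Functions on the cube as elements of `L²` -/

variable {d : ℕ}

/-- Lebesgue measure on the cube. -/
abbrev cubeMeas (d : ℕ) : Measure (Fin d → ℝ) := (volume : Measure (Fin d → ℝ)).restrict (cube d)

lemma cubeMeas_eq_pi (d : ℕ) :
    cubeMeas d = Measure.pi (fun _ : Fin d => (volume : Measure ℝ).restrict (Ioo 0 1)) := by
  rw [cubeMeas, cube, volume_pi, Measure.restrict_pi_pi]

lemma isOpen_cube (d : ℕ) : IsOpen (cube d) :=
  isOpen_set_pi Set.finite_univ (fun _ _ => isOpen_Ioo)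

lemma measurableSet_cube (d : ℕ) : MeasurableSet (cube d) := (isOpen_cube d).measurableSet

lemma mem_cube {x : Fin d → ℝ} : x ∈ cube d ↔ ∀ i, x i ∈ Ioo (0 : ℝ) 1 := by
  simp [cube, Set.mem_pi]

/-- The closed cube. -/
def closedCube (d : ℕ) : Set (Fin d → ℝ) := Set.pi Set.univ (fun _ => Set.Icc (0 : ℝ) 1)

lemma isCompact_closedCube (d : ℕ) : IsCompact (closedCube d) :=
  isCompact_univ_pi (fun _ => isCompact_Icc)

lemma cube_subset_closedCube (d : ℕ) : cube d ⊆ closedCube d :=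
  Set.pi_mono (fun _ _ => Ioo_subset_Icc_self)

instance isFiniteMeasure_cubeMeas (d : ℕ) : IsFiniteMeasure (cubeMeas d) :=
  ⟨by
    rw [Measure.restrict_apply_univ]
    exact (measure_mono (cube_subset_closedCube d)).trans_lt (isCompact_closedCube d).measure_lt_top⟩

lemma memLp_of_bounded {F : (Fin d → ℝ) → ℝ} (hF : Continuous F) {p : ℝ≥0∞} :
    MemLp F p (cubeMeas d) := by
  obtain ⟨C, hC⟩ := (isCompact_closedCube d).exists_bound_of_continuousOn hF.continuousOn
  refine MemLp.of_bound hF.aestronglyMeasurable C ?_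
  filter_upwards [ae_restrict_mem (measurableSet_cube d)] with x hx
  exact hC x (cube_subset_closedCube d hx)

/-- The class in `L²` of a square integrable function (`0` if it is not square integrable). -/
def toL2 (F : (Fin d → ℝ) → ℝ) : L2 d :=
  open Classical in if h : MemLp F 2 (cubeMeas d) then h.toLp F else 0

lemma coeFn_toL2 {F : (Fin d → ℝ) → ℝ} (hF : MemLp F 2 (cubeMeas d)) :
    (toL2 F : (Fin d → ℝ) → ℝ) =ᵐ[cubeMeas d] F := by
  rw [toL2, dif_pos hF]
  exact hF.coeFn_toLp

lemma inner_L2_eq (v w : L2 d) : inner ℝ v w = ∫ x in cube d, v x * w x := by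
  rw [L2.inner_def]
  refine integral_congr_ae (Eventually.of_forall fun x => ?_)
  simp [mul_comm]

lemma pairing_eq_inner (v : L2 d) {ψ : (Fin d → ℝ) → ℝ} (hψ : Continuous ψ) :
    pairing v ψ = inner ℝ v (toL2 ψ) := by
  rw [pairing, inner_L2_eq]
  refine integral_congr_ae ?_
  filter_upwards [coeFn_toL2 (memLp_of_bounded hψ)] with x hx
  rw [hx]

lemma pairing_toL2 {F : (Fin d → ℝ) → ℝ} (hF : Continuous F) (ψ : (Fin d → ℝ) → ℝ) :
    pairing (toL2 F) ψ = ∫ x in cube d, F x * ψ x := by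
  rw [pairing]
  refine integral_congr_ae ?_
  filter_upwards [coeFn_toL2 (memLp_of_bounded hF)] with x hx
  rw [hx]

lemma pairing_congr (v : L2 d) {ψ χ : (Fin d → ℝ) → ℝ} (h : ∀ x ∈ cube d, ψ x = χ x) :
    pairing v ψ = pairing v χ :=
  setIntegral_congr_fun (measurableSet_cube d) (fun x hx => by simp [h x hx])

lemma toL2_add {F G : (Fin d → ℝ) → ℝ} (hF : Continuous F) (hG : Continuous G) :
    toL2 (fun x => F x + G x) = toL2 F + toL2 G := by
  apply Lp.ext
  filter_upwards [coeFn_toL2 (memLp_of_bounded hF), coeFn_toL2 (memLp_of_bounded hG),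
    coeFn_toL2 (memLp_of_bounded (hF.add hG)), Lp.coeFn_add (toL2 F) (toL2 G)] with x h1 h2 h3 h4
  rw [h4, Pi.add_apply, h1, h2]
  exact h3

lemma toL2_smul (c : ℝ) {F : (Fin d → ℝ) → ℝ} (hF : Continuous F) :
    toL2 (fun x => c * F x) = c • toL2 F := by
  apply Lp.ext
  filter_upwards [coeFn_toL2 (memLp_of_bounded hF),
    coeFn_toL2 (memLp_of_bounded (hF.const_mul c)), Lp.coeFn_smul c (toL2 F)] with x h1 h2 h3
  rw [h3, h2, Pi.smul_apply, h1, smul_eq_mul]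

lemma integrable_L2 (v : L2 d) : Integrable (fun x => v x) (cubeMeas d) :=
  (Lp.memLp v).integrable (by norm_num)

lemma tendsto_pairing (v : L2 d) {h : ℕ → (Fin d → ℝ) → ℝ} {h' : (Fin d → ℝ) → ℝ} {C : ℝ}
    (hc : ∀ m, Continuous (h m)) (hb : ∀ m, ∀ x ∈ cube d, |h m x| ≤ C)
    (hl : ∀ x ∈ cube d, Tendsto (fun m => h m x) atTop (𝓝 (h' x))) :
    Tendsto (fun m => pairing v (h m)) atTop (𝓝 (pairing v h')) := by
  refine tendsto_integral_of_dominated_convergence (fun x => ‖v x‖ * C) (fun m => ?_) ?_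
    (fun m => ?_) ?_
  · exact (Lp.aestronglyMeasurable v).mul (hc m).aestronglyMeasurable
  · exact (integrable_L2 v).norm.mul_const C
  · filter_upwards [ae_restrict_mem (measurableSet_cube d)] with x hx
    rw [norm_mul]
    exact mul_le_mul_of_nonneg_left (hb m x hx) (norm_nonneg _)
  · filter_upwards [ae_restrict_mem (measurableSet_cube d)] with x hx
    exact (hl x hx).const_mul _

/-! ### Products of functions of one variable -/

/-- `x ↦ ∏ i, f i (x i)`. -/
def prodFun (f : Fin d → ℝ → ℝ) : (Fin d → ℝ) → ℝ := fun x => ∏ i, f i (x i)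

lemma contDiff_prodFun {f : Fin d → ℝ → ℝ} (hf : ∀ i, ContDiff ℝ ∞ (f i)) :
    ContDiff ℝ ∞ (prodFun f) := by
  unfold prodFun
  exact contDiff_prod (fun i _ => (hf i).comp (contDiff_apply ℝ ℝ i))

lemma continuous_prodFun {f : Fin d → ℝ → ℝ} (hf : ∀ i, Continuous (f i)) :
    Continuous (prodFun f) :=
  continuous_finsetProd _ (fun i _ => (hf i).comp (continuous_apply i))

lemma contDiff_deriv {f : ℝ → ℝ} (hf : ContDiff ℝ ∞ f) : ContDiff ℝ ∞ (deriv f) := by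
  have := hf.iterate_deriv 1
  simpa using this

lemma pd_prodFun {f : Fin d → ℝ → ℝ} (hf : ∀ i, ContDiff ℝ ∞ (f i)) (i : Fin d) :
    pd i (prodFun f) = prodFun (Function.update f i (deriv (f i))) := by
  funext x
  have hd : DifferentiableAt ℝ (prodFun f) x :=
    ((contDiff_prodFun hf).differentiable (by simp)) x
  have h1 : HasDerivAt (fun t : ℝ => prodFun f (x + t • Pi.single i (1 : ℝ)))
      (fderiv ℝ (prodFun f) x (Pi.single i 1)) 0 := by
    have := hd.hasFDerivAt.hasLineDerivAt (Pi.single i (1 : ℝ))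
    exact this
  have h2 : (fun t : ℝ => prodFun f (x + t • Pi.single i (1 : ℝ)))
      = fun t => f i (x i + t) * ∏ j ∈ Finset.univ.erase i, f j (x j) := by
    funext t
    rw [prodFun, ← Finset.mul_prod_erase _ _ (Finset.mem_univ i)]
    congr 1
    · simp
    · refine Finset.prod_congr rfl (fun j hj => ?_)
      rw [Finset.mem_erase] at hj
      simp [hj.1]
  have h3 : HasDerivAt (fun t : ℝ => f i (x i + t) * ∏ j ∈ Finset.univ.erase i, f j (x j))
      (deriv (f i) (x i) * ∏ j ∈ Finset.univ.erase i, f j (x j)) 0 := by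
    have h4 : HasDerivAt (f i) (deriv (f i) (x i)) (x i + 0) := by
      rw [add_zero]
      exact (((hf i).differentiable (by simp)) (x i)).hasDerivAt
    exact (h4.comp_const_add (x i) 0).mul_const _
  rw [h2] at h1
  rw [pd, h1.unique h3, prodFun, ← Finset.mul_prod_erase _ _ (Finset.mem_univ i)]
  congr 1
  · simp
  · refine Finset.prod_congr rfl (fun j hj => ?_)
    rw [Finset.mem_erase] at hj
    simp [hj.1]

lemma iterate_pd_prodFun {f : Fin d → ℝ → ℝ} (hf : ∀ i, ContDiff ℝ ∞ (f i)) (i : Fin d) (k : ℕ) :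
    (pd i)^[k] (prodFun f) = prodFun (Function.update f i (deriv^[k] (f i))) := by
  induction k with
  | zero => simp
  | succ k ih =>
    rw [Function.iterate_succ_apply', ih, pd_prodFun]
    · simp [Function.iterate_succ_apply']
    · intro j
      by_cases h : j = i
      · subst h; simpa using (hf j).iterate_deriv k
      · simpa [h] using hf j

lemma foldr_pd_prodFun {f : Fin d → ℝ → ℝ} (hf : ∀ i, ContDiff ℝ ∞ (f i)) (α : Fin d → ℕ)
    (l : List (Fin d)) (hl : l.Nodup) :
    l.foldr (fun i h => (pd i)^[α i] h) (prodFun f)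
      = prodFun (fun i => if i ∈ l then deriv^[α i] (f i) else f i) := by
  induction l with
  | nil => simp
  | cons a l ih =>
    rw [List.nodup_cons] at hl
    rw [List.foldr_cons, ih hl.2, iterate_pd_prodFun]
    · congr 1
      funext j
      by_cases h : j = a
      · subst h; simp [hl.1]
      · simp [h]
    · intro j
      by_cases h : j ∈ l
      · simpa [h] using (hf j).iterate_deriv _
      · simpa [h] using hf j

lemma mpd_prodFun {f : Fin d → ℝ → ℝ} (hf : ∀ i, ContDiff ℝ ∞ (f i)) (α : Fin d → ℕ) :
    mpd α (prodFun f) = prodFun (fun i => deriv^[α i] (f i)) := by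
  rw [mpd, foldr_pd_prodFun hf α _ (List.nodup_finRange d)]
  simp

lemma isTest_prodFun {f : Fin d → ℝ → ℝ} (hf : ∀ i, ContDiff ℝ ∞ (f i))
    (hs : ∀ i, tsupport (f i) ⊆ Ioo 0 1) : IsTest (prodFun f) := by
  have hsub : tsupport (prodFun f) ⊆ Set.pi Set.univ (fun i => tsupport (f i)) := by
    refine closure_minimal (fun x hx => ?_) (isClosed_set_pi (fun i _ => isClosed_tsupport _))
    intro i _
    apply subset_tsupport
    intro h0
    exact hx (Finset.prod_eq_zero (Finset.mem_univ i) h0)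
  have hcomp : ∀ i, IsCompact (tsupport (f i)) := fun i =>
    isCompact_Icc.of_isClosed_subset (isClosed_tsupport _) ((hs i).trans Ioo_subset_Icc_self)
  refine ⟨contDiff_prodFun hf, ?_, hsub.trans (Set.pi_mono (fun i _ => hs i))⟩
  exact (isCompact_univ_pi hcomp).of_isClosed_subset (isClosed_tsupport _) hsub

/-! ### Cut-off functions on the unit interval -/

lemma exists_bound_deriv_smoothTransition :
    ∃ C : ℝ, 0 ≤ C ∧ ∀ x, |deriv Real.smoothTransition x| ≤ C ∧
      (x < 0 ∨ 1 < x → deriv Real.smoothTransition x = 0) := by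
  have hc : Continuous (deriv Real.smoothTransition) :=
    (contDiff_deriv Real.smoothTransition.contDiff).continuous
  obtain ⟨C, hC⟩ := isCompact_Icc.exists_bound_of_continuousOn (s := Icc (0 : ℝ) 1)
    hc.continuousOn
  have h0 : ∀ x : ℝ, x < 0 ∨ 1 < x → deriv Real.smoothTransition x = 0 := by
    rintro x (hx | hx)
    · have : Real.smoothTransition =ᶠ[𝓝 x] fun _ => 0 := by
        filter_upwards [Iio_mem_nhds hx] with y hy
        exact Real.smoothTransition.zero_of_nonpos (le_of_lt hy)
      rw [this.deriv_eq]; simp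
    · have : Real.smoothTransition =ᶠ[𝓝 x] fun _ => 1 := by
        filter_upwards [Ioi_mem_nhds hx] with y hy
        exact Real.smoothTransition.one_of_one_le (le_of_lt hy)
      rw [this.deriv_eq]; simp
  refine ⟨C, (norm_nonneg _).trans (hC 0 (by simp)), fun x => ⟨?_, h0 x⟩⟩
  by_cases hx : x ∈ Icc (0 : ℝ) 1
  · exact hC x hx
  · rw [h0 x (by rwa [Set.mem_Icc, not_and_or, not_le, not_le] at hx), abs_zero]
    exact (norm_nonneg _).trans (hC 0 (by simp))

/-- Smooth cut-off functions with compact support in `(0,1)`, which tend to `1`. -/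
def cutoff (m : ℕ) (x : ℝ) : ℝ :=
  Real.smoothTransition ((m + 3 : ℝ) * x - 1) * Real.smoothTransition ((m + 3 : ℝ) * (1 - x) - 1)

lemma contDiff_cutoff (m : ℕ) : ContDiff ℝ ∞ (cutoff m) := by
  unfold cutoff
  refine ContDiff.mul ?_ ?_
  · exact Real.smoothTransition.contDiff.comp (by fun_prop)
  · exact Real.smoothTransition.contDiff.comp (by fun_prop)

lemma hasDerivAt_cutoff (m : ℕ) (x : ℝ) : HasDerivAt (cutoff m)
    ((m + 3 : ℝ) * deriv Real.smoothTransition ((m + 3 : ℝ) * x - 1)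
        * Real.smoothTransition ((m + 3 : ℝ) * (1 - x) - 1)
      - (m + 3 : ℝ) * deriv Real.smoothTransition ((m + 3 : ℝ) * (1 - x) - 1)
        * Real.smoothTransition ((m + 3 : ℝ) * x - 1)) x := by
  have hs : ∀ y, HasDerivAt Real.smoothTransition (deriv Real.smoothTransition y) y := fun y =>
    ((Real.smoothTransition.contDiff (n := 1)).differentiable (by simp) y).hasDerivAt
  have h1 : HasDerivAt (fun x : ℝ => (m + 3 : ℝ) * x - 1) (m + 3 : ℝ) x := by
    simpa using ((hasDerivAt_id x).const_mul (m + 3 : ℝ)).sub_const 1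
  have h2 : HasDerivAt (fun x : ℝ => (m + 3 : ℝ) * (1 - x) - 1) (-(m + 3 : ℝ)) x := by
    simpa using (((hasDerivAt_id x).const_sub 1).const_mul (m + 3 : ℝ)).sub_const 1
  have h3 := ((hs _).comp x h1).mul ((hs _).comp x h2)
  refine HasDerivAt.congr_deriv (f := cutoff m) h3 ?_
  simp only [Function.comp_apply]
  ring

lemma cutoff_mem (m : ℕ) (x : ℝ) : 0 ≤ cutoff m x ∧ cutoff m x ≤ 1 :=
  ⟨mul_nonneg (Real.smoothTransition.nonneg _) (Real.smoothTransition.nonneg _),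
    mul_le_one₀ (Real.smoothTransition.le_one _) (Real.smoothTransition.nonneg _)
      (Real.smoothTransition.le_one _)⟩

lemma tsupport_cutoff (m : ℕ) : tsupport (cutoff m) ⊆ Ioo 0 1 := by
  have hm : (0 : ℝ) < m + 3 := by positivity
  have : tsupport (cutoff m) ⊆ Icc (1 / (m + 3 : ℝ)) (1 - 1 / (m + 3 : ℝ)) := by
    refine closure_minimal (fun x hx => ?_) isClosed_Icc
    by_contra hn
    apply hx
    rw [Set.mem_Icc, not_and_or, not_le, not_le] at hn
    rcases hn with h | h
    · rw [lt_div_iff₀ hm] at h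
      simp only [cutoff]
      rw [Real.smoothTransition.zero_of_nonpos (by nlinarith), zero_mul]
    · have h' : 1 - x < 1 / (m + 3 : ℝ) := by linarith
      rw [lt_div_iff₀ hm] at h'
      simp only [cutoff]
      rw [Real.smoothTransition.zero_of_nonpos (x := (m + 3 : ℝ) * (1 - x) - 1) (by nlinarith),
        mul_zero]
  refine this.trans (fun x hx => ⟨?_, ?_⟩)
  · exact (by positivity : (0 : ℝ) < 1 / (m + 3 : ℝ)).trans_le hx.1
  · have : (0 : ℝ) < 1 / (m + 3 : ℝ) := by positivity
    linarith [hx.2]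

lemma eventually_large {x : ℝ} (hx : 0 < x) : ∀ᶠ m : ℕ in atTop, 1 < (m + 3 : ℝ) * x - 1 := by
  have h : Tendsto (fun m : ℕ => (m + 3 : ℝ) * x - 1) atTop atTop := by
    refine tendsto_atTop_add_const_right _ _ (Tendsto.atTop_mul_const hx ?_)
    exact tendsto_atTop_add_const_right _ _ tendsto_natCast_atTop_atTop
  exact h.eventually_gt_atTop 1

lemma eventually_cutoff_eq {x : ℝ} (hx : x ∈ Ioo (0 : ℝ) 1) : ∀ᶠ m : ℕ in atTop,
    cutoff m x = 1 ∧ deriv (cutoff m) x = 0 := by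
  obtain ⟨C, -, hC⟩ := exists_bound_deriv_smoothTransition
  filter_upwards [eventually_large hx.1, eventually_large (sub_pos.2 hx.2)] with m h1 h2
  refine ⟨?_, ?_⟩
  · simp only [cutoff]
    rw [Real.smoothTransition.one_of_one_le h1.le, Real.smoothTransition.one_of_one_le h2.le,
      one_mul]
  · rw [(hasDerivAt_cutoff m x).deriv, (hC _).2 (Or.inr h1), (hC _).2 (Or.inr h2)]
    simp

/-- `f` times the cut-off function. -/
def cutFun (f : ℝ → ℝ) (m : ℕ) : ℝ → ℝ := fun x => f x * cutoff m x

lemma contDiff_cutFun {f : ℝ → ℝ} (hf : ContDiff ℝ ∞ f) (m : ℕ) : ContDiff ℝ ∞ (cutFun f m) :=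
  hf.mul (contDiff_cutoff m)

lemma tsupport_cutFun (f : ℝ → ℝ) (m : ℕ) : tsupport (cutFun f m) ⊆ Ioo 0 1 :=
  (tsupport_mul_subset_right).trans (tsupport_cutoff m)

lemma tendsto_cutFun (f : ℝ → ℝ) {x : ℝ} (hx : x ∈ Ioo (0 : ℝ) 1) :
    Tendsto (fun m => cutFun f m x) atTop (𝓝 (f x)) := by
  refine tendsto_const_nhds.congr' ?_
  filter_upwards [eventually_cutoff_eq hx] with m hm
  simp [cutFun, hm.1]

lemma exists_bound_Ioo {f : ℝ → ℝ} (hf : Continuous f) :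
    ∃ C : ℝ, 0 ≤ C ∧ ∀ x ∈ Icc (0 : ℝ) 1, |f x| ≤ C := by
  obtain ⟨C, hC⟩ := isCompact_Icc.exists_bound_of_continuousOn (s := Icc (0 : ℝ) 1)
    hf.continuousOn
  exact ⟨C, (norm_nonneg _).trans (hC 0 (by simp)), hC⟩

lemma exists_bound_cutFun {f : ℝ → ℝ} (hf : Continuous f) :
    ∃ C : ℝ, 0 ≤ C ∧ ∀ m, ∀ x ∈ Ioo (0 : ℝ) 1, |cutFun f m x| ≤ C := by
  obtain ⟨C, hC0, hC⟩ := exists_bound_Ioo hf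
  refine ⟨C, hC0, fun m x hx => ?_⟩
  rw [cutFun, abs_mul, abs_of_nonneg (cutoff_mem m x).1]
  calc |f x| * cutoff m x ≤ C * 1 :=
        mul_le_mul (hC x (Ioo_subset_Icc_self hx)) (cutoff_mem m x).2 (cutoff_mem m x).1 hC0
    _ = C := mul_one C

lemma deriv_cutFun {f : ℝ → ℝ} (hf : ContDiff ℝ ∞ f) (m : ℕ) (x : ℝ) :
    deriv (cutFun f m) x = deriv f x * cutoff m x + f x * deriv (cutoff m) x := by
  unfold cutFun
  exact deriv_fun_mul ((hf.differentiable (by simp)) x)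
    (((contDiff_cutoff m).differentiable (by simp)) x)

lemma tendsto_deriv_cutFun {f : ℝ → ℝ} (hf : ContDiff ℝ ∞ f) {x : ℝ} (hx : x ∈ Ioo (0 : ℝ) 1) :
    Tendsto (fun m => deriv (cutFun f m) x) atTop (𝓝 (deriv f x)) := by
  refine tendsto_const_nhds.congr' ?_
  filter_upwards [eventually_cutoff_eq hx] with m hm
  rw [deriv_cutFun hf, hm.1, hm.2]
  simp

/-- The derivative of the cut-off is of order m + 3, but it is supported where (m + 3) times the
distance to an endpoint is at most 2. There |f| is at most L times that distance, so the product
stays bounded by 2LC near each end. This permits dominated convergence for functions that vanish at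
0 and 1 without compact support. -/
lemma exists_bound_deriv_cutFun {f : ℝ → ℝ} (hf : ContDiff ℝ ∞ f) (h0 : f 0 = 0) (h1 : f 1 = 0) :
    ∃ C : ℝ, 0 ≤ C ∧ ∀ m, ∀ x ∈ Ioo (0 : ℝ) 1, |deriv (cutFun f m) x| ≤ C := by
  obtain ⟨L, hL0, hL⟩ := exists_bound_Ioo (contDiff_deriv hf).continuous
  obtain ⟨C, hC0, hC⟩ := exists_bound_deriv_smoothTransition
  have hlip : ∀ x ∈ Icc (0 : ℝ) 1, ∀ y ∈ Icc (0 : ℝ) 1, |f y - f x| ≤ L * |y - x| := by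
    intro x hx y hy
    exact (convex_Icc (0 : ℝ) 1).norm_image_sub_le_of_norm_deriv_le
      (fun z _ => (hf.differentiable (by simp)) z) (fun z hz => hL z hz) hx hy
  have hsT : ∀ y, |Real.smoothTransition y| ≤ 1 := fun y => by
    rw [abs_of_nonneg (Real.smoothTransition.nonneg y)]
    exact Real.smoothTransition.le_one y
  refine ⟨L + (2 * L * C + 2 * L * C), by positivity, fun m x hx => ?_⟩
  have hx' := Ioo_subset_Icc_self hx
  have hm : (0 : ℝ) < m + 3 := by positivity
  have hb : ∀ y z : ℝ, y ∈ Icc (0 : ℝ) 1 → |f x| ≤ L * y →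
      |f x * ((m + 3 : ℝ) * deriv Real.smoothTransition ((m + 3 : ℝ) * y - 1)
        * Real.smoothTransition z)| ≤ 2 * L * C := by
    intro y z hy hfy
    by_cases hc : 1 < (m + 3 : ℝ) * y - 1
    · rw [(hC _).2 (Or.inr hc)]
      simp; positivity
    · push Not at hc
      rw [abs_mul, abs_mul, abs_mul, abs_of_pos hm]
      have e1 : |f x| * (m + 3 : ℝ) ≤ 2 * L := by
        calc |f x| * (m + 3 : ℝ) ≤ L * y * (m + 3) := mul_le_mul_of_nonneg_right hfy hm.le
          _ = L * ((m + 3) * y) := by ring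
          _ ≤ L * 2 := mul_le_mul_of_nonneg_left (by linarith) hL0
          _ = 2 * L := by ring
      calc |f x| * ((m + 3 : ℝ) * |deriv Real.smoothTransition ((m + 3 : ℝ) * y - 1)|
            * |Real.smoothTransition z|)
          = (|f x| * (m + 3 : ℝ)) * |deriv Real.smoothTransition ((m + 3 : ℝ) * y - 1)|
            * |Real.smoothTransition z| := by ring
        _ ≤ (2 * L) * C * 1 := by
            refine mul_le_mul (mul_le_mul e1 (hC _).1 (abs_nonneg _) (by positivity)) (hsT z)
              (abs_nonneg _) (by positivity)
        _ = 2 * L * C := mul_one _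
  have hf0 : |f x| ≤ L * x := by
    have := hlip 0 (by simp) x hx'
    rwa [h0, sub_zero, sub_zero, abs_of_pos hx.1] at this
  have hf1 : |f x| ≤ L * (1 - x) := by
    have := hlip x hx' 1 (by simp)
    rw [h1, zero_sub, abs_neg, abs_of_pos (sub_pos.2 hx.2)] at this
    exact this
  rw [deriv_cutFun hf, (hasDerivAt_cutoff m x).deriv, mul_sub]
  refine (abs_add_le _ _).trans (add_le_add ?_ ((abs_sub _ _).trans (add_le_add ?_ ?_)))
  · rw [abs_mul, abs_of_nonneg (cutoff_mem m x).1]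
    calc _ ≤ L * 1 := mul_le_mul (hL x hx') (cutoff_mem m x).2 (cutoff_mem m x).1 hL0
      _ = L := mul_one L
  · exact hb x _ hx' hf0
  · exact hb (1 - x) _ ⟨by linarith [hx.2], by linarith [hx.1]⟩ hf1

/-! ### Extension of weak identities to products that need not have compact support -/

lemma tendsto_pairing_prodFun (v : L2 d) {h : ℕ → Fin d → ℝ → ℝ} {h' : Fin d → ℝ → ℝ}
    (hc : ∀ m i, Continuous (h m i))
    (hb : ∀ i, ∃ C : ℝ, 0 ≤ C ∧ ∀ m, ∀ x ∈ Ioo (0 : ℝ) 1, |h m i x| ≤ C)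
    (hl : ∀ i, ∀ x ∈ Ioo (0 : ℝ) 1, Tendsto (fun m => h m i x) atTop (𝓝 (h' i x))) :
    Tendsto (fun m => pairing v (prodFun (h m))) atTop (𝓝 (pairing v (prodFun h'))) := by
  choose C hC0 hC using hb
  refine tendsto_pairing v (C := ∏ i, C i) (fun m => continuous_prodFun (hc m)) ?_ ?_
  · intro m x hx
    rw [prodFun, Finset.abs_prod]
    exact Finset.prod_le_prod (fun i _ => abs_nonneg _) (fun i _ => hC i m _ (mem_cube.1 hx i))
  · intro x hx
    exact tendsto_finsetProd _ (fun i _ => hl i _ (mem_cube.1 hx i))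

lemma sum_ind (S : Finset (Fin d)) : ∑ i, ind S i = S.card := by
  simp [ind]

/-- The derivative of `prodFun f` in the directions of `S`. -/
def derivOn (S : Finset (Fin d)) (f : Fin d → ℝ → ℝ) : Fin d → ℝ → ℝ :=
  fun i => if i ∈ S then deriv (f i) else f i

lemma mpd_ind_prodFun {f : Fin d → ℝ → ℝ} (hf : ∀ i, ContDiff ℝ ∞ (f i)) (S : Finset (Fin d)) :
    mpd (ind S) (prodFun f) = prodFun (derivOn S f) := by
  rw [mpd_prodFun hf]
  congr 1
  funext i
  by_cases h : i ∈ S <;> simp [ind, derivOn, h]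

lemma contDiff_derivOn {f : Fin d → ℝ → ℝ} (hf : ∀ i, ContDiff ℝ ∞ (f i)) (S : Finset (Fin d))
    (i : Fin d) : ContDiff ℝ ∞ (derivOn S f i) := by
  by_cases h : i ∈ S
  · simpa [derivOn, h] using contDiff_deriv (hf i)
  · simpa [derivOn, h] using hf i

/-- Cut off every factor and pass to the limit. The derivative reaches the cut-off only in the
directions of `S`, which is why endpoint values matter there alone; sines and derivatives of cosines
both qualify. -/
theorem IsWeakDeriv.prodFun {S : Finset (Fin d)} {v g : L2 d} (h : IsWeakDeriv (ind S) v g)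
    {f : Fin d → ℝ → ℝ} (hf : ∀ i, ContDiff ℝ ∞ (f i)) (h0 : ∀ i ∈ S, f i 0 = 0 ∧ f i 1 = 0) :
    pairing v (prodFun (derivOn S f)) = (-1) ^ S.card * pairing g (prodFun f) := by
  have h1 : ∀ m, pairing v (DirSplit.prodFun (derivOn S fun i => cutFun (f i) m))
      = (-1) ^ S.card * pairing g (DirSplit.prodFun fun i => cutFun (f i) m) := by
    intro m
    have hs : ∀ i, ContDiff ℝ ∞ (cutFun (f i) m) := fun i => contDiff_cutFun (hf i) m
    have := h _ (isTest_prodFun hs (fun i => tsupport_cutFun (f i) m))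
    rwa [mpd_ind_prodFun hs, sum_ind] at this
  have t1 : Tendsto (fun m => pairing v (DirSplit.prodFun (derivOn S fun i => cutFun (f i) m))) atTop
      (𝓝 (pairing v (DirSplit.prodFun (derivOn S f)))) := by
    refine tendsto_pairing_prodFun v (fun m i => (contDiff_derivOn
      (fun i => contDiff_cutFun (hf i) m) S i).continuous) ?_ ?_
    · intro i
      by_cases hi : i ∈ S
      · simpa [derivOn, hi] using exists_bound_deriv_cutFun (hf i) (h0 i hi).1 (h0 i hi).2
      · simpa [derivOn, hi] using exists_bound_cutFun (hf i).continuous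
    · intro i x hx
      by_cases hi : i ∈ S
      · simpa [derivOn, hi] using tendsto_deriv_cutFun (hf i) hx
      · simpa [derivOn, hi] using tendsto_cutFun (f i) hx
  have t2 : Tendsto (fun m => (-1) ^ S.card * pairing g (DirSplit.prodFun fun i => cutFun (f i) m))
      atTop (𝓝 ((-1) ^ S.card * pairing g (DirSplit.prodFun f))) := by
    refine Tendsto.const_mul _ (tendsto_pairing_prodFun g
      (fun m i => (contDiff_cutFun (hf i) m).continuous)
      (fun i => exists_bound_cutFun (hf i).continuous) (fun i x hx => tendsto_cutFun (f i) hx))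
  exact tendsto_nhds_unique (t1.congr h1) t2

/-- A smooth function equal to `1` near the unit interval. -/
def unitBump : ContDiffBump (1 / 2 : ℝ) := ⟨1, 2, one_pos, one_lt_two⟩

lemma unitBump_eq_one {x : ℝ} (hx : x ∈ Ioo (0 : ℝ) 1) : unitBump x = 1 := by
  apply unitBump.one_of_mem_closedBall
  rw [Metric.mem_closedBall, Real.dist_eq, abs_le]
  simp only [unitBump]
  constructor <;> linarith [hx.1, hx.2]

/-- The defining test functions may be nonzero on the boundary, so it suffices to multiply each
factor by a bump equal to 1 on the unit interval. No endpoint condition on `f` is needed. -/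
theorem IsZeroTraceDeriv.prodFun {i : Fin d} {v g : L2 d} (h : IsZeroTraceDeriv i v g)
    {f : Fin d → ℝ → ℝ} (hf : ∀ i, ContDiff ℝ ∞ (f i)) :
    pairing v (prodFun (Function.update f i (deriv (f i)))) = - pairing g (prodFun f) := by
  set f' : Fin d → ℝ → ℝ := fun j x => f j x * unitBump x with hf'
  have hs : ∀ j, ContDiff ℝ ∞ (f' j) := fun j => (hf j).mul unitBump.contDiff
  have hcomp : ∀ j, HasCompactSupport (f' j) := fun j => unitBump.hasCompactSupport.mul_left
  have hsub : tsupport (DirSplit.prodFun f') ⊆ Set.pi Set.univ (fun j => tsupport (f' j)) := by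
    refine closure_minimal (fun x hx => ?_) (isClosed_set_pi (fun i _ => isClosed_tsupport _))
    intro j _
    apply subset_tsupport
    intro h0
    exact hx (Finset.prod_eq_zero (Finset.mem_univ j) h0)
  have hc : HasCompactSupport (DirSplit.prodFun f') :=
    (isCompact_univ_pi hcomp).of_isClosed_subset (isClosed_tsupport _) hsub
  have h1 := h _ (contDiff_prodFun hs) hc
  rw [pd_prodFun hs] at h1
  have e1 : ∀ j, ∀ x ∈ Ioo (0 : ℝ) 1, f' j x = f j x := fun j x hx => by
    simp [hf', unitBump_eq_one hx]
  have e2 : ∀ x ∈ Ioo (0 : ℝ) 1, deriv (f' i) x = deriv (f i) x := fun x hx => by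
    apply Filter.EventuallyEq.deriv_eq
    filter_upwards [Ioo_mem_nhds hx.1 hx.2] with y hy using e1 i y hy
  rw [pairing_congr g (χ := DirSplit.prodFun f), pairing_congr v
    (χ := DirSplit.prodFun (Function.update f i (deriv (f i))))] at h1
  · exact h1
  · intro x hx
    refine Finset.prod_congr rfl (fun j _ => ?_)
    by_cases hj : j = i
    · subst hj; simpa using e2 _ (mem_cube.1 hx j)
    · simpa [hj] using e1 j _ (mem_cube.1 hx j)
  · intro x hx
    exact Finset.prod_congr rfl (fun j _ => e1 j _ (mem_cube.1 hx j))

/-- `prodFun f` differentiated twice in the directions of `S`. -/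
def derivTwoOn (S : Finset (Fin d)) (f : Fin d → ℝ → ℝ) : Fin d → ℝ → ℝ :=
  fun i => if i ∈ S then deriv (deriv (f i)) else f i

lemma contDiff_derivTwoOn {f : Fin d → ℝ → ℝ} (hf : ∀ i, ContDiff ℝ ∞ (f i))
    (S : Finset (Fin d)) (i : Fin d) : ContDiff ℝ ∞ (derivTwoOn S f i) := by
  by_cases h : i ∈ S
  · simpa [derivTwoOn, h] using contDiff_deriv (contDiff_deriv (hf i))
  · simpa [derivTwoOn, h] using hf i

lemma mpd_two_ind_prodFun {f : Fin d → ℝ → ℝ} (hf : ∀ i, ContDiff ℝ ∞ (f i))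
    (S : Finset (Fin d)) : mpd (2 • ind S) (prodFun f) = prodFun (derivTwoOn S f) := by
  rw [mpd_prodFun hf]
  congr 1
  funext i
  by_cases h : i ∈ S <;> simp [ind, derivTwoOn, h]

lemma pairing_sum {ι : Type*} (s : Finset ι) (v : L2 d) (c : ι → ℝ)
    (F : ι → (Fin d → ℝ) → ℝ) (hF : ∀ k ∈ s, Continuous (F k)) :
    pairing v (fun x => ∑ k ∈ s, c k * F k x) = ∑ k ∈ s, c k * pairing v (F k) := by
  simp only [pairing, Finset.mul_sum]
  rw [integral_finsetSum]
  · refine Finset.sum_congr rfl (fun k _ => ?_)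
    rw [← integral_const_mul]
    exact integral_congr_ae (Eventually.of_forall fun x => by ring)
  · intro k hk
    have : Integrable (fun x => v x * F k x) (cubeMeas d) :=
      (Lp.memLp v).integrable_mul (memLp_of_bounded (p := 2) (hF k hk))
    refine (this.const_mul (c k)).congr (Eventually.of_forall fun x => by simp only; ring)

/-- An even constant coefficient operator applied to a function that vanishes on all faces can be
tested with products that vanish on the faces. -/
theorem pairing_even_operator {v g : L2 d} {w : Fin d → L2 d}
    (hw : ∀ i, IsZeroTraceDeriv i v (w i)) (c : Finset (Fin d) → ℝ)
    (h : ∀ ψ, IsTest ψ →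
      pairing v (fun x => ∑ S : Finset (Fin d), c S * mpd (2 • ind S) ψ x) = pairing g ψ)
    {f : Fin d → ℝ → ℝ} (hf : ∀ i, ContDiff ℝ ∞ (f i)) (h0 : ∀ i, f i 0 = 0 ∧ f i 1 = 0) :
    ∑ S : Finset (Fin d), c S * pairing v (prodFun (derivTwoOn S f)) = pairing g (prodFun f) := by
  -- The set J contains the directions in which the factor only vanishes at the endpoints; in the
  -- others it has compact support. The cut-off is removed in one direction at a time.
  suffices H : ∀ J : Finset (Fin d), ∀ f : Fin d → ℝ → ℝ, (∀ i, ContDiff ℝ ∞ (f i)) →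
      (∀ i ∈ J, f i 0 = 0 ∧ f i 1 = 0) → (∀ i ∉ J, tsupport (f i) ⊆ Ioo 0 1) →
      ∑ S : Finset (Fin d), c S * pairing v (prodFun (derivTwoOn S f))
        = pairing g (prodFun f) from
    H Finset.univ f hf (fun i _ => h0 i) (fun i hi => absurd (Finset.mem_univ i) hi)
  intro J
  induction J using Finset.induction_on with
  | empty =>
    intro f hf _ hs
    rw [← h _ (isTest_prodFun hf (fun i => hs i (by simp)))]
    simp only [mpd_two_ind_prodFun hf]
    rw [pairing_sum]
    intro S _
    exact continuous_prodFun (fun i => (contDiff_derivTwoOn hf S i).continuous)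
  | insert k J hk ih =>
    intro f hf h0 hs
    set F : ℕ → Fin d → ℝ → ℝ := fun m => Function.update f k (cutFun (f k) m) with hF
    have hFs : ∀ m i, ContDiff ℝ ∞ (F m i) := by
      intro m i
      by_cases hi : i = k
      · subst hi; simpa [hF] using contDiff_cutFun (hf i) m
      · simpa [hF, hi] using hf i
    have h1 : ∀ m, ∑ S : Finset (Fin d), c S * pairing v (prodFun (derivTwoOn S (F m)))
        = pairing g (prodFun (F m)) := by
      intro m
      refine ih (F m) (hFs m) ?_ ?_
      · intro i hi
        have : i ≠ k := fun e => hk (e ▸ hi)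
        simpa [hF, this] using h0 i (Finset.mem_insert_of_mem hi)
      · intro i hi
        by_cases hik : i = k
        · subst hik; simpa [hF] using tsupport_cutFun (f i) m
        · simpa [hF, hik] using hs i (by simp [hik, hi])
    have h0k := h0 k (Finset.mem_insert_self _ _)
    have bd : ∀ {a : ℝ → ℝ}, Continuous a →
        ∃ C : ℝ, 0 ≤ C ∧ ∀ (_ : ℕ), ∀ x ∈ Ioo (0 : ℝ) 1, |a x| ≤ C := by
      intro a ha
      obtain ⟨C, hC0, hC⟩ := exists_bound_Ioo ha
      exact ⟨C, hC0, fun _ x hx => hC x (Ioo_subset_Icc_self hx)⟩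
    have t2 : Tendsto (fun m => pairing g (prodFun (F m))) atTop (𝓝 (pairing g (prodFun f))) := by
      refine tendsto_pairing_prodFun g (fun m i => (hFs m i).continuous) ?_ ?_
      · intro i
        by_cases hi : i = k
        · subst hi; simpa [hF] using exists_bound_cutFun (hf i).continuous
        · simpa [hF, hi] using bd (hf i).continuous
      · intro i x hx
        by_cases hi : i = k
        · subst hi; simpa [hF] using tendsto_cutFun (f i) hx
        · simp [hF, hi]
    have t1 : ∀ S : Finset (Fin d), Tendsto
        (fun m => pairing v (prodFun (derivTwoOn S (F m)))) atTop
        (𝓝 (pairing v (prodFun (derivTwoOn S f)))) := by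
      intro S
      by_cases hkS : k ∈ S
      -- Two derivatives on a cut-off function need not stay bounded. The zero trace of `v` allows
      -- one of them to be moved to `w k`, so that only first derivatives of the cut-off functions
      -- appear in the limit.
      · have conv : ∀ a : ℝ → ℝ, ContDiff ℝ ∞ a →
            pairing v (prodFun (derivTwoOn S (Function.update f k a)))
              = - pairing (w k) (prodFun (Function.update (derivTwoOn S f) k (deriv a))) := by
          intro a ha
          have hsm : ∀ i, ContDiff ℝ ∞ (Function.update (derivTwoOn S f) k (deriv a) i) := by
            intro i
            by_cases hi : i = k
            · subst hi; simpa using contDiff_deriv ha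
            · simpa [hi] using contDiff_derivTwoOn hf S i
          rw [← (hw k).prodFun hsm]
          congr 2
          funext i
          by_cases hi : i = k
          · subst hi; simp [derivTwoOn, hkS]
          · simp [derivTwoOn, hi]
        have e0 : derivTwoOn S f = derivTwoOn S (Function.update f k (f k)) := by simp
        rw [e0, conv _ (hf k)]
        simp only [hF, conv _ (contDiff_cutFun (hf k) _)]
        refine Tendsto.neg (tendsto_pairing_prodFun (w k) ?_ ?_ ?_)
        · intro m i
          by_cases hi : i = k
          · subst hi; simpa using (contDiff_deriv (contDiff_cutFun (hf i) m)).continuous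
          · simpa [hi] using (contDiff_derivTwoOn hf S i).continuous
        · intro i
          by_cases hi : i = k
          · subst hi; simpa using exists_bound_deriv_cutFun (hf i) h0k.1 h0k.2
          · simpa [hi] using bd (contDiff_derivTwoOn hf S i).continuous
        · intro i x hx
          by_cases hi : i = k
          · subst hi; simpa using tendsto_deriv_cutFun (hf i) hx
          · simp [hi]
      · have e : ∀ m, derivTwoOn S (F m) = Function.update (derivTwoOn S f) k (cutFun (f k) m) := by
          intro m
          funext i
          by_cases hi : i = k
          · subst hi; simp [derivTwoOn, hkS, hF]
          · simp [derivTwoOn, hi, hF]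
        simp only [e]
        refine tendsto_pairing_prodFun v ?_ ?_ ?_
        · intro m i
          by_cases hi : i = k
          · subst hi; simpa using (contDiff_cutFun (hf i) m).continuous
          · simpa [hi] using (contDiff_derivTwoOn hf S i).continuous
        · intro i
          by_cases hi : i = k
          · subst hi; simpa using exists_bound_cutFun (hf i).continuous
          · simpa [hi] using bd (contDiff_derivTwoOn hf S i).continuous
        · intro i x hx
          by_cases hi : i = k
          · subst hi; simpa [derivTwoOn, hkS] using tendsto_cutFun (f i) hx
          · simp [hi]
    have t3 := tendsto_finsetSum Finset.univ (fun S (_ : S ∈ Finset.univ) => (t1 S).const_mul (c S))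
    exact tendsto_nhds_unique (t3.congr h1) t2

/-! ### Completeness of the cosine system -/

/-- `x ↦ cos (k π x)`. -/
def cosFun (k : ℕ) : ℝ → ℝ := fun x => Real.cos (k * Real.pi * x)

/-- The products of cosines. -/
def cosProd (n : Fin d → ℕ) : (Fin d → ℝ) → ℝ := prodFun (fun i => cosFun (n i))

lemma contDiff_cosFun (k : ℕ) : ContDiff ℝ ∞ (cosFun k) := by
  unfold cosFun; fun_prop

lemma continuous_cosProd (n : Fin d → ℕ) : Continuous (cosProd n) :=
  continuous_prodFun (fun i => (contDiff_cosFun (n i)).continuous)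

lemma integrable_mul_of_continuous {f F : (Fin d → ℝ) → ℝ} (hf : Integrable f (cubeMeas d))
    (hF : Continuous F) : Integrable (fun x => f x * F x) (cubeMeas d) := by
  obtain ⟨C, hC⟩ := (isCompact_closedCube d).exists_bound_of_continuousOn hF.continuousOn
  refine hf.mul_bdd (c := C) hF.aestronglyMeasurable ?_
  filter_upwards [ae_restrict_mem (measurableSet_cube d)] with x hx
  exact hC x (cube_subset_closedCube d hx)

lemma prodFun_update_mul (f : Fin d → ℝ → ℝ) (i : Fin d) (a : ℝ → ℝ) (x : Fin d → ℝ) :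
    prodFun (Function.update f i a) x = a (x i) * ∏ j ∈ Finset.univ.erase i, f j (x j) := by
  rw [prodFun, ← Finset.mul_prod_erase _ _ (Finset.mem_univ i)]
  congr 1
  · simp
  · refine Finset.prod_congr rfl (fun j hj => ?_)
    rw [Finset.mem_erase] at hj
    simp [hj.1]

lemma cos_mul_cosProd (n : Fin d → ℕ) (i : Fin d) (x : Fin d → ℝ) :
    Real.cos (Real.pi * x i) * cosProd n x =
      1 / 2 * cosProd (Function.update n i (n i + 1)) x
        + 1 / 2 * cosProd (Function.update n i (if n i = 0 then 1 else n i - 1)) x := by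
  have e : ∀ k, cosProd (Function.update n i k) x
      = cosFun k (x i) * ∏ j ∈ Finset.univ.erase i, cosFun (n j) (x j) := by
    intro k
    rw [← prodFun_update_mul (fun j => cosFun (n j)), cosProd]
    congr 1
    funext j
    by_cases h : j = i
    · subst h; simp
    · simp [h]
  have e0 : cosProd n x = cosFun (n i) (x i) * ∏ j ∈ Finset.univ.erase i, cosFun (n j) (x j) := by
    rw [← e (n i), Function.update_eq_self]
  -- Product-to-sum formula. For index 0 the lower frequency would be -1, which equals frequency 1
  -- because the cosine is even.
  have key : Real.cos (Real.pi * x i) * cosFun (n i) (x i) =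
      1 / 2 * cosFun (n i + 1) (x i) + 1 / 2 * cosFun (if n i = 0 then 1 else n i - 1) (x i) := by
    rcases hn : n i with _ | k
    · simp [cosFun]; ring
    · simp only [cosFun, Nat.add_one_ne_zero, if_false, Nat.add_sub_cancel]
      have h1 : ((k + 1 + 1 : ℕ) : ℝ) * Real.pi * x i
          = ((k + 1 : ℕ) : ℝ) * Real.pi * x i + Real.pi * x i := by push_cast; ring
      have h2 : (k : ℝ) * Real.pi * x i
          = ((k + 1 : ℕ) : ℝ) * Real.pi * x i - Real.pi * x i := by push_cast; ring
      rw [h1, h2, Real.cos_add, Real.cos_sub]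
      ring
  rw [e, e, e0, ← mul_assoc, key]
  ring

/-- The projection onto the closed cube. -/
def clamp (x : Fin d → ℝ) : Fin d → Icc (0 : ℝ) 1 :=
  fun i => Set.projIcc 0 1 zero_le_one (x i)

lemma continuous_clamp : Continuous (clamp (d := d)) :=
  continuous_pi (fun i => continuous_projIcc.comp (continuous_apply i))

lemma clamp_apply {x : Fin d → ℝ} (hx : x ∈ cube d) (i : Fin d) : ((clamp x i : ℝ)) = x i := by
  rw [clamp, Set.projIcc_of_mem zero_le_one (Ioo_subset_Icc_self (mem_cube.1 hx i))]

/-- `x ↦ cos (π xᵢ)` on the closed cube. -/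
def cosCoord (i : Fin d) : C(Fin d → Icc (0 : ℝ) 1, ℝ) :=
  ⟨fun y => Real.cos (Real.pi * (y i : ℝ)), by fun_prop⟩

lemma adjoin_cosCoord_separatesPoints :
    (Algebra.adjoin ℝ (Set.range (cosCoord (d := d)))).SeparatesPoints := by
  intro x y hxy
  obtain ⟨i, hi⟩ := Function.ne_iff.1 hxy
  refine ⟨cosCoord i, ⟨cosCoord i, Algebra.subset_adjoin ⟨i, rfl⟩, rfl⟩, ?_⟩
  intro h
  apply hi
  have hx := (x i).2
  have hy := (y i).2
  have := Real.injOn_cos (x₁ := Real.pi * (x i : ℝ)) (x₂ := Real.pi * (y i : ℝ))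
    ⟨by nlinarith [Real.pi_pos, hx.1], by nlinarith [Real.pi_pos, hx.2]⟩
    ⟨by nlinarith [Real.pi_pos, hy.1], by nlinarith [Real.pi_pos, hy.2]⟩ h
  exact Subtype.ext (mul_left_cancel₀ Real.pi_pos.ne' this)

/-- Orthogonality of f·a to all cosine products is preserved when a is multiplied by some cos(πxᵢ),
by the product-to-sum formula. Hence it holds for the whole algebra generated by these functions,
which is dense by Stone–Weierstrass since cos(π·) is injective on [0,1]. So f annihilates every
continuous function. -/
theorem ae_eq_zero_of_cosProd {f : (Fin d → ℝ) → ℝ} (hf : Integrable f (cubeMeas d))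
    (h : ∀ n : Fin d → ℕ, ∫ x in cube d, f x * cosProd n x = 0) : f =ᵐ[cubeMeas d] 0 := by
  set good : C(Fin d → Icc (0 : ℝ) 1, ℝ) → Prop := fun a =>
    ∀ n : Fin d → ℕ, ∫ x in cube d, f x * (a (clamp x) * cosProd n x) = 0 with hgood
  have hcont : ∀ a : C(Fin d → Icc (0 : ℝ) 1, ℝ), Continuous (fun x => a (clamp x)) :=
    fun a => a.continuous.comp continuous_clamp
  have hint : ∀ (a : C(Fin d → Icc (0 : ℝ) 1, ℝ)) (n : Fin d → ℕ),
      Integrable (fun x => f x * (a (clamp x) * cosProd n x)) (cubeMeas d) :=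
    fun a n => integrable_mul_of_continuous hf ((hcont a).mul (continuous_cosProd n))
  have hQ : ∀ a ∈ Algebra.adjoin ℝ (Set.range (cosCoord (d := d))),
      ∀ b, good b → good (a * b) := by
    intro a ha
    induction ha using Algebra.adjoin_induction with
    | mem a ha =>
      obtain ⟨i, rfl⟩ := ha
      intro b hb n
      have e : ∀ x ∈ cube d, f x * ((cosCoord i * b) (clamp x) * cosProd n x)
          = 1 / 2 * (f x * (b (clamp x) * cosProd (Function.update n i (n i + 1)) x))
            + 1 / 2 * (f x * (b (clamp x) *
              cosProd (Function.update n i (if n i = 0 then 1 else n i - 1)) x)) := by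
        intro x hx
        have h1 : cosCoord i (clamp x) = Real.cos (Real.pi * x i) := by
          simp [cosCoord, clamp_apply hx]
        have h2 := cos_mul_cosProd n i x
        rw [ContinuousMap.mul_apply, h1]
        linear_combination f x * b (clamp x) * h2
      rw [setIntegral_congr_fun (measurableSet_cube d) e,
        integral_add ((hint b _).const_mul _) ((hint b _).const_mul _), integral_const_mul,
        integral_const_mul, hb, hb]
      simp
    | algebraMap r =>
      intro b hb n
      have e : ∀ x, f x * ((algebraMap ℝ C(Fin d → Icc (0 : ℝ) 1, ℝ) r * b) (clamp x)
          * cosProd n x) = r * (f x * (b (clamp x) * cosProd n x)) := by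
        intro x
        simp only [Algebra.algebraMap_eq_smul_one, ContinuousMap.mul_apply,
          ContinuousMap.smul_apply, ContinuousMap.one_apply, smul_eq_mul]
        ring
      simp only [e]
      rw [integral_const_mul, hb, mul_zero]
    | add a a' _ _ ha ha' =>
      intro b hb n
      have e : ∀ x, f x * (((a + a') * b) (clamp x) * cosProd n x)
          = f x * ((a * b) (clamp x) * cosProd n x) + f x * ((a' * b) (clamp x) * cosProd n x) := by
        intro x
        simp only [ContinuousMap.mul_apply, ContinuousMap.add_apply]
        ring
      simp only [e]
      rw [integral_add (hint _ _) (hint _ _), ha b hb, ha' b hb, add_zero]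
    | mul a a' _ _ ha ha' =>
      intro b hb
      rw [mul_assoc]
      exact ha _ (ha' b hb)
  have hone : good 1 := by
    intro n
    simpa using h n
  have hzero : ∀ a ∈ Algebra.adjoin ℝ (Set.range (cosCoord (d := d))),
      ∫ x in cube d, f x * a (clamp x) = 0 := by
    intro a ha
    have := hQ a ha 1 hone 0
    simpa [cosProd, prodFun, cosFun] using this
  have hall : ∀ ψ : (Fin d → ℝ) → ℝ, Continuous ψ → ∫ x in cube d, f x * ψ x = 0 := by
    intro ψ hψ
    set I := ∫ x in cube d, |f x| with hI
    have hI0 : 0 ≤ I := integral_nonneg (fun x => abs_nonneg _)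
    rw [← abs_nonpos_iff]
    -- Approximation within ε/(I + 1) suffices; the summand 1 covers I = 0.
    refine le_of_forall_pos_le_add (fun ε hε => ?_)
    obtain ⟨⟨a, ha⟩, hclose⟩ :=
      ContinuousMap.exists_mem_subalgebra_near_continuous_of_separatesPoints _
        (adjoin_cosCoord_separatesPoints (d := d)) (fun y => ψ (fun i => (y i : ℝ)))
        (hψ.comp (by fun_prop)) (ε / (I + 1)) (by positivity)
    have e : ∫ x in cube d, f x * ψ x = ∫ x in cube d, f x * (ψ x - a (clamp x)) := by
      simp only [mul_sub]
      rw [integral_sub (integrable_mul_of_continuous hf hψ)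
        (integrable_mul_of_continuous hf (hcont a)), hzero a ha, sub_zero]
    rw [e, zero_add]
    calc |∫ x in cube d, f x * (ψ x - a (clamp x))|
        ≤ ∫ x in cube d, |f x| * (ε / (I + 1)) := by
          rw [← Real.norm_eq_abs]
          refine norm_integral_le_of_norm_le (hf.abs.mul_const _) ?_
          filter_upwards [ae_restrict_mem (measurableSet_cube d)] with x hx
          rw [norm_mul, Real.norm_eq_abs]
          refine mul_le_mul_of_nonneg_left ?_ (abs_nonneg _)
          have h1 := hclose (clamp x)
          have h2 : (fun i => ((clamp x i : Icc (0 : ℝ) 1) : ℝ)) = x :=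
            funext (fun i => clamp_apply hx i)
          simp only [h2] at h1
          rw [norm_sub_rev]
          exact h1.le
      _ = I * (ε / (I + 1)) := by rw [integral_mul_const]
      _ ≤ ε := by
          rw [mul_div_assoc', div_le_iff₀ (by positivity)]
          nlinarith
  have h1 := (isOpen_cube d).ae_eq_zero_of_integral_contDiff_smul_eq_zero (μ := volume) (f := f)
    (IntegrableOn.locallyIntegrableOn hf) (fun g hg hc hs => by
      have h2 := hall g hg.continuous
      rw [← h2, ← setIntegral_eq_integral_of_forall_compl_eq_zero (s := cube d)]
      · exact integral_congr_ae (Eventually.of_forall fun x => by simp [mul_comm])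
      · intro x hx
        rw [image_eq_zero_of_notMem_tsupport (fun hx' => hx (hs hx')), zero_smul])
  rw [Filter.EventuallyEq, ae_restrict_iff' (measurableSet_cube d)]
  filter_upwards [h1] with x hx hxc using hx hxc

lemma eq_zero_of_pairing_cosProd {v : L2 d} (h : ∀ n, pairing v (cosProd n) = 0) : v = 0 := by
  rw [Lp.eq_zero_iff_ae_eq_zero]
  exact ae_eq_zero_of_cosProd (integrable_L2 v) h

/-! ### The sine basis -/

/-- The normalized function `x ↦ √2 sin ((k+1) π x)`. -/
def sinFun (k : ℕ) : ℝ → ℝ := fun x => Real.sqrt 2 * Real.sin (((k : ℝ) + 1) * Real.pi * x)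

/-- The normalized products of sines. -/
def sinProd (n : Fin d → ℕ) : (Fin d → ℝ) → ℝ := prodFun (fun i => sinFun (n i))

lemma contDiff_sinFun (k : ℕ) : ContDiff ℝ ∞ (sinFun k) := by
  unfold sinFun; fun_prop

lemma continuous_sinProd (n : Fin d → ℕ) : Continuous (sinProd n) :=
  continuous_prodFun (fun i => (contDiff_sinFun (n i)).continuous)

lemma sinFun_zero (k : ℕ) : sinFun k 0 = 0 := by simp [sinFun]

lemma sinFun_one (k : ℕ) : sinFun k 1 = 0 := by
  have := Real.sin_nat_mul_pi (k + 1)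
  push_cast at this
  simp [sinFun, this]

lemma integral_cos_int_mul_pi (m : ℤ) :
    ∫ x in Ioo (0 : ℝ) 1, Real.cos (m * Real.pi * x) = if m = 0 then 1 else 0 := by
  rw [← integral_Ioc_eq_integral_Ioo, ← intervalIntegral.integral_of_le zero_le_one]
  split_ifs with h
  · simp [h]
  · have hm : (m : ℝ) * Real.pi ≠ 0 := mul_ne_zero (by exact_mod_cast h) Real.pi_ne_zero
    rw [intervalIntegral.integral_comp_mul_left (fun x => Real.cos x) hm, integral_cos]
    simp [Real.sin_int_mul_pi]

lemma integral_sinFun_mul (k l : ℕ) :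
    ∫ x in Ioo (0 : ℝ) 1, sinFun k x * sinFun l x = if k = l then 1 else 0 := by
  have e : ∀ x, sinFun k x * sinFun l x = Real.cos (((k - l : ℤ) : ℝ) * Real.pi * x)
      - Real.cos (((k + l + 2 : ℤ) : ℝ) * Real.pi * x) := by
    intro x
    have h1 : ((k - l : ℤ) : ℝ) * Real.pi * x
        = ((k : ℝ) + 1) * Real.pi * x - ((l : ℝ) + 1) * Real.pi * x := by push_cast; ring
    have h2 : ((k + l + 2 : ℤ) : ℝ) * Real.pi * x
        = ((k : ℝ) + 1) * Real.pi * x + ((l : ℝ) + 1) * Real.pi * x := by push_cast; ring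
    rw [h1, h2, Real.cos_add, Real.cos_sub, sinFun, sinFun]
    have := Real.mul_self_sqrt (show (0 : ℝ) ≤ 2 by norm_num)
    linear_combination Real.sin (((k : ℝ) + 1) * Real.pi * x)
      * Real.sin (((l : ℝ) + 1) * Real.pi * x) * this
  simp only [e]
  have hi : ∀ m : ℤ, Integrable (fun x : ℝ => Real.cos (m * Real.pi * x))
      (volume.restrict (Ioo 0 1)) := fun m =>
    (Continuous.integrableOn_Icc (by fun_prop)).mono_set Ioo_subset_Icc_self
  rw [integral_sub (hi _) (hi _), integral_cos_int_mul_pi, integral_cos_int_mul_pi,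
    if_neg (show ((k : ℤ) + l + 2) ≠ 0 by omega), sub_zero]
  by_cases h : k = l
  · simp [h]
  · rw [if_neg (by omega), if_neg h]

lemma inner_toL2 {F G : (Fin d → ℝ) → ℝ} (hF : Continuous F) (hG : Continuous G) :
    inner ℝ (toL2 F) (toL2 G) = ∫ x in cube d, F x * G x := by
  rw [← pairing_eq_inner _ hG, pairing_toL2 hF]

lemma integral_prodFun_mul (f g : Fin d → ℝ → ℝ) :
    ∫ x in cube d, prodFun f x * prodFun g x
      = ∏ i, ∫ x in Ioo (0 : ℝ) 1, f i x * g i x := by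
  have : ∀ x, prodFun f x * prodFun g x = ∏ i, (fun y => f i y * g i y) (x i) := by
    intro x
    simp [prodFun, Finset.prod_mul_distrib]
  simp only [this]
  change ∫ x, _ ∂(cubeMeas d) = _
  rw [cubeMeas_eq_pi]
  exact integral_fintype_prod_eq_prod (fun i y => f i y * g i y)

lemma orthonormal_sinProd : Orthonormal ℝ (fun n : Fin d → ℕ => (toL2 (sinProd n) : L2 d)) := by
  rw [orthonormal_iff_ite]
  intro n m
  rw [inner_toL2 (continuous_sinProd n) (continuous_sinProd m)]
  simp only [sinProd]
  rw [integral_prodFun_mul]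
  simp only [integral_sinFun_mul]
  rw [Finset.prod_ite_zero]
  simp [funext_iff]

/-- By multilinearity of the product, the factors are moved from `s` to its span one direction at a
time. -/
lemma pairing_prodFun_span {s : Set (ℝ → ℝ)} (hs : ∀ a ∈ s, Continuous a) {v : L2 d}
    (h : ∀ f : Fin d → ℝ → ℝ, (∀ i, f i ∈ s) → pairing v (prodFun f) = 0)
    {f : Fin d → ℝ → ℝ} (hf : ∀ i, f i ∈ Submodule.span ℝ s) : pairing v (prodFun f) = 0 := by
  have hc : ∀ a ∈ Submodule.span ℝ s, Continuous a := by
    intro a ha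
    induction ha using Submodule.span_induction with
    | mem a ha => exact hs a ha
    | zero => exact continuous_const
    | add a b _ _ ha hb => exact ha.add hb
    | smul c a _ ha => exact ha.const_smul c
  suffices H : ∀ J : Finset (Fin d), ∀ f : Fin d → ℝ → ℝ, (∀ i ∈ J, f i ∈ Submodule.span ℝ s) →
      (∀ i ∉ J, f i ∈ s) → pairing v (prodFun f) = 0 from
    H Finset.univ f (fun i _ => hf i) (fun i hi => absurd (Finset.mem_univ i) hi)
  intro J
  induction J using Finset.induction_on with
  | empty => exact fun f _ hf => h f (fun i => hf i (by simp))
  | insert k J hk ih =>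
    intro f hf hf'
    have hall : ∀ i, f i ∈ Submodule.span ℝ s := fun i => by
      by_cases hi : i ∈ insert k J
      · exact hf i hi
      · exact Submodule.subset_span (hf' i hi)
    have key : ∀ a ∈ Submodule.span ℝ s, pairing v (prodFun (Function.update f k a)) = 0 := by
      intro a ha
      have hint : ∀ a ∈ Submodule.span ℝ s,
          Integrable (fun x => v x * prodFun (Function.update f k a) x) (cubeMeas d) := by
        intro a ha
        refine integrable_mul_of_continuous (integrable_L2 v) (continuous_prodFun (fun i => ?_))
        by_cases hi : i = k
        · subst hi; simpa using hc a ha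
        · simpa [hi] using hc _ (hall i)
      induction ha using Submodule.span_induction with
      | mem a ha =>
        refine ih _ (fun i hi => ?_) (fun i hi => ?_)
        · by_cases h : i = k
          · subst h; exact absurd hi hk
          · simpa [h] using hf i (Finset.mem_insert_of_mem hi)
        · by_cases h : i = k
          · subst h; simpa using ha
          · simpa [h] using hf' i (by simp [h, hi])
      | zero => simp [pairing, prodFun_update_mul]
      | add a b ha hb iha ihb =>
        have e := integral_add (hint a ha) (hint b hb)
        rw [pairing] at iha ihb ⊢
        rw [iha, ihb, add_zero] at e
        rw [← e]
        refine integral_congr_ae (Eventually.of_forall fun x => ?_)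
        simp only [prodFun_update_mul, Pi.add_apply]
        ring
      | smul c a ha iha =>
        have e := integral_const_mul (μ := cubeMeas d) c
          (fun x => v x * prodFun (Function.update f k a) x)
        rw [pairing] at iha ⊢
        rw [iha, mul_zero] at e
        rw [← e]
        refine integral_congr_ae (Eventually.of_forall fun x => ?_)
        simp only [prodFun_update_mul, Pi.smul_apply, smul_eq_mul]
        ring
    simpa using key (f k) (hall k)

/-- Product-to-sum formula again. The first two frequencies are separate because the difference
frequency is then negative or zero; `sinFun k` has frequency k + 1. -/
lemma sin_mul_cosFun_mem_span (m : ℕ) :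
    (fun x => Real.sin (Real.pi * x) * cosFun m x) ∈ Submodule.span ℝ (Set.range sinFun) := by
  have h2 : Real.sqrt 2 ≠ 0 := by positivity
  have hmem : ∀ k, sinFun k ∈ Submodule.span ℝ (Set.range sinFun) := fun k =>
    Submodule.subset_span ⟨k, rfl⟩
  rcases m with _ | _ | m
  · have : (fun x => Real.sin (Real.pi * x) * cosFun 0 x) = (Real.sqrt 2)⁻¹ • sinFun 0 := by
      funext x
      simp [cosFun, sinFun]
    rw [this]
    exact Submodule.smul_mem _ _ (hmem 0)
  · have : (fun x => Real.sin (Real.pi * x) * cosFun (0 + 1) x)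
        = (2 * Real.sqrt 2)⁻¹ • sinFun 1 := by
      funext x
      have e : ((1 : ℕ) + 1 : ℝ) * Real.pi * x = 2 * (Real.pi * x) := by push_cast; ring
      simp only [cosFun, sinFun, Pi.smul_apply, smul_eq_mul]
      rw [e, Real.sin_two_mul]
      field_simp
      simp
    rw [this]
    exact Submodule.smul_mem _ _ (hmem 1)
  · have : (fun x => Real.sin (Real.pi * x) * cosFun (m + 1 + 1) x)
        = (2 * Real.sqrt 2)⁻¹ • (sinFun (m + 2) - sinFun m) := by
      funext x
      have e1 : ((m + 2 : ℕ) + 1 : ℝ) * Real.pi * x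
          = ((m + 1 + 1 : ℕ) : ℝ) * Real.pi * x + Real.pi * x := by push_cast; ring
      have e2 : ((m : ℝ) + 1) * Real.pi * x
          = ((m + 1 + 1 : ℕ) : ℝ) * Real.pi * x - Real.pi * x := by push_cast; ring
      simp only [cosFun, sinFun, Pi.smul_apply, Pi.sub_apply, smul_eq_mul]
      rw [e1, e2, Real.sin_add, Real.sin_sub]
      field_simp
      ring
    rw [this]
    exact Submodule.smul_mem _ _ (Submodule.sub_mem _ (hmem _) (hmem _))

/-- Completeness of sines follows from that of cosines: with the weight w = ∏ sin(πxᵢ), the product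
v·w is orthogonal to all cosine products, because sin(πx)cos(mπx) is a combination of sines. The
weight is positive inside the cube. -/
theorem eq_zero_of_pairing_sinProd {v : L2 d} (h : ∀ n, pairing v (sinProd n) = 0) : v = 0 := by
  set w : (Fin d → ℝ) → ℝ := prodFun (fun _ x => Real.sin (Real.pi * x)) with hw
  have hwc : Continuous w := continuous_prodFun (fun _ => by fun_prop)
  have h1 : (fun x => v x * w x) =ᵐ[cubeMeas d] 0 := by
    refine ae_eq_zero_of_cosProd (integrable_mul_of_continuous (integrable_L2 v) hwc) (fun n => ?_)
    have h2 := pairing_prodFun_span (s := Set.range sinFun) (v := v)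
      (by rintro _ ⟨k, rfl⟩; exact (contDiff_sinFun k).continuous)
      (fun f hf => by
        choose k hk using hf
        have : prodFun f = sinProd k := by
          rw [sinProd]; congr 1; funext i; rw [hk]
        rw [this]; exact h k)
      (f := fun i x => Real.sin (Real.pi * x) * cosFun (n i) x)
      (fun i => sin_mul_cosFun_mem_span (n i))
    rw [← h2]
    refine integral_congr_ae (Eventually.of_forall fun x => ?_)
    simp only [hw, prodFun, cosProd, Finset.prod_mul_distrib]
    ring
  rw [Lp.eq_zero_iff_ae_eq_zero]
  filter_upwards [h1, ae_restrict_mem (measurableSet_cube d)] with x hx hxc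
  have hpos : 0 < w x := by
    refine Finset.prod_pos (fun i _ => Real.sin_pos_of_pos_of_lt_pi ?_ ?_)
    · have := (mem_cube.1 hxc i).1; have := Real.pi_pos; positivity
    · have := (mem_cube.1 hxc i).2; have := Real.pi_pos; nlinarith
  exact (mul_eq_zero.1 hx).resolve_right hpos.ne'

/-- The sine coefficients of `v`. -/
def coef (v : L2 d) (n : Fin d → ℕ) : ℝ := inner ℝ (toL2 (sinProd n)) v

lemma pairing_sinProd (v : L2 d) (n : Fin d → ℕ) : pairing v (sinProd n) = coef v n := by
  rw [pairing_eq_inner _ (continuous_sinProd n), coef, real_inner_comm]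

@[simp] lemma coef_add (v w : L2 d) (n) : coef (v + w) n = coef v n + coef w n := inner_add_right _ _ _
@[simp] lemma coef_sub (v w : L2 d) (n) : coef (v - w) n = coef v n - coef w n := inner_sub_right _ _ _
@[simp] lemma coef_smul (c : ℝ) (v : L2 d) (n) : coef (c • v) n = c * coef v n :=
  real_inner_smul_right _ _ _
@[simp] lemma coef_zero (n) : coef (0 : L2 d) n = 0 := inner_zero_right _
lemma coef_sum {ι : Type*} (s : Finset ι) (v : ι → L2 d) (n) :
    coef (∑ k ∈ s, v k) n = ∑ k ∈ s, coef (v k) n := inner_sum _ _ _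

lemma coef_ext {v w : L2 d} (h : ∀ n, coef v n = coef w n) : v = w := by
  rw [← sub_eq_zero]
  refine eq_zero_of_pairing_sinProd (fun n => ?_)
  rw [pairing_sinProd, coef_sub, h, sub_self]

/-- The Hilbert basis of products of sines. -/
def sinBasis (d : ℕ) : HilbertBasis (Fin d → ℕ) ℝ (L2 d) :=
  HilbertBasis.mkOfOrthogonalEqBot orthonormal_sinProd (by
    rw [Submodule.eq_bot_iff]
    intro v hv
    refine coef_ext (fun n => ?_)
    rw [coef_zero]
    exact (Submodule.mem_orthogonal _ _).1 hv _ (Submodule.subset_span ⟨n, rfl⟩))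

lemma sinBasis_apply (n : Fin d → ℕ) : sinBasis d n = toL2 (sinProd n) := by
  simp [sinBasis]

lemma hasSum_coef_mul (v w : L2 d) : HasSum (fun n => coef v n * coef w n) (inner ℝ v w) := by
  have := (sinBasis d).hasSum_inner_mul_inner v w
  simp only [sinBasis_apply] at this
  refine this.congr_fun (fun n => ?_)
  rw [coef, coef, real_inner_comm v]

/-- Riesz–Fischer with a comparison: a sequence dominated by known coefficients is square summable.
All membership in operator domains below is obtained in this way. -/
lemma exists_coef_eq {a : (Fin d → ℕ) → ℝ} {y : L2 d} {C : ℝ}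
    (h : ∀ n, |a n| ≤ C * |coef y n|) :
    ∃ g : L2 d, (∀ n, coef g n = a n) ∧ ‖g‖ ^ 2 ≤ C ^ 2 * ‖y‖ ^ 2 := by
  have hs : Summable (fun n => C ^ 2 * (coef y n * coef y n)) :=
    (hasSum_coef_mul y y).summable.mul_left _
  have hle : ∀ n, a n ^ 2 ≤ C ^ 2 * (coef y n * coef y n) := by
    intro n
    have h1 := pow_le_pow_left₀ (abs_nonneg _) (h n) 2
    rw [sq_abs, mul_pow, sq_abs] at h1
    linarith [h1]
  have hmem : Memℓp a 2 := by
    rw [memℓp_gen_iff (by norm_num)]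
    simp only [ENNReal.toReal_ofNat, Real.rpow_ofNat, Real.norm_eq_abs, sq_abs]
    exact hs.of_nonneg_of_le (fun n => sq_nonneg _) hle
  set g := (sinBasis d).repr.symm ⟨a, hmem⟩ with hg
  have hgc : ∀ n, coef g n = a n := by
    intro n
    rw [coef, ← sinBasis_apply, ← HilbertBasis.repr_apply_apply, hg,
      LinearIsometryEquiv.apply_symm_apply]
  refine ⟨g, hgc, ?_⟩
  have h1 := hasSum_coef_mul g g
  have h2 := (hasSum_coef_mul y y).mul_left (C ^ 2)
  rw [real_inner_self_eq_norm_sq] at h1 h2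
  refine hasSum_le (fun n => ?_) h1 h2
  rw [hgc, ← sq]
  exact hle n

lemma deriv_sinFun (k : ℕ) : deriv (sinFun k)
    = fun x => Real.sqrt 2 * (((k : ℝ) + 1) * Real.pi * Real.cos (((k : ℝ) + 1) * Real.pi * x)) := by
  funext x
  have h1 : HasDerivAt (fun x : ℝ => ((k : ℝ) + 1) * Real.pi * x) (((k : ℝ) + 1) * Real.pi) x := by
    simpa using (hasDerivAt_id x).const_mul (((k : ℝ) + 1) * Real.pi)
  have h2 := (h1.sin).const_mul (Real.sqrt 2)
  rw [show sinFun k = fun x => Real.sqrt 2 * Real.sin (((k : ℝ) + 1) * Real.pi * x) from rfl,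
    h2.deriv]
  ring

/-- The eigenvalues of `-∂ₓₓ` on the unit interval. -/
def eig (k : ℕ) : ℝ := (((k : ℝ) + 1) * Real.pi) ^ 2

lemma one_le_eig (k : ℕ) : 1 ≤ eig k := by
  have h1 : (1 : ℝ) ≤ ((k : ℝ) + 1) * Real.pi := by
    have : (0 : ℝ) ≤ k := Nat.cast_nonneg k
    nlinarith [Real.pi_gt_three]
  exact one_le_pow₀ h1

lemma eig_pos (k : ℕ) : 0 < eig k := one_pos.trans_le (one_le_eig k)

lemma deriv_deriv_sinFun (k : ℕ) : deriv (deriv (sinFun k)) = fun x => - eig k * sinFun k x := by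
  rw [deriv_sinFun]
  funext x
  have h1 : HasDerivAt (fun x : ℝ => ((k : ℝ) + 1) * Real.pi * x) (((k : ℝ) + 1) * Real.pi) x := by
    simpa using (hasDerivAt_id x).const_mul (((k : ℝ) + 1) * Real.pi)
  have h2 := ((h1.cos).const_mul (((k : ℝ) + 1) * Real.pi)).const_mul (Real.sqrt 2)
  rw [h2.deriv, eig, sinFun]
  ring

lemma prodFun_derivTwoOn_sinFun (S : Finset (Fin d)) (n : Fin d → ℕ) (x : Fin d → ℝ) :
    prodFun (derivTwoOn S (fun i => sinFun (n i))) x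
      = (∏ i ∈ S, - eig (n i)) * sinProd n x := by
  rw [prodFun, sinProd, prodFun, ← Finset.prod_mul_prod_compl S,
    ← Finset.prod_mul_prod_compl S (fun i => sinFun (n i) (x i)), ← mul_assoc,
    ← Finset.prod_mul_distrib]
  congr 1
  · refine Finset.prod_congr rfl (fun i hi => ?_)
    simp [derivTwoOn, hi, deriv_deriv_sinFun]
  · refine Finset.prod_congr rfl (fun i hi => ?_)
    rw [Finset.mem_compl] at hi
    simp [derivTwoOn, hi]

lemma pairing_const_mul (v : L2 d) (c : ℝ) (ψ : (Fin d → ℝ) → ℝ) :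
    pairing v (fun x => c * ψ x) = c * pairing v ψ := by
  rw [pairing, pairing, ← integral_const_mul]
  exact integral_congr_ae (Eventually.of_forall fun x => by ring)

/-- Sine coefficients of an even constant coefficient operator applied to a function that vanishes
on all faces. -/
theorem coef_even_operator {v g : L2 d} {w : Fin d → L2 d}
    (hw : ∀ i, IsZeroTraceDeriv i v (w i)) (c : Finset (Fin d) → ℝ)
    (h : ∀ ψ, IsTest ψ →
      pairing v (fun x => ∑ S : Finset (Fin d), c S * mpd (2 • ind S) ψ x) = pairing g ψ)
    (n : Fin d → ℕ) :
    coef g n = (∑ S : Finset (Fin d), c S * ∏ i ∈ S, - eig (n i)) * coef v n := by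
  have := pairing_even_operator hw c h (f := fun i => sinFun (n i))
    (fun i => contDiff_sinFun (n i)) (fun i => ⟨sinFun_zero _, sinFun_one _⟩)
  rw [← pairing_sinProd, sinProd, ← this, Finset.sum_mul]
  refine Finset.sum_congr rfl (fun S _ => ?_)
  rw [show prodFun (derivTwoOn S fun i => sinFun (n i))
    = fun x => (∏ i ∈ S, - eig (n i)) * sinProd n x from
      funext (prodFun_derivTwoOn_sinFun S n), pairing_const_mul, pairing_sinProd]
  ring

/-- Weak derivatives are unique. -/
theorem IsWeakDeriv.unique {S : Finset (Fin d)} {v g g' : L2 d} (h : IsWeakDeriv (ind S) v g)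
    (h' : IsWeakDeriv (ind S) v g') : g = g' := by
  refine coef_ext (fun n => ?_)
  have hs := fun i => contDiff_sinFun (n i)
  have h0 : ∀ i ∈ S, sinFun (n i) 0 = 0 ∧ sinFun (n i) 1 = 0 :=
    fun i _ => ⟨sinFun_zero _, sinFun_one _⟩
  have h1 := h.prodFun hs h0
  rw [h'.prodFun hs h0] at h1
  rw [← pairing_sinProd, ← pairing_sinProd]
  exact (mul_left_cancel₀ (pow_ne_zero _ (by norm_num)) h1).symm

lemma ind_singleton (i : Fin d) : ind {i} = Pi.single i 1 := by
  funext j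
  by_cases h : j = i
  · subst h; simp [ind]
  · simp [ind, h]

lemma ind_empty : ind (∅ : Finset (Fin d)) = 0 := by
  funext j; simp [ind]

lemma mpd_zero (ψ : (Fin d → ℝ) → ℝ) : mpd 0 ψ = ψ := by
  rw [mpd]
  generalize List.finRange d = l
  induction l with
  | nil => rfl
  | cons a l ih => simp

lemma isWeakDeriv_zero_iff {v g : L2 d} :
    IsWeakDeriv 0 v g ↔ v = g := by
  constructor
  · intro h
    have h1 : IsWeakDeriv (ind (∅ : Finset (Fin d))) v v := by
      intro ψ _; simp [ind_empty, mpd_zero]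
    rw [← ind_empty] at h
    exact h1.unique h
  · rintro rfl ψ _
    simp [mpd_zero]

/-- An element of `L²` is determined by its action on test functions. -/
lemma eq_of_pairing_test {v g : L2 d} (h : ∀ ψ, IsTest ψ → pairing v ψ = pairing g ψ) : v = g := by
  rw [← isWeakDeriv_zero_iff]
  intro ψ hψ
  simp [mpd_zero, h ψ hψ]

/-! ### Integration by parts against test functions -/

lemma contDiff_pd {ψ : (Fin d → ℝ) → ℝ} (hψ : ContDiff ℝ ∞ ψ) (i : Fin d) :
    ContDiff ℝ ∞ (pd i ψ) := by
  have h : ContDiff ℝ ∞ (fderiv ℝ ψ) := hψ.fderiv_right (by simp)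
  exact h.clm_apply contDiff_const

lemma IsTest.pd {ψ : (Fin d → ℝ) → ℝ} (hψ : IsTest ψ) (i : Fin d) : IsTest (pd i ψ) :=
  ⟨contDiff_pd hψ.1 i, hψ.2.1.fderiv_apply ℝ _,
    (tsupport_fderiv_apply_subset ℝ _).trans hψ.2.2⟩

lemma IsTest.iterate_pd {ψ : (Fin d → ℝ) → ℝ} (hψ : IsTest ψ) (i : Fin d) (k : ℕ) :
    IsTest ((DirSplit.pd i)^[k] ψ) := by
  induction k with
  | zero => exact hψ
  | succ k ih => rw [Function.iterate_succ_apply']; exact ih.pd i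

lemma IsTest.foldr_pd {ψ : (Fin d → ℝ) → ℝ} (hψ : IsTest ψ) (α : Fin d → ℕ) (l : List (Fin d)) :
    IsTest (l.foldr (fun i h => (DirSplit.pd i)^[α i] h) ψ) := by
  induction l with
  | nil => exact hψ
  | cons a l ih => exact ih.iterate_pd a _

lemma IsTest.mpd {ψ : (Fin d → ℝ) → ℝ} (hψ : IsTest ψ) (α : Fin d → ℕ) : IsTest (mpd α ψ) :=
  hψ.foldr_pd α _

lemma IsTest.continuous {ψ : (Fin d → ℝ) → ℝ} (hψ : IsTest ψ) : Continuous ψ := hψ.1.continuous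

lemma IsTest.eq_zero {ψ : (Fin d → ℝ) → ℝ} (hψ : IsTest ψ) {x : Fin d → ℝ} (hx : x ∉ cube d) :
    ψ x = 0 :=
  image_eq_zero_of_notMem_tsupport (fun h => hx (hψ.2.2 h))

lemma integral_mul_pd {F ψ : (Fin d → ℝ) → ℝ} (hF : ContDiff ℝ ∞ F) (hψ : IsTest ψ) (i : Fin d) :
    ∫ x in cube d, F x * pd i ψ x = - ∫ x in cube d, pd i F x * ψ x := by
  have h1 : Continuous (pd i F) := (contDiff_pd hF i).continuous
  rw [setIntegral_eq_integral_of_forall_compl_eq_zero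
      (fun x hx => by rw [(hψ.pd i).eq_zero hx, mul_zero]),
    setIntegral_eq_integral_of_forall_compl_eq_zero
      (fun x hx => by rw [hψ.eq_zero hx, mul_zero])]
  refine integral_mul_fderiv_eq_neg_fderiv_mul_of_integrable ?_ ?_ ?_
    (fun x _ => (hF.differentiable (by simp)) x) (fun x _ => (hψ.1.differentiable (by simp)) x)
  · exact (h1.mul hψ.continuous).integrable_of_hasCompactSupport (hψ.2.1.mul_left)
  · exact (hF.continuous.mul (hψ.pd i).continuous).integrable_of_hasCompactSupport
      ((hψ.pd i).2.1.mul_left)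
  · exact (hF.continuous.mul hψ.continuous).integrable_of_hasCompactSupport (hψ.2.1.mul_left)

lemma integral_prodFun_mul_iterate_pd {f : Fin d → ℝ → ℝ} (hf : ∀ i, ContDiff ℝ ∞ (f i))
    {ψ : (Fin d → ℝ) → ℝ} (hψ : IsTest ψ) (i : Fin d) (k : ℕ) :
    ∫ x in cube d, prodFun f x * (pd i)^[k] ψ x
      = (-1) ^ k * ∫ x in cube d, prodFun (Function.update f i (deriv^[k] (f i))) x * ψ x := by
  induction k generalizing ψ with
  | zero => simp
  | succ k ih =>
    have hs : ∀ j, ContDiff ℝ ∞ (Function.update f i (deriv^[k] (f i)) j) := by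
      intro j
      by_cases h : j = i
      · subst h; simpa using (hf j).iterate_deriv k
      · simpa [h] using hf j
    rw [Function.iterate_succ_apply, ih (hψ.pd i), integral_mul_pd (contDiff_prodFun hs) hψ,
      pd_prodFun hs, pow_succ]
    simp only [Function.update_self, Function.update_idem, Function.iterate_succ_apply']
    ring

lemma integral_prodFun_mul_foldr_pd {f : Fin d → ℝ → ℝ} (hf : ∀ i, ContDiff ℝ ∞ (f i))
    {ψ : (Fin d → ℝ) → ℝ} (hψ : IsTest ψ) (α : Fin d → ℕ) (l : List (Fin d)) (hl : l.Nodup) :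
    ∫ x in cube d, prodFun f x * l.foldr (fun i h => (pd i)^[α i] h) ψ x
      = (-1) ^ (l.map α).sum * ∫ x in cube d,
        prodFun (fun i => if i ∈ l then deriv^[α i] (f i) else f i) x * ψ x := by
  induction l generalizing f with
  | nil => simp
  | cons a l ih =>
    rw [List.nodup_cons] at hl
    have hs : ∀ j, ContDiff ℝ ∞ (Function.update f a (deriv^[α a] (f a)) j) := by
      intro j
      by_cases h : j = a
      · subst h; simpa using (hf j).iterate_deriv _
      · simpa [h] using hf j
    rw [List.foldr_cons, integral_prodFun_mul_iterate_pd hf (hψ.foldr_pd α l), ih hs hl.2,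
      List.map_cons, List.sum_cons, pow_add, ← mul_assoc]
    congr 4
    funext x
    congr 2
    funext i
    by_cases h : i = a
    · subst h; simp [hl.1]
    · simp [h]

lemma integral_prodFun_mul_mpd {f : Fin d → ℝ → ℝ} (hf : ∀ i, ContDiff ℝ ∞ (f i))
    {ψ : (Fin d → ℝ) → ℝ} (hψ : IsTest ψ) (α : Fin d → ℕ) :
    ∫ x in cube d, prodFun f x * mpd α ψ x
      = (-1) ^ (∑ i, α i) * ∫ x in cube d, prodFun (fun i => deriv^[α i] (f i)) x * ψ x := by
  rw [mpd, integral_prodFun_mul_foldr_pd hf hψ α _ (List.nodup_finRange d), ← List.ofFn_eq_map,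
    List.sum_ofFn]
  simp

lemma isWeakDeriv_prodFun {f : Fin d → ℝ → ℝ} (hf : ∀ i, ContDiff ℝ ∞ (f i)) (α : Fin d → ℕ) :
    IsWeakDeriv α (toL2 (prodFun f)) (toL2 (prodFun (fun i => deriv^[α i] (f i)))) := by
  intro ψ hψ
  rw [pairing_toL2 (continuous_prodFun fun i => (hf i).continuous),
    pairing_toL2 (continuous_prodFun fun i => ((hf i).iterate_deriv _).continuous),
    integral_prodFun_mul_mpd hf hψ]

lemma mpd_single (i : Fin d) (k : ℕ) (ψ : (Fin d → ℝ) → ℝ) :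
    mpd (Pi.single i k) ψ = (pd i)^[k] ψ := by
  have : ∀ l : List (Fin d), l.Nodup →
      l.foldr (fun j h => (pd j)^[(Pi.single i k : Fin d → ℕ) j] h) ψ
        = if i ∈ l then (pd i)^[k] ψ else ψ := by
    intro l hl
    induction l with
    | nil => simp
    | cons a l ih =>
      rw [List.nodup_cons] at hl
      rw [List.foldr_cons, ih hl.2]
      by_cases h : a = i
      · subst h; simp [hl.1]
      · simp [h, Ne.symm h]
  rw [mpd, this _ (List.nodup_finRange d)]
  simp

lemma isWeakDeriv_single_iff {i : Fin d} {v g : L2 d} :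
    IsWeakDeriv (Pi.single i 1) v g ↔
      ∀ ψ, IsTest ψ → pairing v (pd i ψ) = - pairing g ψ := by
  simp [IsWeakDeriv, mpd_single]

lemma IsZeroTraceDeriv.isWeakDeriv {i : Fin d} {v g : L2 d} (h : IsZeroTraceDeriv i v g) :
    IsWeakDeriv (Pi.single i 1) v g :=
  isWeakDeriv_single_iff.2 (fun ψ hψ => h ψ hψ.1 hψ.2.1)

/-! ### The space `H¹₀` -/

/-- Pairs of a function and its gradient. -/
abbrev GradSpace (d : ℕ) : Type := PiLp 2 (fun _ : Option (Fin d) => L2 d)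

/-- The pair `(ψ, ∇ψ)`. -/
def testGrad (ψ : (Fin d → ℝ) → ℝ) : GradSpace d :=
  WithLp.toLp 2 (fun o => o.elim (toL2 ψ) (fun i => toL2 (pd i ψ)))

@[simp] lemma testGrad_none (ψ : (Fin d → ℝ) → ℝ) : testGrad ψ none = toL2 ψ := rfl
@[simp] lemma testGrad_some (ψ : (Fin d → ℝ) → ℝ) (i : Fin d) :
    testGrad ψ (some i) = toL2 (pd i ψ) := rfl

lemma pd_add {ψ χ : (Fin d → ℝ) → ℝ} (hψ : ContDiff ℝ ∞ ψ) (hχ : ContDiff ℝ ∞ χ) (i : Fin d) :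
    pd i (fun x => ψ x + χ x) = fun x => pd i ψ x + pd i χ x := by
  funext x
  rw [pd, fderiv_fun_add ((hψ.differentiable (by simp)) x) ((hχ.differentiable (by simp)) x)]
  rfl

lemma pd_const_mul {ψ : (Fin d → ℝ) → ℝ} (hψ : ContDiff ℝ ∞ ψ) (c : ℝ) (i : Fin d) :
    pd i (fun x => c * ψ x) = fun x => c * pd i ψ x := by
  funext x
  rw [pd, fderiv_const_mul ((hψ.differentiable (by simp)) x)]
  rfl

lemma IsTest.add {ψ χ : (Fin d → ℝ) → ℝ} (hψ : IsTest ψ) (hχ : IsTest χ) :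
    IsTest (fun x => ψ x + χ x) :=
  ⟨hψ.1.add hχ.1, hψ.2.1.add hχ.2.1, (tsupport_add ψ χ).trans (union_subset hψ.2.2 hχ.2.2)⟩

lemma IsTest.const_mul {ψ : (Fin d → ℝ) → ℝ} (hψ : IsTest ψ) (c : ℝ) :
    IsTest (fun x => c * ψ x) :=
  ⟨contDiff_const.mul hψ.1, hψ.2.1.mul_left,
    (tsupport_mul_subset_right (f := fun _ => c)).trans hψ.2.2⟩

lemma isTest_zero : IsTest (fun _ : Fin d → ℝ => (0 : ℝ)) :=
  ⟨contDiff_const, HasCompactSupport.zero, by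
    have : tsupport (fun _ : Fin d → ℝ => (0 : ℝ)) = ∅ := tsupport_eq_empty_iff.2 rfl
    rw [this]; exact empty_subset _⟩

/-- The graph of the gradient on test functions. -/
def testSpace (d : ℕ) : Submodule ℝ (GradSpace d) where
  carrier := {z | ∃ ψ, IsTest ψ ∧ testGrad ψ = z}
  zero_mem' := ⟨_, isTest_zero, by
    have h0 : toL2 (fun _ : Fin d → ℝ => (0 : ℝ)) = 0 := by
      have := toL2_smul 0 (continuous_const : Continuous (fun _ : Fin d → ℝ => (0 : ℝ)))
      simpa using this
    ext1 o
    rcases o with _ | i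
    · exact h0
    · have : pd i (fun _ : Fin d → ℝ => (0 : ℝ)) = fun _ => 0 := by
        funext x; simp [pd]
      rw [testGrad_some, this, h0]; rfl⟩
  add_mem' := by
    rintro _ _ ⟨ψ, hψ, rfl⟩ ⟨χ, hχ, rfl⟩
    refine ⟨_, hψ.add hχ, ?_⟩
    ext1 o
    rcases o with _ | i
    · exact toL2_add hψ.continuous hχ.continuous
    · rw [testGrad_some, pd_add hψ.1 hχ.1,
        toL2_add (hψ.pd i).continuous (hχ.pd i).continuous]; rfl
  smul_mem' := by
    rintro c _ ⟨ψ, hψ, rfl⟩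
    refine ⟨_, hψ.const_mul c, ?_⟩
    ext1 o
    rcases o with _ | i
    · exact toL2_smul c hψ.continuous
    · rw [testGrad_some, pd_const_mul hψ.1, toL2_smul c (hψ.pd i).continuous]; rfl

/-- The graph of the gradient on `H¹₀`. -/
def hOneZero (d : ℕ) : Submodule ℝ (GradSpace d) := (testSpace d).topologicalClosure

lemma tendsto_toL2_iff {ψ : ℕ → (Fin d → ℝ) → ℝ} (hψ : ∀ n, Continuous (ψ n)) (v : L2 d) :
    Tendsto (fun n => toL2 (ψ n)) atTop (𝓝 v) ↔
      Tendsto (fun n => eLpNorm (fun x => ψ n x - v x) 2 (volume.restrict (cube d))) atTop (𝓝 0) := by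
  rw [Lp.tendsto_Lp_iff_tendsto_eLpNorm']
  refine tendsto_congr (fun n => eLpNorm_congr_ae ?_)
  filter_upwards [coeFn_toL2 (memLp_of_bounded (hψ n))] with x hx
  simp [hx]

lemma tendsto_gradSpace_iff {z : ℕ → GradSpace d} {y : GradSpace d} :
    Tendsto z atTop (𝓝 y) ↔ ∀ o, Tendsto (fun n => z n o) atTop (𝓝 (y o)) := by
  constructor
  · intro h o
    exact ((PiLp.continuous_apply 2 _ o).tendsto y).comp h
  · intro h
    have := (tendsto_pi_nhds (f := fun n => (z n).ofLp) (g := y.ofLp)).2 h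
    exact ((PiLp.continuous_toLp 2 _).tendsto _).comp this

/-- The gradients in the definition may be recorded along with the function, which makes H¹₀ a
closed subspace of a Hilbert space and gives access to Riesz representation and density. -/
theorem memH10_iff {v : L2 d} : MemH10 v ↔ ∃ z ∈ hOneZero d, z none = v := by
  constructor
  · rintro ⟨g, ψ, hψ, h1, h2⟩
    refine ⟨WithLp.toLp 2 (fun o => o.elim v g), ?_, rfl⟩
    refine mem_closure_of_tendsto (f := fun n => testGrad (ψ n)) (b := atTop) ?_
      (Eventually.of_forall fun n => ⟨ψ n, hψ n, rfl⟩)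
    rw [tendsto_gradSpace_iff]
    rintro (_ | i)
    · exact (tendsto_toL2_iff (fun n => (hψ n).continuous) v).2 h1
    · exact (tendsto_toL2_iff (fun n => ((hψ n).pd i).continuous) (g i)).2 (h2 i)
  · rintro ⟨z, hz, rfl⟩
    obtain ⟨y, hy, hyz⟩ := mem_closure_iff_seq_limit.1 hz
    choose ψ hψ hψy using hy
    rw [tendsto_gradSpace_iff] at hyz
    refine ⟨fun i => z (some i), ψ, hψ, ?_, fun i => ?_⟩
    · rw [← tendsto_toL2_iff (fun n => (hψ n).continuous)]
      simpa [← hψy] using hyz none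
    · rw [← tendsto_toL2_iff (fun n => ((hψ n).pd i).continuous)]
      simpa [← hψy] using hyz (some i)

lemma hOneZero_induction {z : GradSpace d} (hz : z ∈ hOneZero d) {F : GradSpace d → ℝ}
    (hF : Continuous F) (h : ∀ ψ, IsTest ψ → F (testGrad ψ) = 0) : F z = 0 := by
  have : closure (testSpace d : Set (GradSpace d)) ⊆ {y | F y = 0} := by
    refine closure_minimal ?_ (isClosed_eq hF continuous_const)
    rintro _ ⟨ψ, hψ, rfl⟩
    exact h ψ hψ
  exact this hz

lemma continuous_comp_inner (o : Option (Fin d)) (w : L2 d) :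
    Continuous (fun z : GradSpace d => inner ℝ (z o) w) :=
  (PiLp.continuous_apply 2 _ o).inner continuous_const

lemma isZeroTraceDeriv_of_mem {z : GradSpace d} (hz : z ∈ hOneZero d) (i : Fin d) :
    IsZeroTraceDeriv i (z none) (z (some i)) := by
  intro χ hχ _
  have hc := (contDiff_pd hχ i).continuous
  rw [pairing_eq_inner _ hc, pairing_eq_inner _ hχ.continuous, eq_neg_iff_add_eq_zero]
  refine hOneZero_induction hz (F := fun z => inner ℝ (z none) (toL2 (pd i χ))
    + inner ℝ (z (some i)) (toL2 χ)) ?_ ?_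
  · exact (continuous_comp_inner _ _).add (continuous_comp_inner _ _)
  · intro ψ hψ
    simp only [testGrad_none, testGrad_some]
    rw [inner_toL2 hψ.continuous hc, inner_toL2 (hψ.pd i).continuous hχ.continuous]
    have := integral_mul_pd hχ hψ i
    simp only [mul_comm (ψ _), mul_comm (pd i ψ _), this]
    ring

/-- Green's formula against a function without any boundary condition, as the pressure is: it holds
for test functions by definition of the weak derivative and extends by density. -/
lemma inner_grad_eq_neg {z : GradSpace d} (hz : z ∈ hOneZero d) {i : Fin d} {q q' : L2 d}
    (h : IsWeakDeriv (Pi.single i 1) q q') : inner ℝ (z (some i)) q = - inner ℝ (z none) q' := by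
  rw [eq_neg_iff_add_eq_zero]
  refine hOneZero_induction hz (F := fun z => inner ℝ (z (some i)) q + inner ℝ (z none) q') ?_ ?_
  · exact (continuous_comp_inner _ _).add (continuous_comp_inner _ _)
  · intro ψ hψ
    have := isWeakDeriv_single_iff.1 h ψ hψ
    rw [pairing_eq_inner _ (hψ.pd i).continuous, pairing_eq_inner _ hψ.continuous] at this
    simp only [testGrad_none, testGrad_some]
    rw [real_inner_comm, this, real_inner_comm q']
    ring

lemma sum_finset_card_one (F : Finset (Fin d) → ℝ) :
    ∑ S : Finset (Fin d), (if S.card = 1 then F S else 0) = ∑ i, F {i} := by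
  rw [← Finset.sum_filter]
  have : (Finset.univ : Finset (Finset (Fin d))).filter (fun S => S.card = 1)
      = Finset.univ.map ⟨singleton, Finset.singleton_injective⟩ := by
    ext S
    simp [Finset.card_eq_one, eq_comm]
  rw [this, Finset.sum_map]
  rfl

/-- The eigenvalues of `-Δ` on the cube. -/
def lam (n : Fin d → ℕ) : ℝ := ∑ i, eig (n i)

lemma lam_nonneg (n : Fin d → ℕ) : 0 ≤ lam n := Finset.sum_nonneg (fun _ _ => (eig_pos _).le)

lemma two_ind_singleton (i : Fin d) : 2 • ind {i} = Pi.single i 2 := by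
  rw [ind_singleton]
  funext j
  by_cases h : j = i
  · subst h; simp
  · simp [h]

theorem coef_laplacian {v g : L2 d} {w : Fin d → L2 d} (hw : ∀ i, IsZeroTraceDeriv i v (w i))
    (h : ∀ ψ, IsTest ψ → pairing v (fun x => ∑ i, mpd (Pi.single i 2) ψ x) = pairing g ψ)
    (n : Fin d → ℕ) : coef g n = - lam n * coef v n := by
  rw [coef_even_operator hw (fun S => if S.card = 1 then 1 else 0) (fun ψ hψ => ?_) n]
  · simp only [ite_mul, one_mul, zero_mul]
    rw [sum_finset_card_one (fun S => ∏ i ∈ S, - eig (n i))]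
    simp [lam]
  · rw [← h ψ hψ]
    congr 1
    funext x
    simp only [ite_mul, one_mul, zero_mul]
    rw [sum_finset_card_one (fun S => mpd (2 • ind S) ψ x)]
    simp only [two_ind_singleton]

theorem coef_second_deriv {v g : L2 d} {w : Fin d → L2 d} (hw : ∀ i, IsZeroTraceDeriv i v (w i))
    {i : Fin d} (h : IsWeakDeriv (Pi.single i 2) v g) (n : Fin d → ℕ) :
    coef g n = - eig (n i) * coef v n := by
  rw [coef_even_operator hw (fun S => if S = {i} then 1 else 0) (fun ψ hψ => ?_) n]
  · simp
  · have := h ψ hψ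
    simp only [ite_mul, one_mul, zero_mul, Finset.sum_ite_eq', Finset.mem_univ, if_true,
      two_ind_singleton]
    rw [this]
    simp

/-- A function with square summable `(1 + λ) v̂` is in `H¹₀`. -/
theorem exists_mem_hOneZero {v h : L2 d} (hv : ∀ n, coef h n = (1 + lam n) * coef v n) :
    ∃ z ∈ hOneZero d, z none = v ∧ ∑ i, ‖z (some i)‖ ^ 2 = inner ℝ h v - ‖v‖ ^ 2 := by
  have : CompleteSpace (hOneZero d) :=
    (Submodule.isClosed_topologicalClosure _).completeSpace_coe
  set ℓ : (hOneZero d) →L[ℝ] ℝ :=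
    (innerSL ℝ h ∘L (PiLp.proj 2 (fun _ : Option (Fin d) => L2 d) none : GradSpace d →L[ℝ] L2 d)) ∘L
      (hOneZero d).subtypeL with hℓ
  -- The Riesz representative is the H¹₀ solution of z - Δz = h. It is identified with `v`
  -- afterwards by comparing sine coefficients.
  set z : hOneZero d := (InnerProductSpace.toDual ℝ (hOneZero d)).symm ℓ with hz
  have hzw : ∀ w ∈ hOneZero d, inner ℝ (z : GradSpace d) w = inner ℝ h (w none) := by
    intro w hw
    have : inner ℝ z (⟨w, hw⟩ : hOneZero d) = ℓ ⟨w, hw⟩ := InnerProductSpace.toDual_symm_apply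
    exact this
  have hinner : ∀ y w : GradSpace d, inner ℝ y w
      = inner ℝ (y none) (w none) + ∑ i, inner ℝ (y (some i)) (w (some i)) := by
    intro y w
    rw [PiLp.inner_apply, Fintype.sum_option]
  have htr : ∀ i, IsZeroTraceDeriv i ((z : GradSpace d) none) ((z : GradSpace d) (some i)) :=
    isZeroTraceDeriv_of_mem z.2
  have hweak : ∀ ψ, IsTest ψ → pairing ((z : GradSpace d) none)
      (fun x => ∑ i, mpd (Pi.single i 2) ψ x) = pairing ((z : GradSpace d) none - h) ψ := by
    intro ψ hψ
    have h1 := hzw (testGrad ψ) (Submodule.le_topologicalClosure _ ⟨ψ, hψ, rfl⟩)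
    rw [hinner] at h1
    simp only [testGrad_none, testGrad_some] at h1
    have h2 : ∀ i, inner ℝ ((z : GradSpace d) (some i)) (toL2 (pd i ψ))
        = - pairing ((z : GradSpace d) none) (mpd (Pi.single i 2) ψ) := by
      intro i
      have := htr i _ (hψ.pd i).1 (hψ.pd i).2.1
      rw [mpd_single, ← pairing_eq_inner _ (hψ.pd i).continuous]
      rw [show (pd i)^[2] ψ = pd i (pd i ψ) from rfl, this]
      ring
    have h3 := pairing_sum Finset.univ ((z : GradSpace d) none) (fun _ : Fin d => (1 : ℝ))
      (fun i => mpd (Pi.single i 2) ψ) (fun i _ => (hψ.mpd _).continuous)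
    simp only [one_mul] at h3
    rw [h3, pairing_eq_inner _ hψ.continuous, inner_sub_left]
    simp only [h2, Finset.sum_neg_distrib] at h1
    linarith
  have hzv : (z : GradSpace d) none = v := by
    refine coef_ext (fun n => ?_)
    have h1 := coef_laplacian htr hweak n
    rw [coef_sub, hv] at h1
    have h2 : (1 + lam n) * coef ((z : GradSpace d) none) n = (1 + lam n) * coef v n := by linarith
    exact mul_left_cancel₀ (by have := lam_nonneg n; positivity) h2
  refine ⟨z, z.2, hzv, ?_⟩
  have h1 := hzw z z.2
  rw [hinner, hzv] at h1
  simp only [real_inner_self_eq_norm_sq] at h1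
  linarith

/-- A function with square summable `b v̂` is in the domain of the corresponding operator. -/
theorem pairing_even_operator_of_coef {v g : L2 d} (c : Finset (Fin d) → ℝ)
    (h : ∀ n, coef g n = (∑ S : Finset (Fin d), c S * ∏ i ∈ S, - eig (n i)) * coef v n)
    {ψ : (Fin d → ℝ) → ℝ} (hψ : IsTest ψ) :
    pairing v (fun x => ∑ S : Finset (Fin d), c S * mpd (2 • ind S) ψ x) = pairing g ψ := by
  have hc : Continuous (fun x => ∑ S : Finset (Fin d), c S * mpd (2 • ind S) ψ x) :=
    continuous_finsetSum _ (fun S _ => (hψ.mpd _).continuous.const_mul _)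
  rw [pairing_eq_inner _ hc, pairing_eq_inner _ hψ.continuous]
  refine (hasSum_coef_mul v _).unique ((hasSum_coef_mul g _).congr_fun (fun n => ?_))
  rw [h]
  have h1 : coef (toL2 (fun x => ∑ S : Finset (Fin d), c S * mpd (2 • ind S) ψ x)) n
      = (∑ S : Finset (Fin d), c S * ∏ i ∈ S, - eig (n i)) * coef (toL2 ψ) n := by
    rw [coef, coef, ← pairing_eq_inner _ hc, ← pairing_eq_inner _ hψ.continuous,
      pairing_sum _ _ _ _ (fun S _ => (hψ.mpd _).continuous), Finset.sum_mul]
    refine Finset.sum_congr rfl (fun S _ => ?_)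
    rw [mul_assoc, pairing_toL2 (continuous_sinProd n), pairing_toL2 (continuous_sinProd n),
      sinProd, integral_prodFun_mul_mpd (fun i => contDiff_sinFun (n i)) hψ, ← sinProd]
    congr 1
    have e1 : (-1 : ℝ) ^ (∑ i, (2 • ind S) i) = 1 := by
      simp only [Pi.smul_apply, ← Finset.smul_sum]
      simp [pow_mul]
    rw [e1, one_mul, ← integral_const_mul]
    refine integral_congr_ae (Eventually.of_forall fun x => ?_)
    have e2 : (fun i => deriv^[(2 • ind S) i] (sinFun (n i)))
        = derivTwoOn S (fun i => sinFun (n i)) := by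
      funext i
      by_cases hi : i ∈ S <;> simp [ind, derivTwoOn, hi]
    simp only [e2, prodFun_derivTwoOn_sinFun]
    ring
  rw [h1]
  ring

/-! ### The pressure space -/

/-- Families of mixed derivatives. -/
abbrev MixedSpace (d : ℕ) : Type := PiLp 2 (fun _ : Finset (Fin d) => L2 d)

lemma zeroMean_iff {v : L2 d} : ZeroMean v ↔ inner ℝ v (toL2 (fun _ => 1)) = 0 := by
  rw [← pairing_eq_inner v continuous_const]
  simp [ZeroMean, pairing]

lemma isWeakDeriv_iff {α : Fin d → ℕ} {v g : L2 d} : IsWeakDeriv α v g ↔ ∀ ψ, IsTest ψ →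
    inner ℝ v (toL2 (mpd α ψ)) = (-1) ^ (∑ i, α i) * inner ℝ g (toL2 ψ) := by
  refine forall₂_congr (fun ψ hψ => ?_)
  rw [pairing_eq_inner _ (hψ.mpd α).continuous, pairing_eq_inner _ hψ.continuous]

/-- The space `Y`, as the graph of `q ↦ (∂_S q)_S`. -/
def presSpace (d : ℕ) : Submodule ℝ (MixedSpace d) where
  carrier := {y | ZeroMean (y ∅) ∧ ∀ S, IsWeakDeriv (ind S) (y ∅) (y S)}
  zero_mem' := by
    simp only [Set.mem_ofPred_eq, zeroMean_iff, isWeakDeriv_iff]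
    simp
  add_mem' := by
    intro a b ha hb
    simp only [Set.mem_ofPred_eq, zeroMean_iff, isWeakDeriv_iff, PiLp.add_apply,
      inner_add_left] at *
    refine ⟨by rw [ha.1, hb.1, add_zero], fun S ψ hψ => ?_⟩
    rw [ha.2 S ψ hψ, hb.2 S ψ hψ]
    ring
  smul_mem' := by
    intro c a ha
    simp only [Set.mem_ofPred_eq, zeroMean_iff, isWeakDeriv_iff, PiLp.smul_apply,
      real_inner_smul_left] at *
    refine ⟨by rw [ha.1, mul_zero], fun S ψ hψ => ?_⟩
    rw [ha.2 S ψ hψ]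
    ring

/-- All defining conditions are equations between continuous linear functionals. Completeness makes
the adjoint of the gradient available. -/
lemma isClosed_presSpace : IsClosed (presSpace d : Set (MixedSpace d)) := by
  have hc : ∀ (S : Finset (Fin d)) (w : L2 d),
      Continuous (fun z : MixedSpace d => inner ℝ (z S) w) := fun S w =>
    (PiLp.continuous_apply 2 _ S).inner continuous_const
  have : (presSpace d : Set (MixedSpace d)) = {y | inner ℝ (y ∅) (toL2 (fun _ => 1)) = 0} ∩
      ⋂ (S : Finset (Fin d)) (ψ : (Fin d → ℝ) → ℝ) (_ : IsTest ψ), {y : MixedSpace d |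
        inner ℝ (y ∅) (toL2 (mpd (ind S) ψ))
          = (-1) ^ (∑ i, ind S i) * inner ℝ (y S) (toL2 ψ)} := by
    ext y
    have : y ∈ presSpace d ↔ ZeroMean (y ∅) ∧ ∀ S, IsWeakDeriv (ind S) (y ∅) (y S) := Iff.rfl
    simp only [SetLike.mem_coe, this, zeroMean_iff, isWeakDeriv_iff, Set.mem_inter_iff,
      Set.mem_ofPred_eq, Set.mem_iInter]
  rw [this]
  refine (isClosed_eq (hc _ _) continuous_const).inter ?_
  refine isClosed_iInter (fun S => isClosed_iInter (fun ψ => isClosed_iInter (fun _ => ?_)))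
  exact isClosed_eq (hc _ _) ((hc _ _).const_mul _)

instance completeSpace_presSpace : CompleteSpace (presSpace d) :=
  isClosed_presSpace.completeSpace_coe

lemma presSpace_norm_sq (q : presSpace d) : ‖q‖ ^ 2 = ∑ S, ‖(q : MixedSpace d) S‖ ^ 2 :=
  PiLp.norm_sq_eq_of_L2 _ (q : MixedSpace d)

/-- The gradient as an operator on the pressure space. -/
def presGrad (d : ℕ) : presSpace d →L[ℝ] VL2 d :=
  LinearMap.mkContinuous
    { toFun := fun q => WithLp.toLp 2 (fun i => (q : MixedSpace d) {i})
      map_add' := fun _ _ => rfl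
      map_smul' := fun _ _ => rfl } 1 (fun q => by
    rw [one_mul]
    refine abs_le_of_sq_le_sq' ?_ (norm_nonneg _) |>.2
    rw [PiLp.norm_sq_eq_of_L2, presSpace_norm_sq]
    change ∑ i : Fin d, ‖(q : MixedSpace d) {i}‖ ^ 2 ≤ _
    rw [← sum_finset_card_one (fun S => ‖(q : MixedSpace d) S‖ ^ 2)]
    refine Finset.sum_le_sum (fun S _ => ?_)
    split_ifs
    · exact le_rfl
    · positivity)

/-- The squared norm of Y contains the first derivatives among its summands. This is the contraction
hypothesis of the stability estimate. -/
lemma norm_presGrad_le (q : presSpace d) : ‖presGrad d q‖ ≤ ‖q‖ := by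
  have h : ‖presGrad d‖ ≤ 1 := LinearMap.mkContinuous_norm_le _ zero_le_one _
  exact ((presGrad d).le_opNorm q).trans (by nlinarith [norm_nonneg q])

lemma isWeakGrad_presGrad (q : presSpace d) :
    IsWeakGrad ((q : MixedSpace d) ∅) (presGrad d q) := by
  intro i
  rw [← ind_singleton]
  exact q.2.2 {i}

lemma IsWeakGrad.unique {q : L2 d} {G G' : VL2 d} (h : IsWeakGrad q G) (h' : IsWeakGrad q G') :
    G = G' := by
  ext1 i
  have h1 := h i
  have h2 := h' i
  rw [← ind_singleton] at h1 h2
  exact h1.unique h2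

/-! ### The operator `A` -/

/-- The eigenvalues of `-∂ₓₓ` with Neumann conditions. -/
def neig (k : ℕ) : ℝ := ((k : ℝ) * Real.pi) ^ 2

lemma deriv_cosFun (k : ℕ) : deriv (cosFun k)
    = fun x => - ((k : ℝ) * Real.pi * Real.sin ((k : ℝ) * Real.pi * x)) := by
  funext x
  have h1 : HasDerivAt (fun x : ℝ => (k : ℝ) * Real.pi * x) ((k : ℝ) * Real.pi) x := by
    simpa using (hasDerivAt_id x).const_mul ((k : ℝ) * Real.pi)
  rw [show cosFun k = fun x => Real.cos ((k : ℝ) * Real.pi * x) from rfl, h1.cos.deriv]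
  ring

lemma deriv_deriv_cosFun (k : ℕ) : deriv (deriv (cosFun k)) = fun x => - neig k * cosFun k x := by
  rw [deriv_cosFun]
  funext x
  have h1 : HasDerivAt (fun x : ℝ => (k : ℝ) * Real.pi * x) ((k : ℝ) * Real.pi) x := by
    simpa using (hasDerivAt_id x).const_mul ((k : ℝ) * Real.pi)
  rw [(h1.sin.const_mul ((k : ℝ) * Real.pi)).fun_neg.deriv, neig, cosFun]
  ring

lemma deriv_cosFun_zero (k : ℕ) : deriv (cosFun k) 0 = 0 := by simp [deriv_cosFun]

lemma deriv_cosFun_one (k : ℕ) : deriv (cosFun k) 1 = 0 := by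
  simp [deriv_cosFun, Real.sin_nat_mul_pi]

lemma prodFun_derivTwoOn_cosFun (S : Finset (Fin d)) (n : Fin d → ℕ) :
    prodFun (derivTwoOn S (fun i => cosFun (n i)))
      = fun x => (∏ i ∈ S, - neig (n i)) * cosProd n x := by
  funext x
  rw [prodFun, cosProd, prodFun, ← Finset.prod_mul_prod_compl S,
    ← Finset.prod_mul_prod_compl S (fun i => cosFun (n i) (x i)), ← mul_assoc,
    ← Finset.prod_mul_distrib]
  congr 1
  · refine Finset.prod_congr rfl (fun i hi => ?_)
    simp [derivTwoOn, hi, deriv_deriv_cosFun]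
  · refine Finset.prod_congr rfl (fun i hi => ?_)
    rw [Finset.mem_compl] at hi
    simp [derivTwoOn, hi]

lemma derivOn_derivOn (S : Finset (Fin d)) (f : Fin d → ℝ → ℝ) :
    derivOn S (derivOn S f) = derivTwoOn S f := by
  funext i
  by_cases h : i ∈ S <;> simp [derivOn, derivTwoOn, h]

/-- The test product consists of differentiated cosines in the directions of `S`; these are sines
and vanish on the faces, so no boundary condition on `v` is needed. -/
lemma IsWeakDeriv.pairing_cos {S : Finset (Fin d)} {v g : L2 d} (h : IsWeakDeriv (ind S) v g)
    (n : Fin d → ℕ) : pairing g (DirSplit.prodFun (derivOn S fun i => cosFun (n i)))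
      = (∏ i ∈ S, neig (n i)) * pairing v (cosProd n) := by
  have h1 := h.prodFun (f := derivOn S fun i => cosFun (n i))
    (fun i => contDiff_derivOn (fun i => contDiff_cosFun (n i)) S i)
    (fun i hi => by simp [derivOn, hi, deriv_cosFun_zero, deriv_cosFun_one])
  rw [derivOn_derivOn, prodFun_derivTwoOn_cosFun, pairing_const_mul, Finset.prod_neg,
    mul_assoc] at h1
  exact (mul_left_cancel₀ (pow_ne_zero _ (by norm_num)) h1).symm

lemma IsNeumannSecond.pairing_cos {i : Fin d} {v a : L2 d} (h : IsNeumannSecond i v a)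
    (n : Fin d → ℕ) : pairing a (cosProd n) = - neig (n i) * pairing v (cosProd n) := by
  obtain ⟨w, h1, h2⟩ := h
  rw [← ind_singleton] at h1
  have h3 := h1.pairing_cos n
  have h4 := h2.prodFun (f := fun i => cosFun (n i)) (fun i => contDiff_cosFun (n i))
  have e : derivOn {i} (fun i => cosFun (n i))
      = Function.update (fun i => cosFun (n i)) i (deriv (cosFun (n i))) := by
    funext j
    by_cases hj : j = i
    · subst hj; simp [derivOn]
    · simp [derivOn, hj]
  rw [e, h4, Finset.prod_singleton] at h3
  rw [cosProd]
  rw [cosProd] at h3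
  linarith

lemma pairing_sub_left (v w : L2 d) {ψ : (Fin d → ℝ) → ℝ} (hψ : Continuous ψ) :
    pairing (v - w) ψ = pairing v ψ - pairing w ψ := by
  simp only [pairing_eq_inner _ hψ, inner_sub_left]

lemma eq_prod_mul_of_chain : ∀ {m : ℕ} (F : Fin (m + 1) → ℝ) (κ : Fin m → ℝ)
    (_ : ∀ i : Fin m, F i.castSucc = κ i * F i.succ), F 0 = (∏ i, κ i) * F (Fin.last m)
  | 0, F, κ, _ => by simp
  | m + 1, F, κ, h => by
    have ih := eq_prod_mul_of_chain (fun i => F i.succ) (fun i => κ i.succ)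
      (fun i => by simpa using h i.succ)
    have h0 := h 0
    simp only [Fin.castSucc_zero] at h0
    rw [h0, Fin.prod_univ_succ, mul_assoc]
    simp only [Fin.succ_last] at ih
    rw [← ih]

lemma IsA.pairing_cos {φ h : L2 d} (hA : IsA φ h) (n : Fin d → ℕ) :
    pairing h (cosProd n) = (∏ i, (1 + neig (n i))) * pairing φ (cosProd n) := by
  obtain ⟨-, w, rfl, rfl, hw⟩ := hA
  refine eq_prod_mul_of_chain (fun k => pairing (w k) (cosProd n)) _ (fun i => ?_)
  obtain ⟨a, ha, hwi⟩ := hw i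
  rw [hwi, pairing_sub_left _ _ (continuous_cosProd n), ha.pairing_cos]
  ring

/-- The family of mixed derivatives of a product of cosines. -/
def cosMixed (n : Fin d → ℕ) : MixedSpace d :=
  WithLp.toLp 2 (fun S => toL2 (prodFun (derivOn S fun i => cosFun (n i))))

lemma integral_cosProd {n : Fin d → ℕ} (hn : n ≠ 0) : ∫ x in cube d, cosProd n x = 0 := by
  have h := integral_prodFun_mul (fun i => cosFun (n i)) (fun _ _ => 1)
  simp only [prodFun, Finset.prod_const_one, mul_one] at h
  obtain ⟨i, hi⟩ := Function.ne_iff.1 hn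
  rw [cosProd, show prodFun (fun i => cosFun (n i)) = fun x => ∏ i, cosFun (n i) (x i) from rfl, h]
  refine Finset.prod_eq_zero (Finset.mem_univ i) ?_
  have := integral_cos_int_mul_pi (n i)
  rw [if_neg (by simpa using hi)] at this
  simpa [cosFun] using this

lemma cosMixed_empty (n : Fin d → ℕ) : cosMixed n ∅ = toL2 (cosProd n) := by
  have : derivOn ∅ (fun i => cosFun (n i)) = fun i => cosFun (n i) := by
    funext i; simp [derivOn]
  simp [cosMixed, this, cosProd]

lemma cosMixed_mem {n : Fin d → ℕ} (hn : n ≠ 0) : cosMixed n ∈ presSpace d := by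
  refine ⟨?_, fun S => ?_⟩
  · rw [cosMixed_empty, zeroMean_iff, inner_toL2 (continuous_cosProd n) continuous_const]
    simpa using integral_cosProd hn
  · rw [cosMixed_empty]
    have h := isWeakDeriv_prodFun (fun i => contDiff_cosFun (n i)) (ind S)
    have e : (fun i => deriv^[ind S i] (cosFun (n i))) = derivOn S fun i => cosFun (n i) := by
      funext i
      by_cases hi : i ∈ S <;> simp [ind, derivOn, hi]
    rw [e] at h
    exact h

/-- Expanding ∏(1 + neig) over subsets reproduces the sum over S of the mixed derivatives: the inner
product of Y is the form of `A`. -/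
lemma inner_cosMixed (q : presSpace d) (n : Fin d → ℕ) : inner ℝ (q : MixedSpace d) (cosMixed n)
    = (∏ i, (1 + neig (n i))) * pairing ((q : MixedSpace d) ∅) (cosProd n) := by
  rw [PiLp.inner_apply, Finset.prod_one_add, Finset.sum_mul, Finset.powerset_univ]
  refine Finset.sum_congr rfl (fun S _ => ?_)
  rw [← (q.2.2 S).pairing_cos n, pairing_eq_inner]
  · rfl
  · exact continuous_prodFun (fun i =>
      (contDiff_derivOn (fun i => contDiff_cosFun (n i)) S i).continuous)

/-- A solution of `A φ = h` is in the pressure space, and it is the weak solution. -/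
theorem IsA.exists_lift {φ h : L2 d} (hA : IsA φ h) : ∃ y : presSpace d,
    (y : MixedSpace d) ∅ = φ ∧ ∀ q : presSpace d, inner ℝ y q = inner ℝ h ((q : MixedSpace d) ∅) := by
  set ℓ : (presSpace d) →L[ℝ] ℝ :=
    (innerSL ℝ h ∘L (PiLp.proj 2 (fun _ : Finset (Fin d) => L2 d) ∅ : MixedSpace d →L[ℝ] L2 d)) ∘L
      (presSpace d).subtypeL with hℓ
  set y : presSpace d := (InnerProductSpace.toDual ℝ (presSpace d)).symm ℓ with hy
  have hyq : ∀ q : presSpace d, inner ℝ y q = inner ℝ h ((q : MixedSpace d) ∅) := by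
    intro q
    have : inner ℝ y q = ℓ q := InnerProductSpace.toDual_symm_apply
    exact this
  refine ⟨y, ?_, hyq⟩
  rw [← sub_eq_zero]
  refine eq_zero_of_pairing_cosProd (fun n => ?_)
  rw [pairing_sub_left _ _ (continuous_cosProd n), sub_eq_zero]
  -- The constant mode is excluded from Y. Its coefficient vanishes on both sides by the zero mean.
  by_cases hn : n = 0
  · have h1 : cosProd (0 : Fin d → ℕ) = fun _ => 1 := by
      funext x; simp [cosProd, prodFun, cosFun]
    rw [hn, h1]
    have h2 := y.2.1
    have h3 := hA.1
    rw [zeroMean_iff, ← pairing_eq_inner _ continuous_const] at h2 h3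
    rw [h2, h3]
  · have h1 := hyq ⟨cosMixed n, cosMixed_mem hn⟩
    have h2 := inner_cosMixed y n
    rw [Submodule.coe_inner, h2, cosMixed_empty, ← pairing_eq_inner _ (continuous_cosProd n),
      hA.pairing_cos n] at h1
    refine mul_left_cancel₀ (Finset.prod_ne_zero_iff.2 (fun i _ => ?_)) h1
    have : 0 ≤ neig (n i) := sq_nonneg _
    positivity

/-- Green's formula for the divergence. -/
theorem inner_div_eq {U : VL2 d} {D : L2 d} (hU : ∀ j, MemH10 (U j)) (hD : IsWeakDiv U D)
    (q : presSpace d) : inner ℝ D ((q : MixedSpace d) ∅) = - inner ℝ U (presGrad d q) := by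
  choose z hz hzU using fun j => memH10_iff.1 (hU j)
  -- The weak divergence is the sum of the components of the H¹₀ gradients, to which Green's formula
  -- applies.
  have hDz : D = ∑ j, z j (some j) := by
    refine eq_of_pairing_test (fun ψ hψ => ?_)
    have h1 := hD ψ hψ
    have h2 : ∀ j, pairing (U j) (pd j ψ) = - pairing (z j (some j)) ψ := by
      intro j
      rw [← hzU j]
      exact isZeroTraceDeriv_of_mem (hz j) j ψ hψ.1 hψ.2.1
    simp only [h2, Finset.sum_neg_distrib] at h1
    rw [pairing_eq_inner (∑ j, z j (some j)) hψ.continuous, sum_inner]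
    simp only [← pairing_eq_inner _ hψ.continuous]
    linarith
  rw [hDz, sum_inner, PiLp.inner_apply, ← Finset.sum_neg_distrib]
  refine Finset.sum_congr rfl (fun j _ => ?_)
  rw [← hzU j]
  exact inner_grad_eq_neg (hz j) (isWeakGrad_presGrad q j)

/-! ### Estimates for functions with bounded derivatives in time -/

section Time

variable {F : Type*} [NormedAddCommGroup F] [NormedSpace ℝ F]

/-- A function with an essentially bounded derivative (in the integrated sense) is Lipschitz. -/
lemma lipschitz_of_integral {V V' : ℝ → F} {T : ℝ}
    (hV' : MemLp V' ⊤ (volume.restrict (Icc 0 T)))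
    (h : ∀ t ∈ Icc 0 T, V t = V 0 + ∫ s in (0 : ℝ)..t, V' s) :
    ∃ M : ℝ, 0 ≤ M ∧ (∀ a ∈ Icc 0 T, ∀ b ∈ Icc 0 T, ‖V b - V a‖ ≤ M * |b - a|) ∧
      (∀ a ∈ Icc 0 T, ∀ b ∈ Icc 0 T, IntervalIntegrable V' volume a b) ∧
      ∀ a ∈ Icc 0 T, ∀ b ∈ Icc 0 T, V b - V a = ∫ s in a..b, V' s := by
  have hae : ∀ᵐ s ∂(volume.restrict (Icc 0 T)),
      ‖V' s‖ ≤ (eLpNorm V' ⊤ (volume.restrict (Icc 0 T))).toReal := by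
    have h1 := ae_le_eLpNormEssSup (f := V') (μ := volume.restrict (Icc 0 T))
    filter_upwards [h1] with s hs
    rw [← eLpNorm_exponent_top] at hs
    have := ENNReal.toReal_mono hV'.2.ne hs
    simpa using this
  set M := (eLpNorm V' ⊤ (volume.restrict (Icc 0 T))).toReal with hM
  have hint : IntegrableOn V' (Icc 0 T) := hV'.integrable (by simp)
  have hii : ∀ a ∈ Icc 0 T, ∀ b ∈ Icc 0 T, IntervalIntegrable V' volume a b := by
    intro a ha b hb
    rw [intervalIntegrable_iff]
    refine hint.mono_set (uIoc_subset_uIcc.trans ?_)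
    exact uIcc_subset_Icc ha hb
  have hsub : ∀ a ∈ Icc 0 T, ∀ b ∈ Icc 0 T, V b - V a = ∫ s in a..b, V' s := by
    intro a ha b hb
    have h0 : (0 : ℝ) ∈ Icc 0 T := ⟨le_rfl, ha.1.trans ha.2⟩
    rw [h a ha, h b hb, add_sub_add_left_eq_sub,
      intervalIntegral.integral_interval_sub_left (hii 0 h0 b hb) (hii 0 h0 a ha)]
  refine ⟨M, ENNReal.toReal_nonneg, ?_, hii, hsub⟩
  intro a ha b hb
  rw [hsub a ha b hb]
  refine intervalIntegral.norm_integral_le_of_norm_le_const_ae ?_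
  rw [ae_restrict_iff' measurableSet_Icc] at hae
  filter_upwards [hae] with s hs hsab
  exact hs (uIcc_subset_Icc ha hb (uIoc_subset_uIcc hsab))

lemma MemWInfty.lipschitz {m : ℕ} (hm : 1 ≤ m) {T : ℝ} {g : ℝ → F} (h : MemWInfty m T g) :
    ∃ M : ℝ, 0 ≤ M ∧ ∀ a ∈ Icc 0 T, ∀ b ∈ Icc 0 T, ‖g b - g a‖ ≤ M * |b - a| := by
  obtain ⟨V, h0, h1, h2⟩ := h
  obtain ⟨M, hM0, hM, -⟩ := lipschitz_of_integral (h1 1 hm) (h2 0 (by omega))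
  refine ⟨M, hM0, fun a ha b hb => ?_⟩
  rw [← h0 a ha, ← h0 b hb]
  exact hM a ha b hb

lemma taylor_one [CompleteSpace F] {V V' : ℝ → F} {T L : ℝ} (hL : 0 ≤ L)
    (hii : ∀ a ∈ Icc 0 T, ∀ b ∈ Icc 0 T, IntervalIntegrable V' volume a b)
    (hsub : ∀ a ∈ Icc 0 T, ∀ b ∈ Icc 0 T, V b - V a = ∫ s in a..b, V' s)
    (hlip : ∀ a ∈ Icc 0 T, ∀ b ∈ Icc 0 T, ‖V' b - V' a‖ ≤ L * |b - a|)
    {a b : ℝ} (ha : a ∈ Icc 0 T) (hb : b ∈ Icc 0 T) :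
    ‖V b - V a - (b - a) • V' a‖ ≤ L * |b - a| ^ 2 := by
  have e : V b - V a - (b - a) • V' a = ∫ s in a..b, (V' s - V' a) := by
    rw [intervalIntegral.integral_sub (hii a ha b hb) intervalIntegrable_const, ← hsub a ha b hb,
      intervalIntegral.integral_const]
  rw [e, sq, ← mul_assoc]
  refine intervalIntegral.norm_integral_le_of_norm_le_const (fun s hs => ?_)
  have hs' := uIoc_subset_uIcc hs
  refine (hlip a ha s (uIcc_subset_Icc ha hb hs')).trans (mul_le_mul_of_nonneg_left ?_ hL)
  exact abs_sub_left_of_mem_uIcc hs'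

/-- The linear terms of the Taylor expansions to both sides cancel. -/
lemma MemWInfty.second_difference [CompleteSpace F] {m : ℕ} (hm : 2 ≤ m) {T : ℝ} {g : ℝ → F}
    (h : MemWInfty m T g) : ∃ M : ℝ, 0 ≤ M ∧ ∀ t h, 0 ≤ h → t - h ∈ Icc 0 T → t + h ∈ Icc 0 T →
      ‖g (t + h) + g (t - h) - (2 : ℝ) • g t‖ ≤ M * h ^ 2 := by
  obtain ⟨V, h0, h1, h2⟩ := h
  obtain ⟨M, hM0, hM, hii, hsub⟩ := lipschitz_of_integral (h1 1 (by omega)) (h2 0 (by omega))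
  obtain ⟨L, hL0, hL, -⟩ := lipschitz_of_integral (h1 2 hm) (h2 1 (by omega))
  refine ⟨2 * L, by positivity, fun t h hh ha hb => ?_⟩
  have ht : t ∈ Icc 0 T := ⟨by linarith [ha.1], by linarith [hb.2]⟩
  rw [← h0 _ ha, ← h0 _ hb, ← h0 _ ht]
  have e1 := taylor_one hL0 hii hsub hL ht hb
  have e2 := taylor_one hL0 hii hsub hL ht ha
  have e : V 0 (t + h) + V 0 (t - h) - (2 : ℝ) • V 0 t
      = (V 0 (t + h) - V 0 t - (t + h - t) • V (0 + 1) t)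
        + (V 0 (t - h) - V 0 t - (t - h - t) • V (0 + 1) t) := by
    module
  rw [e]
  refine (norm_add_le _ _).trans ((add_le_add e1 e2).trans (le_of_eq ?_))
  rw [sq_abs, sq_abs]
  ring

/-- The central difference is the integral of `V 1` over an interval symmetric about t, where the
linear part (s - t)V₂(t) integrates to zero; the rest is quadratic. The derivative is also exhibited
in the classical sense, to be matched with the time derivative in the momentum equation. -/
lemma MemWInfty.midpoint [CompleteSpace F] {m : ℕ} (hm : 3 ≤ m) {T : ℝ} {g : ℝ → F}
    (h : MemWInfty m T g) : ∃ (g' : ℝ → F) (M : ℝ), 0 ≤ M ∧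
      (∀ t ∈ Icc 0 T, 0 < T → HasDerivWithinAt g (g' t) (Icc 0 T) t) ∧
      ∀ t h, 0 ≤ h → t - h ∈ Icc 0 T → t + h ∈ Icc 0 T →
        ‖g (t + h) - g (t - h) - (2 * h) • g' t‖ ≤ M * h ^ 3 := by
  obtain ⟨V, h0, h1, h2⟩ := h
  obtain ⟨M, hM0, hM, hii, hsub⟩ := lipschitz_of_integral (h1 1 (by omega)) (h2 0 (by omega))
  obtain ⟨L, hL0, hL, hii1, hsub1⟩ := lipschitz_of_integral (h1 2 (by omega)) (h2 1 (by omega))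
  obtain ⟨K, hK0, hK, -⟩ := lipschitz_of_integral (h1 3 hm) (h2 2 (by omega))
  refine ⟨V 1, 2 * K, by positivity, ?_, ?_⟩
  · intro t ht _
    rw [hasDerivWithinAt_iff_isLittleO]
    have hO : (fun s => g s - g t - (s - t) • V 1 t) =O[𝓝[Icc 0 T] t] fun s => |s - t| ^ 2 := by
      refine Asymptotics.IsBigO.of_bound L ?_
      filter_upwards [self_mem_nhdsWithin] with s hs
      rw [← h0 s hs, ← h0 t ht]
      have := taylor_one hL0 hii hsub hL ht hs
      rwa [Real.norm_of_nonneg (by positivity)]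
    refine hO.trans_isLittleO ?_
    have : (fun s : ℝ => |s - t| ^ 2) =o[𝓝 t] fun s => s - t := by
      simp only [sq_abs]
      have h3 : Tendsto (fun s : ℝ => s - t) (𝓝 t) (𝓝 0) := by
        have : Tendsto (fun s : ℝ => s - t) (𝓝 t) (𝓝 (t - t)) :=
          (continuous_id.sub continuous_const).tendsto t
        simpa using this
      exact (Asymptotics.isLittleO_pow_id one_lt_two).comp_tendsto h3
    exact this.mono nhdsWithin_le_nhds
  · intro t h hh ha hb
    have ht : t ∈ Icc 0 T := ⟨by linarith [ha.1], by linarith [hb.2]⟩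
    rw [← h0 _ ha, ← h0 _ hb]
    have hlin : ∫ s in (t - h)..(t + h), (s - t) • V 2 t = 0 := by
      rw [intervalIntegral.integral_smul_const, intervalIntegral.integral_sub
        intervalIntegral.intervalIntegrable_id intervalIntegrable_const, integral_id,
        intervalIntegral.integral_const]
      simp only [smul_eq_mul]
      rw [show ((t + h) ^ 2 - (t - h) ^ 2) / 2 - (t + h - (t - h)) * t = 0 by ring, zero_smul]
    have hii' := hii _ ha _ hb
    have e : V 0 (t + h) - V 0 (t - h) - (2 * h) • V 1 t
        = ∫ s in (t - h)..(t + h), (V 1 s - V 1 t - (s - t) • V 2 t) := by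
      rw [intervalIntegral.integral_sub (hii'.sub intervalIntegrable_const)
        (by exact (Continuous.intervalIntegrable (by fun_prop) _ _)), hlin, sub_zero,
        intervalIntegral.integral_sub hii' intervalIntegrable_const, hsub _ ha _ hb,
        intervalIntegral.integral_const]
      congr 2
      ring
    rw [e]
    have hb2 : ‖∫ s in (t - h)..(t + h), (V 1 s - V 1 t - (s - t) • V 2 t)‖
        ≤ K * h ^ 2 * |t + h - (t - h)| := by
      refine intervalIntegral.norm_integral_le_of_norm_le_const (fun s hs => ?_)
      rw [uIoc_of_le (by linarith)] at hs
      have hs' : s ∈ Icc 0 T := ⟨ha.1.trans hs.1.le, hs.2.trans hb.2⟩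
      refine (taylor_one hK0 hii1 hsub1 hK ht hs').trans (mul_le_mul_of_nonneg_left ?_ hK0)
      exact pow_le_pow_left₀ (abs_nonneg _) (abs_le.2 ⟨by linarith [hs.1], by linarith [hs.2]⟩) 2
    refine hb2.trans (le_of_eq ?_)
    rw [show t + h - (t - h) = 2 * h by ring, abs_of_nonneg (by positivity)]
    ring

end Time

/-! ### Fourier multipliers on vector fields -/

lemma hasSum_inner_coef (v w : VL2 d) :
    HasSum (fun n => ∑ j, coef (v j) n * coef (w j) n) (inner ℝ v w) := by
  rw [PiLp.inner_apply]
  exact hasSum_sum (fun j _ => hasSum_coef_mul (v j) (w j))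

lemma inner_congr_coef {v w v' w' : VL2 d}
    (h : ∀ j n, coef (v j) n * coef (w j) n = coef (v' j) n * coef (w' j) n) :
    inner ℝ v w = inner ℝ v' w' := by
  refine (hasSum_inner_coef v w).unique ?_
  simp only [h]
  exact hasSum_inner_coef v' w'

lemma inner_mono_coef {v w v' w' : VL2 d}
    (h : ∀ j n, coef (v j) n * coef (w j) n ≤ coef (v' j) n * coef (w' j) n) :
    inner ℝ v w ≤ inner ℝ v' w' :=
  hasSum_le (fun n => Finset.sum_le_sum (fun j _ => h j n)) (hasSum_inner_coef v w)
    (hasSum_inner_coef v' w')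

lemma vcoef_ext {v w : VL2 d} (h : ∀ j n, coef (v j) n = coef (w j) n) : v = w := by
  ext1 j
  exact coef_ext (h j)

lemma exists_vcoef_eq {a : Fin d → (Fin d → ℕ) → ℝ} {y : VL2 d} {C : ℝ}
    (h : ∀ j n, |a j n| ≤ C * |coef (y j) n|) :
    ∃ g : VL2 d, (∀ j n, coef (g j) n = a j n) ∧ ‖g‖ ^ 2 ≤ C ^ 2 * ‖y‖ ^ 2 := by
  choose g hg hn using fun j => exists_coef_eq (h j)
  refine ⟨WithLp.toLp 2 g, hg, ?_⟩
  rw [PiLp.norm_sq_eq_of_L2, PiLp.norm_sq_eq_of_L2, Finset.mul_sum]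
  exact Finset.sum_le_sum (fun j _ => hn j)

/-- A bounded sequence defines a bounded Fourier multiplier. -/
theorem exists_multiplier {c : (Fin d → ℕ) → ℝ} {C : ℝ} (hc : ∀ n, |c n| ≤ C) :
    ∃ M : VL2 d →L[ℝ] VL2 d, ∀ v j n, coef (M v j) n = c n * coef (v j) n := by
  have hC : 0 ≤ C := (abs_nonneg _).trans (hc 0)
  have h : ∀ v : VL2 d, ∀ j n, |c n * coef (v j) n| ≤ C * |coef (v j) n| := by
    intro v j n
    rw [abs_mul]
    exact mul_le_mul_of_nonneg_right (hc n) (abs_nonneg _)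
  choose g hg hn using fun v => exists_vcoef_eq (h v)
  refine ⟨LinearMap.mkContinuous
    { toFun := g
      map_add' := fun v w => vcoef_ext (fun j n => ?_)
      map_smul' := fun a v => vcoef_ext (fun j n => ?_) } C (fun v => ?_), hg⟩
  · simp only [hg, PiLp.add_apply, coef_add]
    ring
  · simp only [hg, PiLp.smul_apply, coef_smul, RingHom.id_apply]
    ring
  · refine abs_le_of_sq_le_sq' ?_ (by positivity) |>.2
    rw [mul_pow]
    exact hn v

/-! ### The symbols of the operators -/

/-- The coefficients of `B`. -/
def coeffB (τ : ℝ) (S : Finset (Fin d)) : ℝ := if 2 ≤ S.card then (-τ / 2) ^ (S.card - 2) else 0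

/-- The symbol of `B` in the sine basis. -/
def symB (τ : ℝ) (n : Fin d → ℕ) : ℝ := ∑ S : Finset (Fin d), coeffB τ S * ∏ i ∈ S, - eig (n i)

lemma formalB_eq (τ : ℝ) (ψ : (Fin d → ℝ) → ℝ) :
    formalB τ ψ = fun x => ∑ S : Finset (Fin d), coeffB τ S * mpd (2 • ind S) ψ x := by
  funext x
  rw [formalB, Finset.sum_filter]
  refine Finset.sum_congr rfl (fun S _ => ?_)
  unfold coeffB
  split_ifs <;> simp

lemma symB_two (τ : ℝ) (n : Fin 2 → ℕ) : symB τ n = eig (n 0) * eig (n 1) := by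
  rw [symB, show (Finset.univ : Finset (Finset (Fin 2))) = {∅, {0}, {1}, {0, 1}} from by decide]
  repeat rw [Finset.sum_insert (by decide)]
  rw [Finset.sum_singleton]
  simp [coeffB]

lemma symB_three (τ : ℝ) (n : Fin 3 → ℕ) : symB τ n = eig (n 0) * eig (n 1)
    + eig (n 0) * eig (n 2) + eig (n 1) * eig (n 2)
    + τ / 2 * (eig (n 0) * eig (n 1) * eig (n 2)) := by
  rw [symB, show (Finset.univ : Finset (Finset (Fin 3)))
    = {∅, {0}, {1}, {2}, {0, 1}, {0, 2}, {1, 2}, {0, 1, 2}} from by decide]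
  repeat rw [Finset.sum_insert (by decide)]
  rw [Finset.sum_singleton]
  have h2 : ∀ a b : Fin 3, a ≠ b → coeffB τ ({a, b} : Finset (Fin 3)) = 1 := by
    intro a b hab
    simp [coeffB, Finset.card_pair hab]
  have p2 : ∀ a b : Fin 3, a ≠ b →
      ∏ i ∈ ({a, b} : Finset (Fin 3)), - eig (n i) = eig (n a) * eig (n b) := by
    intro a b hab
    rw [Finset.prod_pair hab]
    ring
  have h3 : coeffB τ ({0, 1, 2} : Finset (Fin 3)) = - τ / 2 := by
    have : ({0, 1, 2} : Finset (Fin 3)).card = 3 := by decide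
    simp [coeffB, this]
  have p3 : ∏ i ∈ ({0, 1, 2} : Finset (Fin 3)), - eig (n i)
      = - (eig (n 0) * eig (n 1) * eig (n 2)) := by
    rw [show ({0, 1, 2} : Finset (Fin 3)) = Finset.univ from by decide, Fin.prod_univ_three]
    ring
  rw [h2 0 1 (by decide), h2 0 2 (by decide), h2 1 2 (by decide), p2 0 1 (by decide),
    p2 0 2 (by decide), p2 1 2 (by decide), h3, p3]
  simp [coeffB]
  ring

lemma lam_two (n : Fin 2 → ℕ) : lam n = eig (n 0) + eig (n 1) := by
  rw [lam, Fin.sum_univ_two]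

lemma lam_three (n : Fin 3 → ℕ) : lam n = eig (n 0) + eig (n 1) + eig (n 2) := by
  rw [lam, Fin.sum_univ_three]

/-- The exponent |S| - 2 is at most 1 in these dimensions. Two values of τ thus determine all, which
makes bounds on `B` uniform in τ. -/
lemma symB_affine (hd : d = 2 ∨ d = 3) (τ : ℝ) (n : Fin d → ℕ) :
    symB τ n = symB 1 n + (τ - 1) * (symB 2 n - symB 1 n) := by
  rcases hd with rfl | rfl
  · simp only [symB_two]
    ring
  · simp only [symB_three]
    ring

lemma lam_le_symB (hd : d = 2 ∨ d = 3) {τ : ℝ} (hτ : 0 ≤ τ) (n : Fin d → ℕ) :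
    lam n ≤ 3 * symB τ n := by
  rcases hd with rfl | rfl
  · have h0 := one_le_eig (n 0)
    have h1 := one_le_eig (n 1)
    rw [symB_two, lam_two]
    nlinarith
  · have h0 := one_le_eig (n 0)
    have h1 := one_le_eig (n 1)
    have h2 := one_le_eig (n 2)
    rw [symB_three, lam_three]
    have h3 : 0 ≤ τ / 2 * (eig (n 0) * eig (n 1) * eig (n 2)) := by positivity
    nlinarith

lemma symB_nonneg (hd : d = 2 ∨ d = 3) {τ : ℝ} (hτ : 0 ≤ τ) (n : Fin d → ℕ) : 0 ≤ symB τ n := by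
  have h1 := lam_le_symB hd hτ n
  have h2 := lam_nonneg n
  linarith

/-! ### The domain of `B` -/

/-- `v` is in the domain of `B`, in terms of the sine coefficients. -/
def InDomB (τ : ℝ) (v : VL2 d) : Prop :=
  ∃ g : VL2 d, ∀ j n, coef (g j) n = symB τ n * coef (v j) n

lemma InDomB.exists_lam (hd : d = 2 ∨ d = 3) {τ : ℝ} (hτ : 0 ≤ τ) {v : VL2 d} (h : InDomB τ v) :
    ∃ g : VL2 d, ∀ j n, coef (g j) n = lam n * coef (v j) n := by
  obtain ⟨g, hg⟩ := h
  obtain ⟨y, hy, -⟩ := exists_vcoef_eq (a := fun j n => lam n * coef (v j) n) (y := g) (C := 3)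
    (fun j n => by
      rw [hg, abs_mul, abs_mul, abs_of_nonneg (lam_nonneg n), abs_of_nonneg (symB_nonneg hd hτ n),
        ← mul_assoc]
      exact mul_le_mul_of_nonneg_right (lam_le_symB hd hτ n) (abs_nonneg _))
  exact ⟨y, hy⟩

/-- A field `v` with `Δ v ∈ L²` (in terms of coefficients) lies in `H¹₀`. -/
lemma exists_grad_of_lam {v y : VL2 d} (h : ∀ j n, coef (y j) n = lam n * coef (v j) n) :
    ∃ z : Fin d → GradSpace d, (∀ j, z j ∈ hOneZero d) ∧ (∀ j, z j none = v j) ∧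
      ∑ j, ∑ i, ‖z j (some i)‖ ^ 2 = inner ℝ y v := by
  have h1 : ∀ j n, coef (v j + y j) n = (1 + lam n) * coef (v j) n := by
    intro j n
    rw [coef_add, h]
    ring
  choose z hz hv hn using fun j => exists_mem_hOneZero (h1 j)
  refine ⟨z, hz, hv, ?_⟩
  rw [PiLp.inner_apply]
  refine Finset.sum_congr rfl (fun j _ => ?_)
  rw [hn, inner_add_left, real_inner_self_eq_norm_sq]
  ring

lemma InDomB.memH10 (hd : d = 2 ∨ d = 3) {τ : ℝ} (hτ : 0 ≤ τ) {v : VL2 d} (h : InDomB τ v)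
    (j : Fin d) : MemH10 (v j) := by
  obtain ⟨y, hy⟩ := h.exists_lam hd hτ
  obtain ⟨z, hz, hv, -⟩ := exists_grad_of_lam hy
  exact memH10_iff.2 ⟨z j, hz j, hv j⟩

lemma MemH10.exists_zeroTrace {v : L2 d} (h : MemH10 v) :
    ∃ w : Fin d → L2 d, ∀ i, IsZeroTraceDeriv i v (w i) := by
  obtain ⟨z, hz, rfl⟩ := memH10_iff.1 h
  exact ⟨fun i => z (some i), isZeroTraceDeriv_of_mem hz⟩

lemma IsB.coef_eq {τ : ℝ} {v g : VL2 d} (h : IsB τ v g) (j : Fin d) (n : Fin d → ℕ) :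
    coef (g j) n = symB τ n * coef (v j) n := by
  obtain ⟨w, hw⟩ := (h.1 j).exists_zeroTrace
  refine coef_even_operator hw (coeffB τ) (fun ψ hψ => ?_) n
  rw [← formalB_eq]
  exact h.2 j ψ hψ

lemma isB_of_coef (hd : d = 2 ∨ d = 3) {τ : ℝ} (hτ : 0 ≤ τ) {v g : VL2 d}
    (h : ∀ j n, coef (g j) n = symB τ n * coef (v j) n) : IsB τ v g := by
  refine ⟨InDomB.memH10 hd hτ ⟨g, h⟩, fun j ψ hψ => ?_⟩
  rw [formalB_eq]
  exact pairing_even_operator_of_coef (coeffB τ) (h j) hψ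

/-- The norm is an infimum over gradients, so one gradient suffices; the one from H¹₀ has squared
norm ⟨-Δv, v⟩. -/
lemma normH1_le {v y : VL2 d} (h : ∀ j n, coef (y j) n = lam n * coef (v j) n) :
    normH1 v ≤ ENNReal.ofReal (Real.sqrt (inner ℝ y v)) := by
  obtain ⟨z, hz, hv, hn⟩ := exists_grad_of_lam h
  refine iInf₂_le_of_le (fun i => WithLp.toLp 2 (fun j => z j (some i))) (fun i j => ?_) ?_
  · rw [← hv]
    exact (isZeroTraceDeriv_of_mem (hz j) i).isWeakDeriv
  · rw [← hn, Finset.sum_comm]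
    simp only [PiLp.norm_sq_eq_of_L2]
    exact le_rfl

lemma normB_le (hd : d = 2 ∨ d = 3) {τ : ℝ} (hτ : 0 ≤ τ) {v g : VL2 d}
    (h : ∀ j n, coef (g j) n = symB τ n * coef (v j) n) :
    normB τ v ≤ ENNReal.ofReal (Real.sqrt (inner ℝ v g)) :=
  iInf₂_le g (isB_of_coef hd hτ h)

lemma normA_le (q : presSpace d) :
    normA ((q : MixedSpace d) ∅) ≤ ENNReal.ofReal ‖q‖ := by
  refine iInf₂_le_of_le (fun S => (q : MixedSpace d) S) q.2 ?_
  rw [← presSpace_norm_sq, Real.sqrt_sq (norm_nonneg _)]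

/-! ### The velocity step in terms of sine coefficients -/

/-- The outer derivative is tested with sines, which vanish on the faces. The inner one is then
tested with a cosine in direction i, where the zero trace of `v` removes the boundary term. -/
lemma IsDirichletSecond.coef_eq {i : Fin d} {v g : L2 d} (h : IsDirichletSecond i v g)
    (n : Fin d → ℕ) : coef g n = - eig (n i) * coef v n := by
  obtain ⟨w, h1, h2⟩ := h
  rw [← ind_singleton] at h2
  have h3 := h2.prodFun (f := fun i => sinFun (n i)) (fun i => contDiff_sinFun (n i))
    (fun j _ => ⟨sinFun_zero _, sinFun_one _⟩)
  have h4 := h1.prodFun (f := derivOn {i} fun i => sinFun (n i))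
    (fun j => contDiff_derivOn (fun i => contDiff_sinFun (n i)) {i} j)
  have e : Function.update (derivOn {i} fun i => sinFun (n i)) i
      (deriv (derivOn {i} (fun i => sinFun (n i)) i)) = derivTwoOn {i} fun i => sinFun (n i) := by
    funext j
    by_cases hj : j = i
    · subst hj; simp [derivOn, derivTwoOn]
    · simp [derivOn, derivTwoOn, hj]
  rw [e, funext (prodFun_derivTwoOn_sinFun {i} n), pairing_const_mul, pairing_sinProd,
    Finset.prod_singleton, h3, ← sinProd, pairing_sinProd, Finset.card_singleton] at h4
  linarith

/-- The symbol of the factored operator of the scheme. -/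
def symM (τ : ℝ) (n : Fin d → ℕ) : ℝ := 1 + τ ^ 2 / 4 * symB τ n

lemma one_le_symM (hd : d = 2 ∨ d = 3) {τ : ℝ} (hτ : 0 ≤ τ) (n : Fin d → ℕ) : 1 ≤ symM τ n := by
  have := symB_nonneg hd hτ n
  unfold symM
  nlinarith [mul_nonneg (sq_nonneg τ) this]

/-- The implicit factors multiply out as ∏(1 + (τ/2)λᵢ) = `symM` + (τ/2)`lam`, which is the reason
for the form of `B`. The membership of `uk` in the domain supplies the zero trace that its
explicitly treated second derivatives do not carry. -/
lemma VelocityStep.coef_eq (hd : d = 2 ∨ d = 3) {τ : ℝ} (hτ : 0 < τ) {uk uk1 G F : VL2 d}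
    (h : VelocityStep d τ uk uk1 G F) (hk : InDomB τ uk) (j : Fin d) (n : Fin d → ℕ) :
    symM τ n * (coef (uk1 j) n - coef (uk j) n)
      + τ / 2 * lam n * (coef (uk1 j) n + coef (uk j) n) + τ * coef (G j) n
      = τ * coef (F j) n := by
  obtain ⟨z, hz⟩ := (hk.memH10 hd hτ.le j).exists_zeroTrace
  have hτ0 : τ ≠ 0 := hτ.ne'
  rcases hd with rfl | rfl
  · obtain ⟨w, a, b, c, ha, hb, hc, e1, e2⟩ := h
    have ha' := (ha j).coef_eq n
    have hb' := coef_second_deriv hz (hb j) n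
    have hc' := (hc j).coef_eq n
    have e1' := congrArg (fun v : VL2 2 => coef (v j) n) e1
    have e2' := congrArg (fun v : VL2 2 => coef (v j) n) e2
    simp only [PiLp.add_apply, PiLp.sub_apply, PiLp.smul_apply, coef_add, coef_sub, coef_smul,
      ha', hb', hc'] at e1' e2'
    rw [symM, symB_two, lam_two]
    field_simp at e1' e2'
    -- In the two equations the intermediate field has the factors 1 + (τ/2)λ₀ and -(1 - (τ/2)λ₀);
    -- cross-multiplication eliminates it.
    linear_combination (1 - τ / 2 * eig (n 0)) * e1' / 2 + (1 + τ / 2 * eig (n 0)) * e2' / 2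
  · obtain ⟨ξ, η, ζ, a, b, c, D, hD, ha, hb, hc, e1, e2, e3, e4⟩ := h
    have ha' := (ha j).coef_eq n
    have hb' := (hb j).coef_eq n
    have hc' := (hc j).coef_eq n
    have hD' := fun i => coef_second_deriv hz (hD i j) n
    rw [Fin.sum_univ_three] at e1
    have e1' := congrArg (fun v : VL2 3 => coef (v j) n) e1
    have e2' := congrArg (fun v : VL2 3 => coef (v j) n) e2
    have e3' := congrArg (fun v : VL2 3 => coef (v j) n) e3
    have e4' := congrArg (fun v : VL2 3 => coef (v j) n) e4
    simp only [PiLp.add_apply, PiLp.sub_apply, PiLp.smul_apply, coef_add, coef_sub, coef_smul,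
      ha', hb', hc', hD', PiLp.zero_apply, coef_zero] at e1' e2' e3' e4'
    rw [symM, symB_three, lam_three]
    field_simp at e1' e2' e3' e4'
    -- Each stage is multiplied by the implicit factors of the stages before it, so that the
    -- intermediate fields telescope.
    linear_combination e1' + e2' / 2 + (1 + τ / 2 * eig (n 0)) * e3' / 2
      + (1 + τ / 2 * eig (n 0)) * (1 + τ / 2 * eig (n 1)) * e4' / 2

/-- The symbol `symM` + (τ/2)`lam` of the implicit operator dominates (τ²/4)`symB`; hence the
constant 4/τ². It depends on τ, but only membership is needed. -/
lemma VelocityStep.inDomB (hd : d = 2 ∨ d = 3) {τ : ℝ} (hτ : 0 < τ) {uk uk1 G F : VL2 d}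
    (h : VelocityStep d τ uk uk1 G F) (hk : InDomB τ uk) : InDomB τ uk1 := by
  obtain ⟨g, hg⟩ := hk
  obtain ⟨y, hy⟩ := InDomB.exists_lam hd hτ.le ⟨g, hg⟩
  obtain ⟨g', hg', -⟩ := exists_vcoef_eq (a := fun j n => symB τ n * coef (uk1 j) n)
    (y := uk + (τ ^ 2 / 4) • g - (τ / 2) • y + τ • (F - G)) (C := 4 / τ ^ 2) (fun j n => by
      have h1 := h.coef_eq hd hτ ⟨g, hg⟩ j n
      have h2 := symB_nonneg hd hτ.le n
      have h3 := lam_nonneg n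
      have h4 : coef ((uk + (τ ^ 2 / 4) • g - (τ / 2) • y + τ • (F - G)) j) n
          = (symM τ n + τ / 2 * lam n) * coef (uk1 j) n := by
        simp only [PiLp.add_apply, PiLp.sub_apply, PiLp.smul_apply, coef_add, coef_sub, coef_smul,
          hg, hy]
        unfold symM at *
        linear_combination - h1
      have h5 : 0 ≤ symM τ n + τ / 2 * lam n := by unfold symM; positivity
      rw [h4, abs_mul, abs_mul, abs_of_nonneg h2, abs_of_nonneg h5, ← mul_assoc]
      refine mul_le_mul_of_nonneg_right ?_ (abs_nonneg _)
      rw [div_mul_eq_mul_div, le_div_iff₀ (by positivity)]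
      unfold symM
      nlinarith [mul_nonneg hτ.le h3])
  exact ⟨g', hg'⟩

/-! ### Stability of the splitting scheme -/

lemma lam_le_symM (hd : d = 2 ∨ d = 3) {τ : ℝ} (hτ : 0 < τ) (n : Fin d → ℕ) :
    lam n ≤ 12 / τ ^ 2 * symM τ n := by
  have h1 := lam_le_symB hd hτ.le n
  rw [div_mul_eq_mul_div, le_div_iff₀ (by positivity)]
  unfold symM
  nlinarith [sq_nonneg τ]

lemma linfNorm_le {E : Type*} {N : ℕ} {nrm : E → ℝ≥0∞} {ψ : ℕ → E} {a : ℝ≥0∞}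
    (h : ∀ k ≤ N, nrm (ψ k) ≤ a) : linfNorm N nrm ψ ≤ a :=
  iSup₂_le (fun k hk => h k (Finset.mem_Icc.1 hk).2)

lemma l2Norm_le {E : Type*} {N : ℕ} {τ Γ : ℝ} (hτ : 0 ≤ τ) (hΓ : 0 ≤ Γ) {nrm : E → ℝ≥0∞}
    {ψ : ℕ → E} {a : ℕ → ℝ} (ha : ∀ k, 0 ≤ a k)
    (h : ∀ k ≤ N, nrm (ψ k) ≤ ENNReal.ofReal (Real.sqrt (a k)))
    (hs : τ * ∑ k ∈ Finset.range (N + 1), a k ≤ Γ ^ 2) : l2Norm τ N nrm ψ ≤ ENNReal.ofReal Γ := by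
  have h1 : ∑ k ∈ Finset.Icc 1 N, nrm (ψ k) ^ 2
      ≤ ENNReal.ofReal (∑ k ∈ Finset.range (N + 1), a k) := by
    rw [ENNReal.ofReal_sum_of_nonneg (fun k _ => ha k)]
    refine (Finset.sum_le_sum (g := fun k => ENNReal.ofReal (a k)) (fun k hk => ?_)).trans
      (Finset.sum_le_sum_of_subset (fun k hk => ?_))
    · refine (pow_le_pow_left' (h k (Finset.mem_Icc.1 hk).2) 2).trans ?_
      rw [← ENNReal.ofReal_pow (Real.sqrt_nonneg _), Real.sq_sqrt (ha k)]
    · have := Finset.mem_Icc.1 hk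
      exact Finset.mem_range.2 (by omega)
  have h2 : ENNReal.ofReal τ * ∑ k ∈ Finset.Icc 1 N, nrm (ψ k) ^ 2 ≤ ENNReal.ofReal (Γ ^ 2) := by
    refine (mul_le_mul_right h1 _).trans ?_
    rw [← ENNReal.ofReal_mul hτ]
    exact ENNReal.ofReal_le_ofReal hs
  refine (ENNReal.rpow_le_rpow h2 (by norm_num)).trans ?_
  rw [ENNReal.ofReal_rpow_of_nonneg (sq_nonneg _) (by norm_num), ← Real.sqrt_eq_rpow,
    Real.sqrt_sq hΓ]

/-- The abstract estimate is applied to ε = M^{1/2}E, with i = M^{-1/2}, a contraction as `symM` ≥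
1, and with -ΔM⁻¹ as the monotone operator. The latter is bounded for fixed τ; the bound 12/τ² does
not enter the result. In these variables ⟨-ΔM⁻¹ε, ε⟩ = ‖∇E‖², and ‖ε‖ controls both ‖E‖ and τ‖E‖_B.
-/
theorem splitting_stability (hd : d = 2 ∨ d = 3) {τ Γ : ℝ} (hτ : 0 < τ) (N : ℕ)
    (E : ℕ → VL2 d) (r ρ σ : ℕ → presSpace d) (φ : ℕ → VL2 d)
    (hE0 : E 0 = 0) (hr0 : r 0 = 0) (hρ0 : ρ 0 = 0) (hdom : ∀ k ≤ N, InDomB τ (E k))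
    (hstep : ∀ k < N, ∀ j n, symM τ n * (coef (E (k + 1) j) n - coef (E k j) n)
      + τ / 2 * lam n * (coef (E (k + 1) j) n + coef (E k j) n)
      + τ * coef (presGrad d (2 • r k - ρ k) j) n = coef (φ k j) n)
    (hρ : ∀ k < N, ρ (k + 1) = r k + σ k)
    (hr : ∀ k < N, r (k + 1)
      = ρ (k + 1) + τ⁻¹ • ContinuousLinearMap.adjoint (presGrad d) (E (k + 1)))
    (hΓ : ∑ k ∈ Finset.range N, (2 * ‖φ k‖ + 2 * (τ * ‖σ k‖)) ≤ Γ) :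
    linfNorm N normL2 E ≤ ENNReal.ofReal (2 * Γ) ∧
    l2Norm τ N normH1 E ≤ ENNReal.ofReal Γ ∧
    ENNReal.ofReal τ * linfNorm N normA (fun k => (r k : MixedSpace d) ∅) ≤ ENNReal.ofReal Γ ∧
    ENNReal.ofReal τ * linfNorm N (normB τ) E ≤ ENNReal.ofReal (4 * Γ) := by
  have hμ := one_le_symM hd hτ.le
  have hμ0 : ∀ n : Fin d → ℕ, 0 < symM τ n := fun n => zero_lt_one.trans_le (hμ n)
  have hsq : ∀ n : Fin d → ℕ, 1 ≤ Real.sqrt (symM τ n) := fun n => Real.one_le_sqrt.2 (hμ n)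
  have hss : ∀ n : Fin d → ℕ, Real.sqrt (symM τ n) * Real.sqrt (symM τ n) = symM τ n := fun n =>
    Real.mul_self_sqrt (hμ0 n).le
  have hex : ∀ k, ∃ ε : VL2 d, k ≤ N →
      ∀ j n, coef (ε j) n = Real.sqrt (symM τ n) * coef (E k j) n := by
    intro k
    by_cases hk : k ≤ N
    · obtain ⟨g, hg⟩ := hdom k hk
      obtain ⟨ε, hε, -⟩ := exists_vcoef_eq
        (a := fun j n => Real.sqrt (symM τ n) * coef (E k j) n)
        (y := E k + (τ ^ 2 / 4) • g) (C := 1) (fun j n => by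
          have : coef ((E k + (τ ^ 2 / 4) • g) j) n = symM τ n * coef (E k j) n := by
            simp only [PiLp.add_apply, PiLp.smul_apply, coef_add, coef_smul, hg, symM]
            ring
          rw [this, one_mul, abs_mul, abs_mul, abs_of_nonneg (Real.sqrt_nonneg _),
            abs_of_pos (hμ0 n)]
          refine mul_le_mul_of_nonneg_right ?_ (abs_nonneg _)
          nlinarith [hsq n, hss n])
      exact ⟨ε, fun _ => hε⟩
    · exact ⟨0, fun h => absurd h hk⟩
  choose ε hε using hex
  obtain ⟨i, hi⟩ := exists_multiplier (d := d) (c := fun n => (Real.sqrt (symM τ n))⁻¹) (C := 1)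
    (fun n => by
      rw [abs_of_nonneg (by positivity)]
      exact inv_le_one_of_one_le₀ (hsq n))
  obtain ⟨A, hA⟩ := exists_multiplier (d := d) (c := fun n => lam n / symM τ n) (C := 12 / τ ^ 2)
    (fun n => by
      rw [abs_of_nonneg (div_nonneg (lam_nonneg n) (hμ0 n).le), div_le_iff₀ (hμ0 n)]
      exact lam_le_symM hd hτ n)
  have hiε : ∀ k ≤ N, i (ε k) = E k := by
    intro k hk
    refine vcoef_ext (fun j n => ?_)
    rw [hi, hε k hk, ← mul_assoc, inv_mul_cancel₀ (by linarith [hsq n]), one_mul]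
  have hiadj : ∀ v w, inner ℝ v (i w) = inner ℝ (i v) w := by
    intro v w
    refine inner_congr_coef (fun j n => ?_)
    rw [hi, hi]
    ring
  have hin : ∀ v, ‖i v‖ ≤ ‖v‖ := by
    intro v
    refine abs_le_of_sq_le_sq' ?_ (norm_nonneg _) |>.2
    rw [← real_inner_self_eq_norm_sq, ← real_inner_self_eq_norm_sq]
    refine inner_mono_coef (fun j n => ?_)
    rw [hi]
    have h1 : (Real.sqrt (symM τ n))⁻¹ ≤ 1 := inv_le_one_of_one_le₀ (hsq n)
    have h2 : 0 ≤ (Real.sqrt (symM τ n))⁻¹ := by positivity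
    have h3 : (Real.sqrt (symM τ n))⁻¹ * (Real.sqrt (symM τ n))⁻¹ ≤ 1 := by nlinarith
    nlinarith [mul_self_nonneg (coef (v j) n)]
  have hA0 : ∀ v, 0 ≤ inner ℝ (A v) v := by
    intro v
    rw [← inner_zero_left (𝕜 := ℝ) v]
    refine inner_mono_coef (fun j n => ?_)
    rw [hA, PiLp.zero_apply, coef_zero, zero_mul, mul_assoc]
    exact mul_nonneg (div_nonneg (lam_nonneg n) (hμ0 n).le) (mul_self_nonneg _)
  have hε0 : ε 0 = 0 := by
    refine vcoef_ext (fun j n => ?_)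
    rw [hε 0 (Nat.zero_le _), hE0, PiLp.zero_apply, coef_zero, mul_zero]
  obtain ⟨hb, hs⟩ := stability_estimate i (presGrad d) A hin norm_presGrad_le hA0 hτ N ε r ρ σ φ
    hε0 hr0 hρ0 (fun k hk w => by
      rw [hiadj, hiadj]
      have : ε (k + 1) - ε k + (τ / 2) • A (ε (k + 1) + ε k) + τ • i (presGrad d (2 • r k - ρ k))
          = i (φ k) := by
        refine vcoef_ext (fun j n => ?_)
        simp only [PiLp.add_apply, PiLp.sub_apply, PiLp.smul_apply, coef_add, coef_sub, coef_smul,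
          hA, hi, hε k hk.le, hε (k + 1) hk]
        rw [← hstep k hk j n]
        have h1 : Real.sqrt (symM τ n) ≠ 0 := by linarith [hsq n]
        rw [show lam n / symM τ n = lam n / (Real.sqrt (symM τ n) * Real.sqrt (symM τ n)) by
          rw [hss n]]
        rw [show symM τ n = Real.sqrt (symM τ n) * Real.sqrt (symM τ n) by rw [hss n]]
        simp only [Real.sqrt_mul_self (Real.sqrt_nonneg _)]
        field_simp
      rw [← this, inner_add_left, inner_add_left, real_inner_smul_left, real_inner_smul_left])
    hρ (fun k hk => by rw [hr k hk, hiε (k + 1) hk]) hΓ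
  have hΓ0 : 0 ≤ Γ := (mul_nonneg hτ.le (norm_nonneg _)).trans (hb 0 (Nat.zero_le _)).2
  refine ⟨linfNorm_le (fun k hk => ENNReal.ofReal_le_ofReal ?_), ?_, ?_, ?_⟩
  · rw [← hiε k hk]
    exact (hin _).trans (hb k hk).1
  · refine l2Norm_le hτ.le hΓ0 (a := fun k => inner ℝ (A (ε k)) (ε k)) (fun k => hA0 _)
      (fun k hk => ?_) hs
    obtain ⟨y, hy⟩ := (hdom k hk).exists_lam hd hτ.le
    refine (normH1_le hy).trans_eq ?_
    congr 2
    refine inner_congr_coef (fun j n => ?_)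
    have := (hμ0 n).ne'
    rw [hA, hε k hk, hy, div_mul_eq_mul_div, div_mul_eq_mul_div, eq_div_iff this, ← hss n]
    simp only [Real.sqrt_mul_self (Real.sqrt_nonneg _)]
    ring
  · refine (mul_le_mul_right (linfNorm_le (a := ENNReal.ofReal (Γ / τ)) (fun k hk => ?_)) _).trans ?_
    · refine (normA_le (r k)).trans (ENNReal.ofReal_le_ofReal ?_)
      rw [le_div_iff₀ hτ, mul_comm]
      exact (hb k hk).2
    · rw [← ENNReal.ofReal_mul hτ.le, mul_div_cancel₀ _ hτ.ne']
  · refine (mul_le_mul_right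
      (linfNorm_le (a := ENNReal.ofReal (4 * Γ / τ)) (fun k hk => ?_)) _).trans ?_
    · obtain ⟨g, hg⟩ := hdom k hk
      refine (normB_le hd hτ.le hg).trans (ENNReal.ofReal_le_ofReal ?_)
      -- From τ²/4 · `symB` ≤ `symM`. With ‖ε k‖ ≤ 2Γ this gives ‖E k‖_B ≤ 4Γ/τ.
      have h1 : inner ℝ (E k) g ≤ (4 / τ ^ 2) * ‖ε k‖ ^ 2 := by
        rw [← real_inner_self_eq_norm_sq, ← real_inner_smul_left]
        refine inner_mono_coef (fun j n => ?_)
        rw [PiLp.smul_apply, coef_smul, hε k hk, hg]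
        have e : 4 / τ ^ 2 * (Real.sqrt (symM τ n) * coef (E k j) n)
            * (Real.sqrt (symM τ n) * coef (E k j) n)
            = 4 / τ ^ 2 * (Real.sqrt (symM τ n) * Real.sqrt (symM τ n))
              * coef (E k j) n ^ 2 := by ring
        rw [e, hss]
        have e2 : coef (E k j) n * (symB τ n * coef (E k j) n) = symB τ n * coef (E k j) n ^ 2 := by
          ring
        rw [e2]
        refine mul_le_mul_of_nonneg_right ?_ (sq_nonneg _)
        rw [div_mul_eq_mul_div, le_div_iff₀ (by positivity), symM]
        linarith
      refine Real.sqrt_le_iff.2 ⟨by positivity, h1.trans ?_⟩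
      rw [div_pow, div_mul_eq_mul_div]
      refine div_le_div_of_nonneg_right ?_ (by positivity)
      nlinarith [(hb k hk).1, norm_nonneg (ε k)]
    · rw [← ENNReal.ofReal_mul hτ.le, mul_div_cancel₀ _ hτ.ne']

/-! ### Consistency -/

lemma MemWInfty.congr {F : Type*} [NormedAddCommGroup F] [NormedSpace ℝ F] {m : ℕ} {T : ℝ}
    {g g' : ℝ → F} (h : MemWInfty m T g) (hg : ∀ t ∈ Icc 0 T, g t = g' t) : MemWInfty m T g' := by
  obtain ⟨V, h0, h1, h2⟩ := h
  exact ⟨V, fun t ht => (h0 t ht).trans (hg t ht), h1, h2⟩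

lemma MemWInftyH2.memWInfty {m : ℕ} {T : ℝ} {u : ℝ → VL2 d} (h : MemWInftyH2 m T u) :
    MemWInfty m T u := by
  obtain ⟨g, hg, hu⟩ := h 0 (by simp)
  refine hg.congr (fun t ht => ?_)
  ext1 j
  exact (isWeakDeriv_zero_iff.1 (hu t ht j)).symm

/-- The Laplacian of `u`, with a bound for its second differences. -/
lemma MemWInftyH2.exists_laplacian {T : ℝ} {u : ℝ → VL2 d} (h : MemWInftyH2 3 T u)
    (h0 : ∀ t ∈ Icc 0 T, ∀ j, MemH10 (u t j)) : ∃ (L : ℝ → VL2 d) (M : ℝ), 0 ≤ M ∧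
      (∀ t ∈ Icc 0 T, ∀ j n, coef (L t j) n = - lam n * coef (u t j) n) ∧
      ∀ t h, 0 ≤ h → t - h ∈ Icc 0 T → t + h ∈ Icc 0 T →
        ‖L (t + h) + L (t - h) - (2 : ℝ) • L t‖ ≤ M * h ^ 2 := by
  choose g hg hu using fun i : Fin d => h (Pi.single i 2) (by simp)
  choose M hM0 hM using fun i => (hg i).second_difference (by norm_num)
  refine ⟨fun t => ∑ i, g i t, ∑ i, M i, Finset.sum_nonneg (fun i _ => hM0 i), ?_, ?_⟩
  · intro t ht j n
    obtain ⟨w, hw⟩ := (h0 t ht j).exists_zeroTrace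
    have e : (∑ i, g i t) j = ∑ i, g i t j := by
      simp
    rw [e, coef_sum, lam, ← Finset.sum_neg_distrib, Finset.sum_mul]
    exact Finset.sum_congr rfl (fun i _ => coef_second_deriv hw (hu i t ht j) n)
  · intro t h hh h1 h2
    rw [Finset.smul_sum, ← Finset.sum_add_distrib, ← Finset.sum_sub_distrib, Finset.sum_mul]
    exact (norm_sum_le _ _).trans (Finset.sum_le_sum (fun i _ => hM i t h hh h1 h2))

/-- The field `B u`, with a Lipschitz bound which is uniform in the parameter of `B`. -/
lemma exists_uniform_lipschitz_B (hd : d = 2 ∨ d = 3) {T : ℝ} {u : ℝ → VL2 d}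
    (huB : ∀ τ : ℝ, 0 < τ → MemWInftyDB τ 2 T u) : ∃ M : ℝ, 0 ≤ M ∧ ∀ τ, 0 < τ → τ ≤ T →
      ∃ g : ℝ → VL2 d, (∀ t ∈ Icc 0 T, ∀ j n, coef (g t j) n = symB τ n * coef (u t j) n) ∧
        ∀ a ∈ Icc 0 T, ∀ b ∈ Icc 0 T, ‖g b - g a‖ ≤ M * |b - a| := by
  -- The values τ = 1 and τ = 2 serve as interpolation nodes for the affine dependence on τ; the
  -- factor |τ - 1| is then at most |T| + 1.
  obtain ⟨-, g1, hg1, hB1⟩ := huB 1 one_pos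
  obtain ⟨-, g2, hg2, hB2⟩ := huB 2 two_pos
  obtain ⟨M1, hM1, h1⟩ := hg1.lipschitz (by norm_num)
  obtain ⟨M2, hM2, h2⟩ := hg2.lipschitz (by norm_num)
  refine ⟨M1 + (|T| + 1) * (M1 + M2), by positivity, fun τ hτ hτT => ?_⟩
  refine ⟨fun t => g1 t + (τ - 1) • (g2 t - g1 t), fun t ht j n => ?_, fun a ha b hb => ?_⟩
  · simp only [PiLp.add_apply, PiLp.sub_apply, PiLp.smul_apply, coef_add, coef_sub, coef_smul,
      (hB1 t ht).coef_eq, (hB2 t ht).coef_eq]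
    rw [symB_affine hd τ n]
    ring
  · have e : g1 b + (τ - 1) • (g2 b - g1 b) - (g1 a + (τ - 1) • (g2 a - g1 a))
        = (g1 b - g1 a) + (τ - 1) • ((g2 b - g2 a) - (g1 b - g1 a)) := by module
    have h3 := h1 a ha b hb
    have h4 := h2 a ha b hb
    have h5 : |τ - 1| ≤ |T| + 1 := by
      refine (abs_sub _ _).trans ?_
      rw [abs_of_pos hτ, abs_one]
      linarith [le_abs_self T]
    have h6 : ‖(τ - 1) • ((g2 b - g2 a) - (g1 b - g1 a))‖
        ≤ (|T| + 1) * (M2 * |b - a| + M1 * |b - a|) := by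
      rw [norm_smul, Real.norm_eq_abs]
      exact mul_le_mul h5 ((norm_sub_le _ _).trans (add_le_add h4 h3)) (norm_nonneg _)
        (by positivity)
    rw [e]
    refine (norm_add_le _ _).trans ((add_le_add h3 h6).trans_eq ?_)
    ring

/-- The exact solution satisfies the equations of the scheme up to a remainder of second order. -/
theorem consistency (hd : d = 2 ∨ d = 3) {T : ℝ} (hT : 0 < T) {f : ℝ → VL2 d} {u₀ : VL2 d}
    {u : ℝ → VL2 d} {p : ℝ → L2 d} (hsol : IsStokesSolution T f u₀ u p)
    (huH2 : MemWInftyH2 3 T u) (huB : ∀ τ : ℝ, 0 < τ → MemWInftyDB τ 2 T u) :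
    ∃ C : ℝ, 0 ≤ C ∧ ∀ τ, 0 < τ → ∀ k : ℕ, ((k : ℝ) + 1) * τ ≤ T → ∃ R : VL2 d,
      ‖R‖ ≤ C * τ ^ 2 ∧ ∀ G, IsWeakGrad (p (((k : ℝ) + 1 / 2) * τ)) G → ∀ j n,
        symM τ n * (coef (u (((k + 1 : ℕ) : ℝ) * τ) j) n - coef (u ((k : ℝ) * τ) j) n)
          + τ / 2 * lam n * (coef (u (((k + 1 : ℕ) : ℝ) * τ) j) n + coef (u ((k : ℝ) * τ) j) n)
          + τ * coef (G j) n
        = τ * coef (f (((k : ℝ) + 1 / 2) * τ) j) n + τ * coef (R j) n := by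
  -- Taken from the domain of `B`, because the boundary condition of the Stokes problem is stated
  -- only for positive times.
  have hH10 : ∀ t ∈ Icc 0 T, ∀ j, MemH10 (u t j) := by
    obtain ⟨-, g, -, hB⟩ := huB 1 one_pos
    exact fun t ht => (hB t ht).1
  obtain ⟨L, M2, hM2, hL, hL2⟩ := huH2.exists_laplacian hH10
  obtain ⟨M3, hM3, hB⟩ := exists_uniform_lipschitz_B hd huB
  obtain ⟨u', M1, hM1, hu', hu2⟩ := huH2.memWInfty.midpoint (by norm_num)
  refine ⟨M1 + M2 + M3, by positivity, fun τ hτ k hk => ?_⟩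
  have hk0 : (0 : ℝ) ≤ k := Nat.cast_nonneg k
  have hkτ : 0 ≤ (k : ℝ) * τ := by positivity
  set t : ℝ := ((k : ℝ) + 1 / 2) * τ with ht
  have e1 : t + τ / 2 = ((k + 1 : ℕ) : ℝ) * τ := by rw [ht]; push_cast; ring
  have e2 : t - τ / 2 = (k : ℝ) * τ := by rw [ht]; ring
  have m1 : t + τ / 2 ∈ Icc 0 T := by
    rw [e1]; push_cast; exact ⟨by positivity, hk⟩
  have m2 : t - τ / 2 ∈ Icc 0 T := by
    rw [e2]; exact ⟨hkτ, by nlinarith⟩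
  have m : t ∈ Ioc 0 T := by
    constructor
    · positivity
    · linarith [m1.2]
  have m' : t ∈ Icc 0 T := Ioc_subset_Icc_self m
  obtain ⟨g, hg, hgL⟩ := hB τ hτ (by nlinarith)
  rw [← e1, ← e2]
  -- The three parts of the remainder are the midpoint error of the time derivative, the error of
  -- averaging the Laplacian over both ends, and the splitting error (τ/4)B(u(t_{k+1}) - u(t_k)).
  -- The last is O(τ²) because Bu is Lipschitz in time.
  refine ⟨τ⁻¹ • (u (t + τ / 2) - u (t - τ / 2) - (2 * (τ / 2)) • u' t)
    - (1 / 2 : ℝ) • (L (t + τ / 2) + L (t - τ / 2) - (2 : ℝ) • L t)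
    + (τ / 4) • (g (t + τ / 2) - g (t - τ / 2)), ?_, fun G hG j n => ?_⟩
  · have n1 := hu2 t (τ / 2) (by positivity) m2 m1
    have n2 := hL2 t (τ / 2) (by positivity) m2 m1
    have n3 := hgL _ m2 _ m1
    have ea : |t + τ / 2 - (t - τ / 2)| = τ := by
      rw [show t + τ / 2 - (t - τ / 2) = τ by ring, abs_of_pos hτ]
    rw [ea] at n3
    refine (norm_add_le _ _).trans ((add_le_add (norm_sub_le _ _) le_rfl).trans ?_)
    rw [norm_smul, norm_smul, norm_smul, Real.norm_of_nonneg (by positivity),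
      Real.norm_of_nonneg (by positivity), Real.norm_of_nonneg (by positivity)]
    have q1 : τ⁻¹ * ‖u (t + τ / 2) - u (t - τ / 2) - (2 * (τ / 2)) • u' t‖ ≤ M1 * τ ^ 2 := by
      rw [inv_mul_le_iff₀ hτ]
      refine n1.trans ?_
      have : 0 ≤ M1 * τ ^ 3 := by positivity
      nlinarith
    have q2 : 1 / 2 * ‖L (t + τ / 2) + L (t - τ / 2) - (2 : ℝ) • L t‖ ≤ M2 * τ ^ 2 := by
      have : 0 ≤ M2 * τ ^ 2 := by positivity
      nlinarith
    have q3 : τ / 4 * ‖g (t + τ / 2) - g (t - τ / 2)‖ ≤ M3 * τ ^ 2 := by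
      have : 0 ≤ M3 * τ ^ 2 := by positivity
      have q4 : τ / 4 * ‖g (t + τ / 2) - g (t - τ / 2)‖ ≤ τ / 4 * (M3 * τ) :=
        mul_le_mul_of_nonneg_left n3 (by positivity)
      nlinarith
    linarith
  · obtain ⟨ut, Lt, Gt, hut, hLt, hGt, heq⟩ := hsol.momentum t m
    obtain ⟨w, hw⟩ := (hH10 t m' j).exists_zeroTrace
    have c1 := coef_laplacian hw (hLt j) n
    have c2 : ut = u' t := (uniqueDiffOn_Icc hT t m').eq_deriv _ hut (hu' t m' hT)
    have c3 : Gt = G := hGt.unique hG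
    subst c2 c3
    have c4 := congrArg (fun v : VL2 d => coef (v j) n) heq
    simp only [PiLp.add_apply, PiLp.sub_apply, coef_add, coef_sub, c1] at c4
    simp only [PiLp.add_apply, PiLp.sub_apply, PiLp.smul_apply, coef_add, coef_sub, coef_smul,
      hL _ m1, hL _ m2, hL _ m', hg _ m1, hg _ m2, symM]
    rw [← c4]
    field_simp
    ring

/-! ### The exact pressure -/

lemma presSpace_norm_le {q : presSpace d} {a : Finset (Fin d) → ℝ}
    (h : ∀ S, ‖(q : MixedSpace d) S‖ ≤ a S) : ‖q‖ ≤ ∑ S, a S := by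
  have h0 : ∀ S, 0 ≤ a S := fun S => (norm_nonneg _).trans (h S)
  refine abs_le_of_sq_le_sq' ?_ (Finset.sum_nonneg (fun S _ => h0 S)) |>.2
  rw [presSpace_norm_sq]
  exact (Finset.sum_le_sum (fun S _ => pow_le_pow_left₀ (norm_nonneg _) (h S) 2)).trans
    (Finset.sum_sq_le_sq_sum_of_nonneg (fun S _ => h0 S))

/-- All mixed derivatives are bundled into one curve in the Hilbert space Y, so that time
differences are bounded in its norm. Outside [0,T] the value is 0. -/
theorem MemWInftyY.exists_lift {T : ℝ} {p : ℝ → L2 d} (h : MemWInftyY 3 T p) :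
    ∃ (q : ℝ → presSpace d) (M : ℝ), 0 ≤ M ∧ (∀ t ∈ Icc 0 T, (q t : MixedSpace d) ∅ = p t) ∧
      (∀ a ∈ Icc 0 T, ∀ b ∈ Icc 0 T, ‖q b - q a‖ ≤ M * |b - a|) ∧
      ∀ t h, 0 ≤ h → t - h ∈ Icc 0 T → t + h ∈ Icc 0 T →
        ‖q (t + h) + q (t - h) - (2 : ℝ) • q t‖ ≤ M * h ^ 2 := by
  obtain ⟨hz, h⟩ := h
  choose g hg hp using h
  have hg0 : ∀ t ∈ Icc 0 T, g ∅ t = p t := by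
    intro t ht
    have := hp ∅ t ht
    rw [ind_empty, isWeakDeriv_zero_iff] at this
    exact this.symm
  have hmem : ∀ t ∈ Icc 0 T, WithLp.toLp 2 (fun S => g S t) ∈ presSpace d := by
    intro t ht
    refine ⟨?_, fun S => ?_⟩
    · change ZeroMean (g ∅ t)
      rw [hg0 t ht]
      exact hz t ht
    · change IsWeakDeriv (ind S) (g ∅ t) (g S t)
      rw [hg0 t ht]
      exact hp S t ht
  have hex : ∀ t, ∃ q : presSpace d, t ∈ Icc 0 T → ∀ S, (q : MixedSpace d) S = g S t := by
    intro t
    by_cases ht : t ∈ Icc 0 T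
    · exact ⟨⟨_, hmem t ht⟩, fun _ S => rfl⟩
    · exact ⟨0, fun h => absurd h ht⟩
  choose q hq using hex
  choose M hM0 hM using fun S => (hg S).lipschitz (by norm_num)
  choose M' hM0' hM' using fun S => (hg S).second_difference (by norm_num)
  refine ⟨q, ∑ S, (M S + M' S), Finset.sum_nonneg (fun S _ => add_nonneg (hM0 S) (hM0' S)),
    fun t ht => (hq t ht ∅).trans (hg0 t ht), fun a ha b hb => ?_, fun t h hh h1 h2 => ?_⟩
  · rw [Finset.sum_mul]
    refine presSpace_norm_le (fun S => ?_)
    simp only [Submodule.coe_sub, PiLp.sub_apply, hq a ha, hq b hb]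
    have := hM S a ha b hb
    have h3 := mul_nonneg (hM0' S) (abs_nonneg (b - a))
    linarith
  · rw [Finset.sum_mul]
    refine presSpace_norm_le (fun S => ?_)
    have ht : t ∈ Icc 0 T := ⟨by linarith [h1.1], by linarith [h2.2]⟩
    simp only [Submodule.coe_sub, Submodule.coe_add, Submodule.coe_smul, PiLp.sub_apply,
      PiLp.add_apply, PiLp.smul_apply, hq _ h1, hq _ h2, hq t ht]
    have := hM' S t h hh h1 h2
    have h3 := mul_nonneg (hM0 S) (sq_nonneg h)
    linarith

/-! ### The error equations -/

lemma IsWeakGrad.sub {q q' : L2 d} {G G' : VL2 d} (h : IsWeakGrad q G) (h' : IsWeakGrad q' G') :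
    IsWeakGrad (q - q') (G - G') := by
  intro i
  have h1 := h i
  have h2 := h' i
  rw [isWeakDeriv_iff] at *
  intro ψ hψ
  rw [inner_sub_left, h1 ψ hψ, h2 ψ hψ, PiLp.sub_apply, inner_sub_left]
  ring

lemma InDomB.sub {τ : ℝ} {v w : VL2 d} (hv : InDomB τ v) (hw : InDomB τ w) :
    InDomB τ (v - w) := by
  obtain ⟨g, hg⟩ := hv
  obtain ⟨g', hg'⟩ := hw
  refine ⟨g - g', fun j n => ?_⟩
  simp only [PiLp.sub_apply, coef_sub, hg, hg']
  ring

lemma adjoint_presGrad_eq {U : VL2 d} {D : L2 d} (hU : ∀ j, MemH10 (U j)) (hD : IsWeakDiv U D)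
    (q : presSpace d) : inner ℝ (ContinuousLinearMap.adjoint (presGrad d) U) q
      = - inner ℝ D ((q : MixedSpace d) ∅) := by
  rw [ContinuousLinearMap.adjoint_inner_left, inner_div_eq hU hD, neg_neg]

lemma adjoint_presGrad_eq_zero {U : VL2 d} (hU : ∀ j, MemH10 (U j)) (hD : IsWeakDiv U 0) :
    ContinuousLinearMap.adjoint (presGrad d) U = 0 := by
  refine ext_inner_right ℝ (fun q => ?_)
  rw [adjoint_presGrad_eq hU hD, inner_zero_left, inner_zero_left, neg_zero]

/-- Both sides represent the functional q ↦ -τ⁻¹⟨div U, q⟩ for the inner product of Y, hence agree.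
This turns the penalty equation into an exact adjoint relation with the gradient in the momentum
equation. -/
lemma IsA.eq_adjoint {τ : ℝ} {U : VL2 d} {D φ : L2 d} (hU : ∀ j, MemH10 (U j))
    (hD : IsWeakDiv U D) (hA : IsA φ (-(τ⁻¹ • D))) :
    ((τ⁻¹ • ContinuousLinearMap.adjoint (presGrad d) U : presSpace d) : MixedSpace d) ∅ = φ := by
  obtain ⟨y, rfl, hy⟩ := hA.exists_lift
  have : τ⁻¹ • ContinuousLinearMap.adjoint (presGrad d) U = y := by
    refine ext_inner_right ℝ (fun q => ?_)
    refine (real_inner_smul_left (F := presSpace d) _ _ _).trans ?_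
    rw [hy, adjoint_presGrad_eq hU hD, inner_neg_left, real_inner_smul_left, mul_neg]
  rw [this]

lemma IsSchemeSolution.inDomB (hd : d = 2 ∨ d = 3) {χ τ : ℝ} (hτ : 0 < τ) {N : ℕ}
    {f : ℝ → VL2 d} {u₀ : VL2 d} {p₀ φstar : L2 d} {U : ℕ → VL2 d} {P Φ : ℕ → L2 d}
    (hS : IsSchemeSolution χ τ N f u₀ p₀ φstar U P Φ) (h0 : InDomB τ u₀) :
    ∀ k ≤ N, InDomB τ (U k)
  | 0, _ => by rw [hS.init_velocity]; exact h0
  | k + 1, hk => by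
    obtain ⟨G, -, hG⟩ := hS.velocity k hk
    exact hG.inDomB hd hτ (hS.inDomB hd hτ h0 k (Nat.le_of_succ_le hk))

/-! ### Pressure times and the size of the sources. -/

/-- The times at which the discrete pressures live. -/
def presTime (τ : ℝ) : ℕ → ℝ
  | 0 => 0
  | k + 1 => ((k : ℝ) + 1 / 2) * τ

lemma presTime_mem {τ T : ℝ} (hτ : 0 < τ) {N : ℕ} (hN : N * τ ≤ T) :
    ∀ k ≤ N, presTime τ k ∈ Icc 0 T
  | 0, _ => ⟨le_rfl, (by positivity : (0 : ℝ) ≤ N * τ).trans hN⟩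
  | k + 1, hk => by
    have h1 : ((k : ℝ) + 1) ≤ N := by exact_mod_cast hk
    refine ⟨?_, ?_⟩
    · change 0 ≤ ((k : ℝ) + 1 / 2) * τ
      positivity
    · change ((k : ℝ) + 1 / 2) * τ ≤ T
      nlinarith

lemma presTime_succ_succ (τ : ℝ) (k : ℕ) : presTime τ (k + 2) = presTime τ (k + 1) + τ := by
  simp only [presTime]
  push_cast
  ring

lemma abs_presTime_sub_le {τ : ℝ} (hτ : 0 < τ) (k : ℕ) :
    |presTime τ (k + 1) - presTime τ k| ≤ τ := by
  cases k with
  | zero =>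
    simp only [presTime]
    rw [abs_of_nonneg (by push_cast; nlinarith)]
    push_cast
    linarith
  | succ k =>
    rw [presTime_succ_succ, add_sub_cancel_left, abs_of_pos hτ]

lemma presError_eq (τ : ℝ) (p : ℝ → L2 d) (P : ℕ → L2 d) (k : ℕ) :
    presError τ p P k = p (presTime τ k) - P k := by
  cases k <;> rfl

/-- Separates the two start-up sources, which are larger by a factor 1/τ, from the regular ones;
only the latter are multiplied by N. -/
lemma sum_le_of_two_large {N : ℕ} {a : ℕ → ℝ} {A B : ℝ} (hA : 0 ≤ A) (hB : 0 ≤ B)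
    (h : ∀ k < N, a k ≤ if k < 2 then A else B) :
    ∑ k ∈ Finset.range N, a k ≤ 2 * A + N * B := by
  have h1 : ∀ k ∈ Finset.range N,
      a k ≤ B + ((if k = 0 then A else 0) + (if k = 1 then A else 0)) := by
    intro k hk
    refine (h k (Finset.mem_range.1 hk)).trans ?_
    rcases k with _ | _ | k
    · simp [hB]
    · simp [hB]
    · simp
  refine (Finset.sum_le_sum h1).trans ?_
  rw [Finset.sum_add_distrib, Finset.sum_add_distrib, Finset.sum_ite_eq', Finset.sum_ite_eq',
    Finset.sum_const, Finset.card_range, nsmul_eq_mul]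
  split_ifs <;> linarith

/-- The right hand sides of the equations for the increments of the errors. -/
def incrRhs (τ : ℝ) (R : ℕ → VL2 d) (Q : VL2 d) (D : ℕ → presSpace d) : ℕ → VL2 d
  | 0 => τ • (R 0 - Q)
  | 1 => τ • (R 1 - R 0) + τ • Q - τ • presGrad d (D 2)
  | k + 2 => τ • (R (k + 2) - R (k + 1)) - τ • presGrad d (D (k + 3) - D (k + 2))

/-- From index 2 on the pressure increments are taken over equal intervals, and their differences
are O(τ²). Before that, `D 0` = 0 and the first interval is half as long, so only O(τ) is available,
as for `Q₀`; one factor τ still makes these sources O(τ²). Differences of `R` need no extra order: N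
of them, each O(τ³), sum to O(τ²). -/
lemma sum_incrRhs_le {T τ C M c₀ : ℝ} (hτ : 0 < τ) (hτT : τ ≤ T) (hC : 0 ≤ C) (hM : 0 ≤ M)
    {N : ℕ} (hN : N * τ ≤ T) {R : ℕ → VL2 d} (hRn : ∀ k < N, ‖R k‖ ≤ C * τ ^ 2) {Q₀ : VL2 d}
    (hQ₀n : ‖Q₀‖ ≤ c₀ * τ) {D : ℕ → presSpace d} (hD0 : D 0 = 0)
    (hDn : ∀ k < N, ‖D (k + 1)‖ ≤ M * τ)
    (hDn2 : ∀ k, k + 2 < N → ‖D (k + 3) - D (k + 2)‖ ≤ M * τ ^ 2) :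
    ∑ k ∈ Finset.range N, (2 * ‖incrRhs τ R Q₀ D k‖ + 2 * (τ * ‖D (k + 1) - D k‖))
      ≤ (2 + T) * (4 * C * T + 4 * C + 2 * |c₀| + 10 * M) * τ ^ 2 := by
  have hT0 : 0 ≤ T := hτ.le.trans hτT
  have hτ3 : τ ^ 3 ≤ T * τ ^ 2 := by
    rw [pow_succ']
    exact mul_le_mul_of_nonneg_right hτT (sq_nonneg _)
  have hCτ : C * τ ^ 3 ≤ C * (T * τ ^ 2) := mul_le_mul_of_nonneg_left hτ3 hC
  have hc₀ : c₀ * τ ^ 2 ≤ |c₀| * τ ^ 2 :=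
    mul_le_mul_of_nonneg_right (le_abs_self _) (sq_nonneg _)
  have hc₁ : 0 ≤ |c₀| * τ ^ 2 := by positivity
  have hMτ : 0 ≤ M * τ ^ 2 := by positivity
  have hCT : 0 ≤ C * (T * τ ^ 2) := by positivity
  have hCτ2 : 0 ≤ C * τ ^ 2 := by positivity
  obtain ⟨K, hK⟩ : ∃ K, K = 4 * C * T + 4 * C + 2 * |c₀| + 10 * M := ⟨_, rfl⟩
  have hK0 : 0 ≤ K := by rw [hK]; positivity
  rw [← hK]
  have hns : ∀ v : VL2 d, ‖τ • v‖ = τ * ‖v‖ := fun v => by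
    rw [norm_smul, Real.norm_of_nonneg hτ.le]
  have hRd : ∀ k, k + 1 < N → ‖R (k + 1) - R k‖ ≤ 2 * (C * τ ^ 2) := by
    intro k hk
    have := norm_sub_le (R (k + 1)) (R k)
    have h1 := hRn (k + 1) hk
    have h2 := hRn k (Nat.lt_of_succ_lt hk)
    linarith
  refine (sum_le_of_two_large (A := K * τ ^ 2) (B := K * τ ^ 3) (by positivity) (by positivity)
    (fun k hk => ?_)).trans ?_
  · rcases k with _ | _ | k
    · rw [if_pos (by norm_num), hD0, sub_zero]
      change 2 * ‖τ • (R 0 - Q₀)‖ + _ ≤ _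
      have h1 := norm_sub_le (R 0) Q₀
      have h2 := hRn 0 hk
      have h3 := hDn 0 hk
      have h4 : τ * ‖R 0 - Q₀‖ ≤ τ * (C * τ ^ 2 + c₀ * τ) :=
        mul_le_mul_of_nonneg_left (by linarith) hτ.le
      have h5 : τ * ‖D (0 + 1)‖ ≤ τ * (M * τ) := mul_le_mul_of_nonneg_left h3 hτ.le
      rw [hns, hK]
      linarith
    · rw [if_pos (by norm_num)]
      change 2 * ‖τ • (R 1 - R 0) + τ • Q₀ - τ • presGrad d (D 2)‖
        + 2 * (τ * ‖D 2 - D 1‖) ≤ _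
      have h1 := norm_sub_le (τ • (R 1 - R 0) + τ • Q₀) (τ • presGrad d (D 2))
      have h2 := norm_add_le (τ • (R 1 - R 0)) (τ • Q₀)
      rw [hns, hns] at h2
      rw [hns (presGrad d (D 2))] at h1
      have h3 := hDn 1 hk
      have h4 := hDn 0 (Nat.lt_of_succ_lt hk)
      have h5 := norm_sub_le (D 2) (D 1)
      have h6 : τ * ‖R 1 - R 0‖ ≤ τ * (2 * (C * τ ^ 2)) :=
        mul_le_mul_of_nonneg_left (hRd 0 hk) hτ.le
      have h7 : τ * ‖Q₀‖ ≤ τ * (c₀ * τ) := mul_le_mul_of_nonneg_left hQ₀n hτ.le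
      have h8 : τ * ‖presGrad d (D 2)‖ ≤ τ * (M * τ) :=
        mul_le_mul_of_nonneg_left ((norm_presGrad_le _).trans h3) hτ.le
      have h9 : τ * ‖D 2 - D 1‖ ≤ τ * (M * τ + M * τ) :=
        mul_le_mul_of_nonneg_left (h5.trans (add_le_add h3 h4)) hτ.le
      rw [hK]
      linarith
    · rw [if_neg (by omega)]
      change 2 * ‖τ • (R (k + 2) - R (k + 1)) - τ • presGrad d (D (k + 3) - D (k + 2))‖
        + 2 * (τ * ‖D (k + 3) - D (k + 2)‖) ≤ _
      have h1 := norm_sub_le (τ • (R (k + 2) - R (k + 1)))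
        (τ • presGrad d (D (k + 3) - D (k + 2)))
      rw [hns, hns] at h1
      have h2 := hDn2 k hk
      have h3 : τ * ‖R (k + 2) - R (k + 1)‖ ≤ τ * (2 * (C * τ ^ 2)) :=
        mul_le_mul_of_nonneg_left (hRd (k + 1) hk) hτ.le
      have h4 : τ * ‖presGrad d (D (k + 3) - D (k + 2))‖ ≤ τ * (M * τ ^ 2) :=
        mul_le_mul_of_nonneg_left ((norm_presGrad_le _).trans h2) hτ.le
      have h5 : τ * ‖D (k + 3) - D (k + 2)‖ ≤ τ * (M * τ ^ 2) :=
        mul_le_mul_of_nonneg_left h2 hτ.le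
      have h6 : 0 ≤ (4 * C * T + 2 * |c₀| + 6 * M) * τ ^ 3 := by positivity
      rw [hK]
      linarith
  · have : N * (K * τ ^ 3) = (N * τ) * (K * τ ^ 2) := by ring
    rw [this]
    have h1 : (N * τ) * (K * τ ^ 2) ≤ T * (K * τ ^ 2) :=
      mul_le_mul_of_nonneg_right hN (by positivity)
    linarith

-- Stability is applied to E = δe, with r_k = D_k - Y_k, where D is the increment of the exact
-- pressure and Y_k = τ⁻¹∇*u^k, which is the discrete increment for k ≥ 1. The predicted increment
-- is ρ_{k+1} = D_{k+1} - Y_k.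
set_option maxHeartbeats 1000000 in
theorem error_estimate (hd : d = 2 ∨ d = 3) {T τ C M c₀ : ℝ} (hτ : 0 < τ) (hτT : τ ≤ T)
    (hC : 0 ≤ C) (hM : 0 ≤ M) {N : ℕ} (hN : N * τ ≤ T) {f : ℝ → VL2 d} {u₀ : VL2 d}
    {u : ℝ → VL2 d} {p : ℝ → L2 d} (hsol : IsStokesSolution T f u₀ u p)
    (hdom : ∀ t ∈ Icc 0 T, InDomB τ (u t)) {R : ℕ → VL2 d} (hRn : ∀ k < N, ‖R k‖ ≤ C * τ ^ 2)
    (hR : ∀ k < N, ∀ G, IsWeakGrad (p (((k : ℝ) + 1 / 2) * τ)) G → ∀ j n,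
        symM τ n * (coef (u (((k + 1 : ℕ) : ℝ) * τ) j) n - coef (u ((k : ℝ) * τ) j) n)
          + τ / 2 * lam n * (coef (u (((k + 1 : ℕ) : ℝ) * τ) j) n + coef (u ((k : ℝ) * τ) j) n)
          + τ * coef (G j) n
        = τ * coef (f (((k : ℝ) + 1 / 2) * τ) j) n + τ * coef (R k j) n)
    {q : ℝ → presSpace d} (hq0 : ∀ t ∈ Icc 0 T, (q t : MixedSpace d) ∅ = p t)
    (hq1 : ∀ a ∈ Icc 0 T, ∀ b ∈ Icc 0 T, ‖q b - q a‖ ≤ M * |b - a|)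
    (hq2 : ∀ t h, 0 ≤ h → t - h ∈ Icc 0 T → t + h ∈ Icc 0 T →
        ‖q (t + h) + q (t - h) - (2 : ℝ) • q t‖ ≤ M * h ^ 2)
    {φstar : L2 d} {Q₀ : VL2 d} (hQ₀ : IsWeakGrad (p (τ / 2) - (p 0 + φstar)) Q₀)
    (hQ₀n : ‖Q₀‖ ≤ c₀ * τ) {U : ℕ → VL2 d} {P Φ : ℕ → L2 d}
    (hS : IsSchemeSolution 0 τ N f u₀ (p 0) φstar U P Φ) :
    linfNorm N normL2 (incr (velError τ u U)) + l2Norm τ N normH1 (incr (velError τ u U))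
      + ENNReal.ofReal τ * linfNorm N normA (incr (presError τ p P))
      + ENNReal.ofReal τ * linfNorm N (normB τ) (incr (velError τ u U))
      ≤ ENNReal.ofReal (8 * ((2 + T) * (4 * C * T + 4 * C + 2 * |c₀| + 10 * M)) * τ ^ 2) := by
  have hT0 : 0 ≤ T := hτ.le.trans hτT
  have ht : ∀ k ≤ N, (k : ℝ) * τ ∈ Icc 0 T := by
    intro k hk
    refine ⟨by positivity, le_trans ?_ hN⟩
    exact mul_le_mul_of_nonneg_right (by exact_mod_cast hk) hτ.le
  have h0mem : (0 : ℝ) ∈ Icc 0 T := ⟨le_rfl, hT0⟩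
  have hU : ∀ k ≤ N, InDomB τ (U k) :=
    hS.inDomB hd hτ (by rw [← hsol.initial]; exact hdom 0 h0mem)
  set s := presTime τ with hs
  have hsm := presTime_mem hτ hN
  set Y : ℕ → presSpace d := fun k => τ⁻¹ • ContinuousLinearMap.adjoint (presGrad d) (U k) with hY
  have hu0 : ∀ t ∈ Icc 0 T, ContinuousLinearMap.adjoint (presGrad d) (u t) = 0 := fun t ht =>
    adjoint_presGrad_eq_zero ((hdom t ht).memH10 hd hτ.le) (hsol.incompressible t ht)
  -- Since the initial velocity is solenoidal, `Y 0` vanishes. It is not φ^⋆; the discrepancy is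
  -- carried by `Q₀` in the first two sources.
  have hY0 : Y 0 = 0 := by
    simp only [hY]
    rw [hS.init_velocity, ← hsol.initial, hu0 0 h0mem, smul_zero]
  have hYΦ : ∀ k < N, (Y (k + 1) : MixedSpace d) ∅ = Φ (k + 1) := by
    intro k hk
    obtain ⟨D, hD, hA⟩ := hS.penalty k hk
    exact hA.eq_adjoint ((hU (k + 1) hk).memH10 hd hτ.le) hD
  have hPs : ∀ k < N, P (k + 1) = P k + Φ (k + 1) := by
    intro k hk
    obtain ⟨D, -, hP⟩ := hS.pressure k hk
    rw [hP, zero_smul, sub_zero]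
  obtain ⟨PY, hPY0, hPYs⟩ : ∃ PY : ℕ → presSpace d, PY 0 = q 0 ∧
      ∀ k, PY (k + 1) = PY k + Y (k + 1) :=
    ⟨fun k => q 0 + ∑ l ∈ Finset.range k, Y (l + 1), by simp, fun k => by
      simp only [Finset.sum_range_succ, add_assoc]⟩
  have hPY : ∀ k ≤ N, (PY k : MixedSpace d) ∅ = P k := by
    intro k
    induction k with
    | zero =>
      intro _
      rw [hPY0, hq0 0 h0mem, hS.init_pressure]
    | succ k ih =>
      intro hk
      rw [hPYs, Submodule.coe_add, PiLp.add_apply, ih (Nat.le_of_succ_le hk), hYΦ k hk, hPs k hk]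
  have hex : ∀ k, ∃ G : VL2 d, k < N → IsWeakGrad (P k + Φ k) G ∧
      VelocityStep d τ (U k) (U (k + 1)) G (f (((k : ℝ) + 1 / 2) * τ)) := by
    intro k
    by_cases hk : k < N
    · obtain ⟨G, hG⟩ := hS.velocity k hk
      exact ⟨G, fun _ => hG⟩
    · exact ⟨0, fun h => absurd h hk⟩
  choose G hG using hex
  have hGp : ∀ k < N, IsWeakGrad (p (((k : ℝ) + 1 / 2) * τ)) (presGrad d (q (s (k + 1)))) := by
    intro k hk
    have := isWeakGrad_presGrad (q (s (k + 1)))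
    rwa [hq0 _ (hsm (k + 1) hk)] at this
  have hGs : ∀ k, k + 1 < N → G (k + 1) = presGrad d (PY (k + 1) + Y (k + 1)) := by
    intro k hk
    refine (hG (k + 1) hk).1.unique ?_
    have := isWeakGrad_presGrad (PY (k + 1) + Y (k + 1))
    rwa [Submodule.coe_add, PiLp.add_apply, hPY (k + 1) hk.le,
      hYΦ k (Nat.lt_of_succ_lt hk)] at this
  have hG0 : 0 < N → presGrad d (q (s 1)) - G 0 = Q₀ := by
    intro h
    refine IsWeakGrad.unique ?_ hQ₀
    have h1 := (hGp 0 h).sub (hG 0 h).1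
    rw [hS.init_pressure, hS.init_correction] at h1
    convert h1 using 3
    push_cast
    ring
  set e := velError τ u U with he
  have hee : ∀ k j n, coef (e k j) n = coef (u ((k : ℝ) * τ) j) n - coef (U k j) n := by
    intro k j n
    rw [he, velError, PiLp.sub_apply, coef_sub]
  have he0 : e 0 = 0 := by
    simp [he, velError, hS.init_velocity, hsol.initial]
  have hestep : ∀ k < N, ∀ j n, symM τ n * (coef (e (k + 1) j) n - coef (e k j) n)
      + τ / 2 * lam n * (coef (e (k + 1) j) n + coef (e k j) n)
      + τ * coef ((presGrad d (q (s (k + 1))) - G k) j) n = τ * coef (R k j) n := by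
    intro k hk j n
    have h1 := hR k hk _ (hGp k hk) j n
    have h2 := (hG k hk).2.coef_eq hd hτ (hU k hk.le) j n
    rw [hee, hee, PiLp.sub_apply, coef_sub]
    linear_combination h1 - h2
  set E := incr e with hE
  have hEs : ∀ k, E (k + 1) = e (k + 1) - e k := fun k => rfl
  have hE0 : E 0 = 0 := sub_self _
  set D : ℕ → presSpace d := incr (fun k => q (s k)) with hD
  have hDs : ∀ k, D (k + 1) = q (s (k + 1)) - q (s k) := fun k => rfl
  have hD0 : D 0 = 0 := sub_self _
  -- The sum is D_{k+1} - Y_k, left in the form r_k + σ_k that the stability estimate requires.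
  obtain ⟨ρ, hρ0, hρs⟩ : ∃ ρ : ℕ → presSpace d, ρ 0 = 0 ∧
      ∀ k, ρ (k + 1) = (D k - Y k) + (D (k + 1) - D k) :=
    ⟨fun k => Nat.casesOn k 0 (fun k => (D k - Y k) + (D (k + 1) - D k)), rfl, fun _ => rfl⟩
  -- The increment of the predictor error is D_{k+2} - 2Y_{k+1} + Y_k once φ^⋆ has left the scheme,
  -- whereas 2r_{k+1} - ρ_{k+1} = D_{k+1} - 2Y_{k+1} + Y_k. They differ by a second difference of
  -- the exact pressure. The case k = 0 is special, since the earlier predictor error has gradient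
  -- `Q₀`.
  have hφ : ∀ k, k + 1 < N → incrRhs τ R Q₀ D (k + 1) = τ • (R (k + 1) - R k)
      - τ • ((presGrad d (q (s (k + 2))) - G (k + 1)) - (presGrad d (q (s (k + 1))) - G k))
      + τ • presGrad d (2 • (D (k + 1) - Y (k + 1)) - ρ (k + 1)) := by
    intro k hk
    rcases k with _ | k
    · rw [hG0 (Nat.zero_lt_of_lt hk), hGs 0 hk, hρs, hPYs, hPY0, hD0, hY0, hDs 0]
      change τ • (R 1 - R 0) + τ • Q₀ - τ • presGrad d (D 2) = _
      rw [hDs 1, show q (s 0) = q 0 from rfl]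
      simp only [map_sub, map_add, map_nsmul, map_zero, zero_add]
      module
    · rw [hGs (k + 1) hk, hGs k (Nat.lt_of_succ_lt hk), hρs, hPYs (k + 1)]
      change τ • (R (k + 2) - R (k + 1)) - τ • presGrad d (D (k + 3) - D (k + 2)) = _
      rw [hDs (k + 2), hDs (k + 1)]
      simp only [map_sub, map_add, map_nsmul]
      module
  have hDn : ∀ k < N, ‖D (k + 1)‖ ≤ M * τ := by
    intro k hk
    rw [hDs]
    exact (hq1 _ (hsm k hk.le) _ (hsm (k + 1) hk)).trans
      (mul_le_mul_of_nonneg_left (abs_presTime_sub_le hτ k) hM)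
  have hDn2 : ∀ k, k + 2 < N → ‖D (k + 3) - D (k + 2)‖ ≤ M * τ ^ 2 := by
    intro k hk
    have h1 : s (k + 3) = s (k + 2) + τ := presTime_succ_succ τ (k + 1)
    have h2 : s (k + 1) = s (k + 2) - τ := by
      rw [show s (k + 2) = s (k + 1) + τ from presTime_succ_succ τ k]
      ring
    have m1 := hsm (k + 3) hk
    have m2 := hsm (k + 1) (by omega)
    have h3 := hq2 (s (k + 2)) τ hτ.le (by rw [← h2]; exact m2) (by rw [← h1]; exact m1)
    rw [hDs, hDs, show k + 2 + 1 = k + 3 from rfl, show k + 1 + 1 = k + 2 from rfl, h1, h2]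
    refine le_of_eq_of_le ?_ h3
    congr 1
    module
  have hsum := sum_incrRhs_le hτ hτT hC hM hN hRn hQ₀n hD0 hDn hDn2
  set K := 4 * C * T + 4 * C + 2 * |c₀| + 10 * M with hK
  have hK0 : 0 ≤ K := by positivity
  have hedom : ∀ k ≤ N, InDomB τ (e k) := fun k hk => (hdom _ (ht k hk)).sub (hU k hk)
  have hEdom : ∀ k ≤ N, InDomB τ (E k) := by
    intro k hk
    cases k with
    | zero => exact (hedom 0 hk).sub (hedom 0 hk)
    | succ k => exact (hedom (k + 1) hk).sub (hedom k (Nat.le_of_succ_le hk))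
  obtain ⟨b1, b2, b3, b4⟩ := splitting_stability hd hτ N E (fun k => D k - Y k) ρ
    (fun k => D (k + 1) - D k) (incrRhs τ R Q₀ D) hE0 (by rw [hD0, hY0, sub_zero]) hρ0 hEdom
    (fun k hk j n => by
      rcases k with _ | k
      · have h1 := hestep 0 hk j n
        rw [hG0 hk, he0] at h1
        change _ = coef ((τ • (R 0 - Q₀)) j) n
        rw [hE0, hEs, he0, hD0, hY0, hρ0]
        simp only [PiLp.smul_apply, PiLp.sub_apply, coef_smul, coef_sub, sub_zero, smul_zero,
          map_zero, PiLp.zero_apply, coef_zero] at h1 ⊢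
        linear_combination h1
      · have h1 := hestep (k + 1) hk j n
        have h2 := hestep k (Nat.lt_of_succ_lt hk) j n
        rw [hφ k hk, hEs, hEs]
        simp only [PiLp.smul_apply, PiLp.sub_apply, PiLp.add_apply, coef_smul, coef_sub,
          coef_add] at h1 h2 ⊢
        linear_combination h1 - h2)
    -- The exact velocity is annihilated by the adjoint gradient, so τ⁻¹∇*E_{k+1} = Y_k - Y_{k+1}.
    (fun k _ => hρs k) (fun k hk => by
      rw [hρs, hEs, he, velError, velError, map_sub, map_sub, map_sub, hu0 _ (ht (k + 1) hk),
        hu0 _ (ht k hk.le)]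
      simp only [hY]
      module)
    hsum
  have hr : linfNorm N normA (incr (presError τ p P))
      = linfNorm N normA (fun k => ((D k - Y k : presSpace d) : MixedSpace d) ∅) := by
    refine iSup_congr (fun k => iSup_congr (fun hk => ?_))
    obtain ⟨hk1, hk2⟩ := Finset.mem_Icc.1 hk
    obtain ⟨k, rfl⟩ := Nat.exists_eq_add_of_le' hk1
    congr 1
    beta_reduce
    rw [hDs, Submodule.coe_sub, Submodule.coe_sub, PiLp.sub_apply, PiLp.sub_apply,
      hq0 _ (hsm _ hk2), hq0 _ (hsm k (Nat.le_of_succ_le hk2)), hYΦ k hk2, incr,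
      Nat.add_sub_cancel, presError_eq, presError_eq, hPs k hk2]
    abel
  rw [hr]
  -- The four constants 2, 1, 1 and 4 of the stability estimate add up to 8.
  refine (add_le_add (add_le_add (add_le_add b1 b2) b3) b4).trans ?_
  have hΓ0 : 0 ≤ (2 + T) * K * τ ^ 2 := by positivity
  rw [← ENNReal.ofReal_add (by positivity) hΓ0, ← ENNReal.ofReal_add (by positivity) hΓ0,
    ← ENNReal.ofReal_add (by positivity) (by positivity)]
  refine ENNReal.ofReal_le_ofReal (le_of_eq ?_)
  ring

end DirSplit
end

/-! ### The error estimate with a constant independent of τ. -/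

theorem mainTheorem2 (d : ℕ) (hd : d = 2 ∨ d = 3) (T : ℝ) (hT : 0 < T)
    (f : ℝ → DirSplit.VL2 d) (u₀ : DirSplit.VL2 d)
    (u : ℝ → DirSplit.VL2 d) (p : ℝ → DirSplit.L2 d)
    (hsol : DirSplit.IsStokesSolution T f u₀ u p)
    (huH2 : DirSplit.MemWInftyH2 3 T u)
    (huB : ∀ τ : ℝ, 0 < τ → DirSplit.MemWInftyDB τ 2 T u)
    (hpY : DirSplit.MemWInftyY 3 T p)
    (c₀ : ℝ) :
    ∃ c : ℝ, ∀ τ : ℝ, 0 < τ → τ ≤ T → ∀ N : ℕ, N = ⌊T / τ⌋₊ →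
      ∀ φstar : DirSplit.L2 d,
      (∃ G : DirSplit.VL2 d,
        DirSplit.IsWeakGrad (p (τ / 2) - (p 0 + φstar)) G ∧ ‖G‖ ≤ c₀ * τ) →
      ∀ (U : ℕ → DirSplit.VL2 d) (P Φ : ℕ → DirSplit.L2 d),
      DirSplit.IsSchemeSolution 0 τ N f u₀ (p 0) φstar U P Φ →
      DirSplit.linfNorm N DirSplit.normL2 (DirSplit.incr (DirSplit.velError τ u U))
        + DirSplit.l2Norm τ N DirSplit.normH1 (DirSplit.incr (DirSplit.velError τ u U))
        + ENNReal.ofReal τ *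
            DirSplit.linfNorm N DirSplit.normA (DirSplit.incr (DirSplit.presError τ p P))
        + ENNReal.ofReal τ *
            DirSplit.linfNorm N (DirSplit.normB τ) (DirSplit.incr (DirSplit.velError τ u U))
        ≤ ENNReal.ofReal (c * τ ^ 2) := by
  obtain ⟨C, hC, hcons⟩ := DirSplit.consistency hd hT hsol huH2 huB
  obtain ⟨q, M, hM, hq0, hq1, hq2⟩ := hpY.exists_lift
  refine ⟨8 * ((2 + T) * (4 * C * T + 4 * C + 2 * |c₀| + 10 * M)), ?_⟩
  rintro τ hτ hτT N rfl φstar ⟨Q₀, hQ₀, hQ₀n⟩ U P Φ hS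
  have hN : (⌊T / τ⌋₊ : ℝ) * τ ≤ T := by
    rw [← le_div_iff₀ hτ]
    exact Nat.floor_le (by positivity)
  choose R hRn hR using fun k : {k : ℕ // k < ⌊T / τ⌋₊} => hcons τ hτ k (by
    refine le_trans (mul_le_mul_of_nonneg_right ?_ hτ.le) hN
    exact_mod_cast k.2)
  classical
  -- Remainders exist only for steps inside [0,T]; the extension by 0 is never used.
  set R' : ℕ → DirSplit.VL2 d := fun k => if hk : k < ⌊T / τ⌋₊ then R ⟨k, hk⟩ else 0 with hR'
  have hRk : ∀ k (hk : k < ⌊T / τ⌋₊), R' k = R ⟨k, hk⟩ := fun k hk => by simp only [hR', hk, dif_pos]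
  refine DirSplit.error_estimate hd hτ hτT hC hM hN hsol (fun t ht => ?_) (R := R')
    (fun k hk => ?_) (fun k hk => ?_) hq0 hq1 hq2 hQ₀ hQ₀n hS
  · obtain ⟨-, g, -, hB⟩ := huB τ hτ
    exact ⟨g t, (hB t ht).coef_eq⟩
  · rw [hRk k hk]
    exact hRn ⟨k, hk⟩
  · rw [hRk k hk]
    exact hR ⟨k, hk⟩
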